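/- All schemes are over $\mathbb{C}$. On $\mathbb{P}^1\times\mathbb{P}^1$ let $\mathcal{O}(m,n)=\mathrm{pr}_1^*\mathcal{O}(m)\otimes\mathrm{pr}_2^*\mathcal{O}(n)$; a curve of bidegree $(a,b)$ is the zero scheme of a nonzero global section of $\mathcal{O}(a,b)$ (the empty scheme if $a=b=0$), and a curve of bidegree $(1,0)$ or $(0,1)$ is called a line. Let $Z\subset\mathbb{P}^1\times\mathbb{P}^1$ be a zero-dimensional (that is, finite, possibly empty) closed subscheme with ideal sheaf $\mathcal{I}_Z$. Let $\mu(Z)$ be the smallest integer $\mu\ge 0$ such that $Z$ is contained in a curve of bidegree $(\mu,0)$, and let $M(Z)$ be the (unique) such curve of bidegree $(\mu(Z),0)$. Write $M(Z)=\bigcup_{1\le i\le\kappa(Z)}\mu_iD_i$ with distinct lines $D_i$ of bidegree $(1,0)$ and multiplicities $\mu_i\ge 1$, and let $X_i$ be the open and closed subscheme of $Z$ that is concentrated on $D_i$. Likewise let $\nu(Z)$ be the smallest integer $\nu\ge 0$ such that $Z$ is contained in a curve of bidegree $(0,\nu)$, let $N(Z)=\bigcup_{1\le j\le\lambda(Z)}\nu_jE_j$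 be the curve of bidegree $(0,\nu(Z))$ containing $Z$, with distinct lines $E_j$ of bidegree $(0,1)$, and let $Y_j$ be the open and closed subscheme of $Z$ concentrated on $E_j$. For a finite subscheme $X$ of a multiple line $kL$, $k\ge 1$, define the string $\rho(X,kL)=(r_0,\dots,r_{k-1})$ inductively: if $k=1$, then $r_0=\operatorname{length}(X)$; if $k\ge 2$, then $r_0=\operatorname{length}(X\cap L)$ and $(r_1,\dots,r_{k-1})=\rho(X',(k-1)L)$, where $X'\subset(k-1)L$ is the residual scheme, with ideal sheaf $(\mathcal{I}_X:\mathcal{I}_L)$, so that the ideal sheaf of $X\cap L$ in $X$ is isomorphic to $\mathcal{O}_{X'}$. Put $\sigma(X_i)=\rho(X_i,M(X_i))$, where $M(X_i)=\mu(X_i)D_i=\mu_iD_i$, and $\tau(Y_j)=\rho(Y_j,N(Y_j))$, where $N(Y_j)=\nu(Y_j)E_j=\nu_jE_j$. Let $m,n$ be integers. (a) Assume that $m\ge\mu(Z)-1$ and $n\ge-1$. Then $H^1(\mathcal{I}_Z(m,n))$ is finite-dimensional and $$\dim_{\mathbb{C}}H^1(\mathcal{I}_Z(m,n))=\sum_{1\le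 i\le\kappa(Z)}\ \sum_{\substack{0\le j\le\mu_i-1\\ \sigma(X_i)_j>n+1}}\bigl(\sigma(X_i)_j-n-1\bigr).$$ If, in addition, $\operatorname{length}(Z\cap D)\le n+1$ for every line $D$ of bidegree $(1,0)$, then $H^1(\mathcal{I}_Z(m,n))=\{0\}$. (b) Assume that $n\ge\nu(Z)-1$ and $m\ge-1$. Then $H^1(\mathcal{I}_Z(m,n))$ is finite-dimensional and $$\dim_{\mathbb{C}}H^1(\mathcal{I}_Z(m,n))=\sum_{1\le j\le\lambda(Z)}\ \sum_{\substack{0\le i\le\nu_j-1\\ \tau(Y_j)_i>m+1}}\bigl(\tau(Y_j)_i-m-1\bigr).$$ If, in addition, $\operatorname{length}(Z\cap E)\le m+1$ for every line $E$ of bidegree $(0,1)$, then $H^1(\mathcal{I}_Z(m,n))=\{0\}$. -/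

import Mathlib

open CategoryTheory CategoryTheory.Limits AlgebraicGeometry TopologicalSpace

noncomputable section

namespace Quadric

/-! ### The projective line and the quadric surface over `ℂ` -/

/-- The standard grading of the polynomial ring `ℂ[X₀, X₁]`. -/
abbrev grading : ℕ → Submodule ℂ (MvPolynomial (Fin 2) ℂ) :=
  MvPolynomial.homogeneousSubmodule (Fin 2) ℂ

instance : GradedAlgebra grading := MvPolynomial.gradedAlgebra

/-- The complex projective line `ℙ¹ = Proj ℂ[X₀, X₁]`. -/
def line : Scheme.{0} := Proj grading

/-- The structure morphism of `ℙ¹`. -/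
def lineToSpec : line ⟶ Spec (CommRingCat.of ℂ) :=
  Proj.toSpecZero grading ≫ Spec.map (CommRingCat.ofHom (algebraMap ℂ (grading 0)))

/-- The quadric surface `ℙ¹ × ℙ¹` over `ℂ`. -/
def surface : Scheme.{0} := pullback lineToSpec lineToSpec

/-- The projection to the first `ℙ¹`, with homogeneous coordinates `(x : y)`. -/
def pr₁ : surface ⟶ line := pullback.fst lineToSpec lineToSpec

/-- The projection to the second `ℙ¹`, with homogeneous coordinates `(z : w)`. -/
def pr₂ : surface ⟶ line := pullback.snd lineToSpec lineToSpec

/-- The structure morphism of `ℙ¹ × ℙ¹`. -/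
def toSpec : surface ⟶ Spec (CommRingCat.of ℂ) := pr₁ ≫ lineToSpec

/-- The open subset of `ℙ¹` where the form `f` does not vanish. -/
def lineOpen (f : MvPolynomial (Fin 2) ℂ) : line.Opens := Proj.basicOpen grading f

/-- The four standard affine charts of `ℙ¹ × ℙ¹`: for `c = (a, b)`, the open subset where the `a`-th
coordinate of the first factor and the `b`-th coordinate of the second factor do not vanish. -/
def chart (c : Fin 2 × Fin 2) : surface.Opens :=
  pr₁ ⁻¹ᵁ lineOpen (MvPolynomial.X c.1) ⊓ pr₂ ⁻¹ᵁ lineOpen (MvPolynomial.X c.2)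

/-! ### Functions on open subsets as `ℂ`-algebras -/

/-- The constants in the ring of functions on an open subset of a `ℂ`-scheme. -/
def scalars {X : Scheme.{0}} (f : X ⟶ Spec (CommRingCat.of ℂ)) (V : X.Opens) : ℂ →+* Γ(X, V) :=
  ((Scheme.ΓSpecIso (CommRingCat.of ℂ)).inv ≫ f.appTop ≫
    X.presheaf.map (homOfLE (le_top : V ≤ ⊤)).op).hom

instance (V : surface.Opens) : Algebra ℂ Γ(surface, V) := (scalars toSpec V).toAlgebra

/-- Restriction of functions from `V` to a smaller open subset `W`. -/
def res {V W : surface.Opens} (h : W ≤ V) : Γ(surface, V) →ₐ[ℂ] Γ(surface, W) where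
  toRingHom := (surface.presheaf.map (homOfLE h).op).hom
  commutes' r := by
    have key : surface.presheaf.map (homOfLE (le_top : V ≤ ⊤)).op ≫
        surface.presheaf.map (homOfLE h).op = surface.presheaf.map (homOfLE le_top).op := by
      rw [← Functor.map_comp]
      rfl
    exact congrArg (fun φ => φ.hom (toSpec.appTop.hom
      ((Scheme.ΓSpecIso (CommRingCat.of ℂ)).inv.hom r))) key

lemma res_res {V W T : surface.Opens} (h : W ≤ V) (h' : T ≤ W) (f : Γ(surface, V)) :
    res h' (res h f) = res (h'.trans h) f := by
  change (surface.presheaf.map (homOfLE h').op).hom ((surface.presheaf.map (homOfLE h).op).hom f) =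
    (surface.presheaf.map (homOfLE (h'.trans h)).op).hom f
  rw [← CommRingCat.comp_apply, ← Functor.map_comp]
  rfl

/-! ### The line bundles `𝒪(m, n)` -/

lemma X_mul_X_mem (a b : Fin 2) :
    (MvPolynomial.X a * MvPolynomial.X b : MvPolynomial (Fin 2) ℂ) ∈ grading 2 :=
  (MvPolynomial.isHomogeneous_X ℂ a).mul (MvPolynomial.isHomogeneous_X ℂ b)

/-- The fraction `f / (X_a X_b)`, for a quadratic form `f`, as a function on the part of `ℙ¹` where
`X_a` and `X_b` do not vanish. -/
def frac (a b : Fin 2) (f : MvPolynomial (Fin 2) ℂ) (hf : f ∈ grading 2) :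
    HomogeneousLocalization.Away grading
      (MvPolynomial.X a * MvPolynomial.X b : MvPolynomial (Fin 2) ℂ) :=
  HomogeneousLocalization.Away.mk grading (X_mul_X_mem a b) 1 f (by rwa [one_smul])

/-- The invertible function `X_a / X_b = X_a² / (X_a X_b)`. -/
def ratio (a b : Fin 2) :
    (HomogeneousLocalization.Away grading
      (MvPolynomial.X a * MvPolynomial.X b : MvPolynomial (Fin 2) ℂ))ˣ where
  val := frac a b (MvPolynomial.X a ^ 2) (MvPolynomial.isHomogeneous_X_pow a 2)
  inv := frac a b (MvPolynomial.X b ^ 2) (MvPolynomial.isHomogeneous_X_pow b 2)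
  val_inv := by
    apply HomogeneousLocalization.val_injective
    simp only [frac, HomogeneousLocalization.val_mul, HomogeneousLocalization.Away.val_mk,
      HomogeneousLocalization.val_one, Localization.mk_mul, ← Localization.mk_one]
    rw [Localization.mk_eq_mk_iff, Localization.r_iff_exists]
    exact ⟨1, by simp; ring⟩
  inv_val := by
    apply HomogeneousLocalization.val_injective
    simp only [frac, HomogeneousLocalization.val_mul, HomogeneousLocalization.Away.val_mk,
      HomogeneousLocalization.val_one, Localization.mk_mul, ← Localization.mk_one]
    rw [Localization.mk_eq_mk_iff, Localization.r_iff_exists]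
    exact ⟨1, by simp; ring⟩

/-- `X_a / X_b` as an invertible function on the part of `ℙ¹` where `X_a X_b ≠ 0`. -/
def lineRatio (a b : Fin 2) :
    Γ(line, lineOpen (MvPolynomial.X a * MvPolynomial.X b))ˣ :=
  Units.map (Proj.awayToSection grading
    (MvPolynomial.X a * MvPolynomial.X b : MvPolynomial (Fin 2) ℂ)).hom.toMonoidHom (ratio a b)

lemma chart_le₁ (c d : Fin 2 × Fin 2) :
    chart c ⊓ chart d ≤ pr₁ ⁻¹ᵁ lineOpen (MvPolynomial.X c.1 * MvPolynomial.X d.1) := by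
  have h : lineOpen (MvPolynomial.X c.1 * MvPolynomial.X d.1) =
      lineOpen (MvPolynomial.X c.1) ⊓ lineOpen (MvPolynomial.X d.1) :=
    Proj.basicOpen_mul grading _ _
  rw [h]
  exact fun p hp => ⟨hp.1.1, hp.2.1⟩

lemma chart_le₂ (c d : Fin 2 × Fin 2) :
    chart c ⊓ chart d ≤ pr₂ ⁻¹ᵁ lineOpen (MvPolynomial.X c.2 * MvPolynomial.X d.2) := by
  have h : lineOpen (MvPolynomial.X c.2 * MvPolynomial.X d.2) =
      lineOpen (MvPolynomial.X c.2) ⊓ lineOpen (MvPolynomial.X d.2) :=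
    Proj.basicOpen_mul grading _ _
  rw [h]
  exact fun p hp => ⟨hp.1.2, hp.2.2⟩

/-- `x_c / x_d`, where `x_c` is the coordinate of the first factor that is invertible on the chart
`c`, as an invertible function on the intersection of the charts `c` and `d`. -/
def ratio₁ (c d : Fin 2 × Fin 2) : Γ(surface, chart c ⊓ chart d)ˣ :=
  Units.map (res (chart_le₁ c d)).toRingHom.toMonoidHom
    (Units.map (pr₁.app _).hom.toMonoidHom (lineRatio c.1 d.1))

/-- `z_c / z_d`, where `z_c` is the coordinate of the second factor that is invertible on the chart
`c`, as an invertible function on the intersection of the charts `c` and `d`. -/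
def ratio₂ (c d : Fin 2 × Fin 2) : Γ(surface, chart c ⊓ chart d)ˣ :=
  Units.map (res (chart_le₂ c d)).toRingHom.toMonoidHom
    (Units.map (pr₂.app _).hom.toMonoidHom (lineRatio c.2 d.2))

/-- The transition function `(x_c / x_d)ᵐ (z_c / z_d)ⁿ` of `𝒪(m, n)`. -/
def transition (m n : ℤ) (c d : Fin 2 × Fin 2) : Γ(surface, chart c ⊓ chart d)ˣ :=
  ratio₁ c d ^ m * ratio₂ c d ^ n

lemma inter_le_left (V : surface.Opens) (c d : Fin 2 × Fin 2) :
    V ⊓ (chart c ⊓ chart d) ≤ V ⊓ chart c := inf_le_inf_left _ inf_le_left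

lemma inter_le_right (V : surface.Opens) (c d : Fin 2 × Fin 2) :
    V ⊓ (chart c ⊓ chart d) ≤ V ⊓ chart d := inf_le_inf_left _ inf_le_right

/-- Sections of the line bundle `𝒪(m, n)` over the open subset `V`. A section is given by a function
`f c` on `V ∩ chart c` for each chart `c`, its expression `f c · x_cᵐ z_cⁿ` in the trivialisation
over the chart; the expressions have to agree on the overlaps. -/
def lineBundle (m n : ℤ) (V : surface.Opens) :
    Submodule ℂ (∀ c : Fin 2 × Fin 2, Γ(surface, V ⊓ chart c)) where
  carrier := {f | ∀ c d, res (inter_le_right V c d) (f d) =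
    res (inf_le_right : V ⊓ (chart c ⊓ chart d) ≤ _) (transition m n c d : Γ(surface, _)) *
      res (inter_le_left V c d) (f c)}
  add_mem' hf hg c d := by
    simp only [Pi.add_apply, map_add, hf c d, hg c d, mul_add]
  zero_mem' c d := by simp
  smul_mem' r f hf c d := by
    simp only [Pi.smul_apply, map_smul, hf c d, mul_smul_comm]

/-! ### Closed subschemes

A closed subscheme of `ℙ¹ × ℙ¹` is given by its quasi-coherent ideal sheaf; `I ≤ J` means that the
subscheme of `I` contains that of `J`, and `I ⊔ J` is the ideal sheaf of the scheme-theoretic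
intersection. -/

/-- The closed subscheme with ideal sheaf `I` is finite over `ℂ`, that is, zero-dimensional
(or empty). -/
def IsFiniteSubscheme (I : surface.IdealSheafData) : Prop :=
  IsFinite (I.subschemeι ≫ toSpec)

/-- The length `dim_ℂ H⁰(𝒪_Z)` of a finite subscheme `Z`. -/
def length (I : surface.IdealSheafData) : ℕ :=
  letI : Algebra ℂ Γ(I.subscheme, ⊤) := (scalars (I.subschemeι ≫ toSpec) ⊤).toAlgebra
  Module.finrank ℂ Γ(I.subscheme, ⊤)

/-- `C` is (the ideal sheaf of) a curve of bidegree `(a, b)`: the zero scheme of a nonzero global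
section of `𝒪(a, b)`. For `a = b = 0` this is the empty scheme. -/
def IsCurve (a b : ℤ) (C : surface.IdealSheafData) : Prop :=
  ∃ s ∈ lineBundle a b ⊤, s ≠ 0 ∧
    ∀ (c : Fin 2 × Fin 2) (W : surface.affineOpens) (hW : W.1 ≤ chart c),
      C.ideal W = Ideal.span {res (le_inf le_top hW : W.1 ≤ ⊤ ⊓ chart c) (s c)}

/-! ### The cohomology group `H¹(ℐ_Z(m, n))` -/

/-- Sections over `V` of the twisted ideal sheaf `ℐ_Z(m, n) = ℐ_Z ⊗ 𝒪(m, n)`: the sections of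
`𝒪(m, n)` whose expressions in the charts vanish on `Z`. -/
def twistedIdeal (I : surface.IdealSheafData) (m n : ℤ) (V : surface.Opens) :
    Submodule ℂ (∀ c : Fin 2 × Fin 2, Γ(surface, V ⊓ chart c)) where
  carrier := {f | f ∈ lineBundle m n V ∧ ∀ c, (I.subschemeι.app (V ⊓ chart c)).hom (f c) = 0}
  add_mem' hf hg := ⟨add_mem hf.1 hg.1, fun c => by
    rw [Pi.add_apply, map_add, hf.2 c, hg.2 c, add_zero]⟩
  zero_mem' := ⟨zero_mem _, fun c => by simp⟩
  smul_mem' r f hf := ⟨Submodule.smul_mem _ r hf.1, fun c => by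
    rw [Pi.smul_apply, Algebra.smul_def, map_mul, hf.2 c, mul_zero]⟩

/-- The vector space `H⁰(V, ℐ_Z(m, n))`. -/
def Sections (I : surface.IdealSheafData) (m n : ℤ) (V : surface.Opens) : Type :=
  twistedIdeal I m n V

instance (I : surface.IdealSheafData) (m n : ℤ) (V : surface.Opens) :
    AddCommGroup (Sections I m n V) :=
  inferInstanceAs (AddCommGroup (twistedIdeal I m n V))

instance (I : surface.IdealSheafData) (m n : ℤ) (V : surface.Opens) :
    Module ℂ (Sections I m n V) :=
  inferInstanceAs (Module ℂ (twistedIdeal I m n V))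

/-- Restriction of sections of `ℐ_Z(m, n)`. -/
def restrict (I : surface.IdealSheafData) (m n : ℤ) {V W : surface.Opens} (h : W ≤ V) :
    Sections I m n V →ₗ[ℂ] Sections I m n W where
  toFun f := ⟨fun c => res (inf_le_inf_right _ h) (f.1 c), by
    constructor
    · intro c d
      have := congrArg (res (inf_le_inf_right _ h :
        W ⊓ (chart c ⊓ chart d) ≤ V ⊓ (chart c ⊓ chart d))) (f.2.1 c d)
      simpa only [map_mul, res_res] using this
    · intro c
      have := I.subschemeι.naturality (homOfLE (inf_le_inf_right (chart c) h)).op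
      have h2 := congrArg (fun φ => φ.hom (f.1 c)) this
      simp only [CommRingCat.comp_apply, f.2.2 c, map_zero] at h2
      exact h2⟩
  map_add' f g := Subtype.ext (funext fun c =>
    map_add (res (inf_le_inf_right (chart c) h)) (f.1 c) (g.1 c))
  map_smul' r f := Subtype.ext (funext fun c =>
    map_smul (res (inf_le_inf_right (chart c) h)) r (f.1 c))

lemma restrict_restrict (I : surface.IdealSheafData) (m n : ℤ) {V W T : surface.Opens}
    (h : W ≤ V) (h' : T ≤ W) (f : Sections I m n V) :
    restrict I m n h' (restrict I m n h f) = restrict I m n (h'.trans h) f :=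
  Subtype.ext (funext fun c => res_res (inf_le_inf_right (chart c) h)
    (inf_le_inf_right (chart c) h') (f.1 c))

/-- The Čech differential in degree `0`, for the cover of `ℙ¹ × ℙ¹` by the four affine charts:
`(t_i) ↦ (t_j - t_i)`. -/
def cechD0 (I : surface.IdealSheafData) (m n : ℤ) :
    (∀ i, Sections I m n (chart i)) →ₗ[ℂ] (∀ i j, Sections I m n (chart i ⊓ chart j)) :=
  LinearMap.pi fun i => LinearMap.pi fun j =>
    restrict I m n inf_le_right ∘ₗ LinearMap.proj j -
      restrict I m n inf_le_left ∘ₗ LinearMap.proj i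

/-- The Čech differential in degree `1`: `(s_ij) ↦ (s_jk - s_ik + s_ij)`. -/
def cechD1 (I : surface.IdealSheafData) (m n : ℤ) :
    (∀ i j, Sections I m n (chart i ⊓ chart j)) →ₗ[ℂ]
      (∀ i j k, Sections I m n (chart i ⊓ chart j ⊓ chart k)) :=
  LinearMap.pi fun i => LinearMap.pi fun j => LinearMap.pi fun k =>
    restrict I m n (le_inf (inf_le_left.trans inf_le_right) inf_le_right) ∘ₗ
        LinearMap.proj k ∘ₗ LinearMap.proj j -
      restrict I m n (le_inf (inf_le_left.trans inf_le_left) inf_le_right) ∘ₗ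
        LinearMap.proj k ∘ₗ LinearMap.proj i +
      restrict I m n inf_le_left ∘ₗ LinearMap.proj j ∘ₗ LinearMap.proj i

lemma cechD1_cechD0 (I : surface.IdealSheafData) (m n : ℤ) (t) :
    cechD1 I m n (cechD0 I m n t) = 0 := by
  ext i j k
  simp [cechD1, cechD0, restrict_restrict]

/-- `H¹(ℐ_Z(m, n))`, computed as Čech cohomology of the quasi-coherent sheaf `ℐ_Z(m, n)` for the
standard affine open cover: `1`-cocycles modulo `1`-coboundaries. -/
abbrev H1 (I : surface.IdealSheafData) (m n : ℤ) : Type :=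
  LinearMap.ker (cechD1 I m n) ⧸
    (LinearMap.range (cechD0 I m n)).submoduleOf (LinearMap.ker (cechD1 I m n))

/-! ### The numerical invariants

The two rulings of the quadric are treated together: `δ = (1, 0)` gives the objects
`μ(Z), M(Z), D_i, μ_i, X_i, σ`, and `δ = (0, 1)` gives `ν(Z), N(Z), E_j, ν_j, Y_j, τ`. -/

/-- The smallest `k` such that `Z` is contained in a curve of bidegree `k δ`. -/
def minDegree (δ : ℤ × ℤ) (Z : surface.IdealSheafData) : ℕ :=
  sInf {k : ℕ | ∃ C, IsCurve (k * δ.1) (k * δ.2) C ∧ C ≤ Z}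

/-- `μ(Z)`. -/
abbrev mu : surface.IdealSheafData → ℕ := minDegree (1, 0)

/-- `ν(Z)`. -/
abbrev nu : surface.IdealSheafData → ℕ := minDegree (0, 1)

/-- The (unique) curve of smallest bidegree `k δ` that contains `Z`. -/
def minCurve (δ : ℤ × ℤ) (Z : surface.IdealSheafData) : surface.IdealSheafData :=
  @Classical.epsilon _ ⟨⊤⟩ fun C =>
    IsCurve (minDegree δ Z * δ.1) (minDegree δ Z * δ.2) C ∧ C ≤ Z

/-- The lines (of bidegree `δ`) in the support of the minimal curve of `Z`. -/
def minLines (δ : ℤ × ℤ) (Z : surface.IdealSheafData) : Set surface.IdealSheafData :=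
  {D | IsCurve δ.1 δ.2 D ∧ minCurve δ Z ≤ D}

/-- The multiplicity of the line `D` in the minimal curve of `Z`: the largest `k` such that `k D` is
contained in that curve. -/
def multiplicity (δ : ℤ × ℤ) (Z D : surface.IdealSheafData) : ℕ :=
  sSup {k : ℕ | minCurve δ Z ≤ D ^ k}

/-- The subscheme of the finite scheme `Z` that is concentrated on `D`: the open (and closed)
subscheme of `Z` formed by the points that lie on `D`, regarded as a closed subscheme of
`ℙ¹ × ℙ¹`. As `Z` is discrete, the interior is the set itself. -/
def concentratedOn (Z D : surface.IdealSheafData) : surface.IdealSheafData :=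
  (Scheme.Opens.ι (Opens.interior (Z.subschemeι ⁻¹' (D.support : Set surface))) ≫
    Z.subschemeι).ker

/-- The residual scheme `Z'` of `Z ∩ D` in `Z`. The ideal sheaf of `Z ∩ D` in `Z` is generated by an
equation of `D`, so that it is isomorphic to `𝒪_{Z'}`, where `Z'` is defined by the ideal quotient
`(ℐ_Z : ℐ_D)`, the largest ideal sheaf whose product with `ℐ_D` is contained in `ℐ_Z`. -/
def residual (Z D : surface.IdealSheafData) : surface.IdealSheafData :=
  sSup {J | J * D ≤ Z}

/-- The string `ρ(Z, k D) = (r_0, …, r_{k - 1})` of a finite subscheme `Z` of the multiple line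
`k D`: `r_0` is the length of `Z ∩ D`, and `(r_1, …, r_{k - 1}) = ρ(Z', (k - 1) D)`. -/
def rho (D : surface.IdealSheafData) : ℕ → surface.IdealSheafData → List ℕ
  | 0, _ => []
  | 1, Z => [length Z]
  | k + 2, Z => length (Z ⊔ D) :: rho D (k + 1) (residual Z D)

/-- `σ(X)` (for `δ = (1, 0)`) or `τ(X)` (for `δ = (0, 1)`), for a finite scheme `X` whose minimal
curve is a multiple of the line `D`. -/
def sigma (δ : ℤ × ℤ) (D X : surface.IdealSheafData) : List ℕ :=
  rho D (minDegree δ X) X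

/-- The sum, over the lines `D_i` in the minimal curve of `Z` and over those `j` with
`0 ≤ j ≤ μ_i - 1` and `σ(X_i)_j > n + 1`, of `σ(X_i)_j - n - 1`. -/
def excess (δ : ℤ × ℤ) (Z : surface.IdealSheafData) (n : ℤ) : ℤ :=
  ∑ᶠ D ∈ minLines δ Z,
    ∑ j ∈ (Finset.range (multiplicity δ Z D)).filter
        (fun j => ((sigma δ D (concentratedOn Z D)).getD j 0 : ℤ) > n + 1),
      (((sigma δ D (concentratedOn Z D)).getD j 0 : ℤ) - n - 1)

end Quadric

end

/-!
The finite scheme `Z` lies in a product `plane c c'` of two affine lines, whose ring of functions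
`R = ℂ[u, v]` is generated by one coordinate of each factor; let `I ⊆ R` be the ideal of `Z`. For
`m, n ≥ -1` the Čech group `H¹` of `𝒪(m, n)` vanishes: all functions involved are combinations of
monomials on the open torus, and the Čech complex can be contracted monomial by monomial
(`exists_cochain`). Since a function on `Z` lifts to every affine open set, it follows that
`H¹(ℐ_Z(m, n))` is the cokernel of the restriction of the global sections of `𝒪(m, n)` to `Z`, that
is, the quotient of `R` by the sum of `I` and the space of polynomials of bidegree at most `(m, n)`
(`cohomologyEquiv`, `finrank_H1`).

The codimension of this sum is a matter of algebra. The curve `M(Z)` is given by the minimal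
polynomial `g` of `u` modulo `I` (`Ruling.isZeroScheme_minCurve`), so that `m ≥ μ(Z) - 1` says that
`g` has degree at most `m + 1`. Division by `g` shows that the bound on the degree in `u` is then
immaterial (`sup_bidegreeSpace_eq_sup_strip`). What is left is the span of the products `uⁱ vʲ` with
`j ≤ n`; it is stable under `u`, so that `R / I` can be decomposed according to the roots `a` of
`g` (`finrank_quotient_sup_strip`), and each part can be filtered by the powers of `w = u - a`. On
the `j`-th step of this filtration `u` acts as the scalar `a`, so the step is the algebra
`R / ((I : wʲ) + (w))` generated by `v`. Its dimension is the entry `r_j` of the string, and the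
first `n + 1` powers of `v` have codimension `max (r_j - n - 1) 0` in it. These codimensions add up
(`finrank_quotient_sup_strip_step`): if `r_0 ≥ n + 1`, then the powers of `v` are independent modulo
`(I, w)`, and otherwise they span, in which case all later steps are spanned as well.

The remaining lemmas translate the geometric notions into the ideal of `Z` in `R`: lines in `M(Z)`
are the roots of `g`, with the same multiplicities, the part of `Z` on a line has the ideal
`I + (w ^ e)`, where `e` is the multiplicity, and its string consists of the dimensions `r_j`. The
structure `Ruling` serves to do this for both projections at once.
-/

noncomputable section

namespace Quadric

/-! ### Functions on the projective line -/

/-- Rational functions in the homogeneous coordinates of the projective line. Functions on the line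
are compared through their germs, which embed into this field. -/
abbrev RatFun : Type := FractionRing (MvPolynomial (Fin 2) ℂ)

/-- The inclusion of the polynomials into the rational functions. -/
def toRF : MvPolynomial (Fin 2) ℂ →+* RatFun := algebraMap _ _

lemma toRF_eq_zero {F : MvPolynomial (Fin 2) ℂ} : toRF F = 0 ↔ F = 0 :=
  FaithfulSMul.algebraMap_eq_zero_iff _ _

/-- The inclusion of the local ring of the polynomial ring at `x`. -/
def localToRatFun (x : ProjectiveSpectrum grading) :
    Localization.AtPrime x.asHomogeneousIdeal.toIdeal →+* RatFun :=
  IsLocalization.lift (M := x.asHomogeneousIdeal.toIdeal.primeCompl)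
    (g := toRF) (fun y => by
      refine IsUnit.mk0 _ ?_
      simp only [ne_eq, toRF_eq_zero]
      rintro h
      exact y.2 (by rw [h]; exact zero_mem _))

lemma localToRatFun_mk (x : ProjectiveSpectrum grading) (F : MvPolynomial (Fin 2) ℂ)
    (g : x.asHomogeneousIdeal.toIdeal.primeCompl) :
    localToRatFun x (Localization.mk F g) = toRF F / toRF g.1 := by
  have hg : toRF g.1 ≠ 0 := by
    simp only [ne_eq, toRF_eq_zero]
    rintro h
    exact g.2 (by rw [h]; exact zero_mem _)
  rw [localToRatFun, Localization.mk_eq_mk', IsLocalization.lift_mk'_spec]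
  field_simp

lemma localToRatFun_injective (x : ProjectiveSpectrum grading) :
    Function.Injective (localToRatFun x) := by
  have := x.isPrime
  rw [localToRatFun, IsLocalization.lift_injective_iff]
  intro a b
  rw [(IsLocalization.injective (Localization.AtPrime x.asHomogeneousIdeal.toIdeal)
    x.asHomogeneousIdeal.toIdeal.primeCompl_le_nonZeroDivisors).eq_iff,
    ((injective_iff_map_eq_zero toRF).2 fun _ => toRF_eq_zero.1).eq_iff]

/-- The inclusion of the local ring of the projective line at `x`. -/
def atToRatFun (x : ProjectiveSpectrum grading) :
    HomogeneousLocalization.AtPrime grading x.asHomogeneousIdeal.toIdeal →+* RatFun :=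
  (localToRatFun x).comp (algebraMap _ (Localization.AtPrime x.asHomogeneousIdeal.toIdeal))

lemma atToRatFun_injective (x : ProjectiveSpectrum grading) :
    Function.Injective (atToRatFun x) :=
  (localToRatFun_injective x).comp (HomogeneousLocalization.val_injective _)

/-- The germ at `x` of a function on `V`, as a rational function. -/
def ev {V : line.Opens} (x : line) (hx : x ∈ V) : Γ(line, V) →+* RatFun :=
  (atToRatFun x).comp (openToLocalization grading V x hx).hom

lemma ev_injective {V : line.Opens} {s t : Γ(line, V)}
    (h : ∀ x (hx : x ∈ V), ev x hx s = ev x hx t) : s = t := by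
  apply Subtype.ext
  funext x
  exact atToRatFun_injective _ (h x.1 x.2)

lemma ev_map {V W : line.Opens} (i : W ≤ V) (x : line) (hx : x ∈ W) (s : Γ(line, V)) :
    ev x hx ((line.presheaf.map (homOfLE i).op).hom s) = ev x (i hx) s := rfl

/-- The degree zero part of the localization at `f`, as functions on the complement of `f = 0`. -/
def awayToLine (f : MvPolynomial (Fin 2) ℂ) :
    CommRingCat.of (HomogeneousLocalization.Away grading f) ⟶ Γ(line, lineOpen f) :=
  Proj.awayToSection grading f

lemma ev_awayToLine {d : ℕ} {f : MvPolynomial (Fin 2) ℂ} (hf : f ∈ grading d) (n : ℕ)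
    (F : MvPolynomial (Fin 2) ℂ) (hF : F ∈ grading (n • d)) (x : line) (hx : x ∈ lineOpen f) :
    ev x hx ((awayToLine f).hom (HomogeneousLocalization.Away.mk grading hf n F hF))
      = toRF F / toRF f ^ n := by
  have := localToRatFun_mk x F ⟨f ^ n, fun h => hx (x.isPrime.mem_of_pow_mem n h)⟩
  rw [map_pow] at this
  exact this

lemma awayToLine_surjective {d : ℕ} (hd : 0 < d) {f : MvPolynomial (Fin 2) ℂ}
    (hf : f ∈ grading d) (s : Γ(line, lineOpen f)) :
    ∃ (n : ℕ) (F : MvPolynomial (Fin 2) ℂ) (hF : F ∈ grading (n • d)),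
      s = (awayToLine f).hom (HomogeneousLocalization.Away.mk grading hf n F hF) := by
  have := ConcreteCategory.bijective_of_isIso (Proj.basicOpenIsoAway grading f hf hd).hom
  obtain ⟨y, rfl⟩ := this.2 s
  obtain ⟨n, F, hF, rfl⟩ := HomogeneousLocalization.Away.mk_surjective grading hf y
  exact ⟨n, F, hF, rfl⟩

lemma opens_ι_appTop_topIso {X : Scheme.{0}} (U : X.Opens) : U.ι.appTop ≫ U.topIso.hom =
    X.presheaf.map (homOfLE (le_top : U ≤ ⊤)).op := by
  rw [Scheme.Opens.ι_appTop, Scheme.Opens.topIso_hom]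
  exact (X.presheaf.map_comp _ _).symm

/-- The structure morphism of the projective line over the degree zero part of the grading. -/
def lineToSpecZero : line ⟶ Spec (CommRingCat.of (grading 0)) := Proj.toSpecZero grading

lemma lineToSpecZero_appTop {d : ℕ} (hd : 0 < d) {f : MvPolynomial (Fin 2) ℂ}
    (hf : f ∈ grading d) :
    lineToSpecZero.appTop ≫ line.presheaf.map (homOfLE (le_top : lineOpen f ≤ ⊤)).op =
    (Scheme.ΓSpecIso _).hom ≫
      CommRingCat.ofHom (HomogeneousLocalization.fromZeroRingHom grading (.powers f)) ≫
      awayToLine f := by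
  have h := Proj.awayι_toSpecZero grading f hf hd
  rw [← Proj.basicOpenIsoSpec_inv_ι, Category.assoc, Iso.inv_comp_eq,
    Proj.basicOpenIsoSpec_hom] at h
  have h2 := congrArg Scheme.Hom.appTop h
  rw [Scheme.Hom.comp_appTop, Scheme.Hom.comp_appTop] at h2
  have h3 := Proj.basicOpenToSpec_app_top grading f
  have h4 := Scheme.ΓSpecIso_naturality
    (CommRingCat.ofHom (HomogeneousLocalization.fromZeroRingHom grading (Submonoid.powers f)))
  rw [show (Proj.basicOpenToSpec grading f).appTop = _ from h3, reassoc_of% h4] at h2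
  have h5 := congrArg (· ≫ (Proj.basicOpen grading f).topIso.hom) h2
  simp only [Category.assoc, Iso.inv_hom_id, Category.comp_id] at h5
  rw [opens_ι_appTop_topIso] at h5
  exact h5

lemma adjoin_X : Algebra.adjoin (grading 0)
    (Set.range (MvPolynomial.X : Fin 2 → MvPolynomial (Fin 2) ℂ)) = ⊤ := by
  rw [eq_top_iff]
  intro F _
  induction F using MvPolynomial.induction_on with
  | C r =>
    exact Subalgebra.algebraMap_mem _ (⟨MvPolynomial.C r, MvPolynomial.isHomogeneous_C _ _⟩ :
      grading 0)
  | add p q hp hq => exact add_mem (hp trivial) (hq trivial)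
  | mul_X p i hp => exact mul_mem (hp trivial) (Algebra.subset_adjoin ⟨i, rfl⟩)

lemma iSup_lineOpen_X : ⨆ a : Fin 2, lineOpen (MvPolynomial.X a) = ⊤ :=
  Proj.iSup_basicOpen_eq_top' grading _ (fun a => ⟨1, MvPolynomial.isHomogeneous_X ℂ a⟩) adjoin_X

lemma exists_mem_lineOpen_X (x : line) : ∃ a : Fin 2, x ∈ lineOpen (MvPolynomial.X a) := by
  have : x ∈ ⨆ a : Fin 2, lineOpen (MvPolynomial.X a) := by
    rw [iSup_lineOpen_X]; trivial
  simpa using Opens.mem_iSup.mp this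

lemma scalars_lineToSpec {V : line.Opens} (r : ℂ) : scalars lineToSpec V r =
    (line.presheaf.map (homOfLE le_top).op).hom (lineToSpecZero.appTop.hom
      ((Scheme.ΓSpecIso (CommRingCat.of (grading 0))).inv.hom (algebraMap ℂ (grading 0) r))) := by
  have h0 : (Scheme.ΓSpecIso (CommRingCat.of ℂ)).inv ≫ lineToSpec.appTop =
    CommRingCat.ofHom (algebraMap ℂ (grading 0)) ≫
      (Scheme.ΓSpecIso (CommRingCat.of (grading 0))).inv ≫ lineToSpecZero.appTop := by
    have h1 : lineToSpec.appTop =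
      (Spec.map (CommRingCat.ofHom (algebraMap ℂ (grading 0)))).appTop ≫ lineToSpecZero.appTop :=
      Scheme.Hom.comp_appTop _ _
    rw [h1, ← Category.assoc, ← Scheme.ΓSpecIso_inv_naturality, Category.assoc]
  exact congrArg (fun φ => (line.presheaf.map (homOfLE le_top).op).hom (φ.hom r)) h0

lemma ev_scalars {V : line.Opens} (x : line) (hx : x ∈ V) (r : ℂ) :
    ev x hx (scalars lineToSpec V r) = toRF (.C r) := by
  obtain ⟨a, ha⟩ := exists_mem_lineOpen_X x
  have h := congrArg (fun φ => φ.hom ((Scheme.ΓSpecIso (CommRingCat.of (grading 0))).inv.hom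
      (algebraMap ℂ (grading 0) r)))
    (lineToSpecZero_appTop one_pos (MvPolynomial.isHomogeneous_X ℂ a))
  have h2 := ev_awayToLine (MvPolynomial.isHomogeneous_X ℂ a) 0 (MvPolynomial.C r)
    (by simp) x ha
  simp only [pow_zero, div_one] at h2
  rw [← h2, scalars_lineToSpec, ev_map, ← ev_map (le_top : lineOpen (.X a) ≤ ⊤) x ha]
  congr 1
  refine h.trans ?_
  rw [CommRingCat.hom_comp, CommRingCat.hom_comp, RingHom.comp_apply, RingHom.comp_apply,
    ← RingHom.comp_apply (Scheme.ΓSpecIso _).hom.hom, ← CommRingCat.hom_comp, Iso.inv_hom_id]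
  rfl

instance (V : line.Opens) : Algebra ℂ Γ(line, V) := (scalars lineToSpec V).toAlgebra

lemma ev_algebraMap {V : line.Opens} (x : line) (hx : x ∈ V) (r : ℂ) :
    ev x hx (algebraMap ℂ Γ(line, V) r) = toRF (.C r) :=
  ev_scalars x hx r

lemma ev_smul {V : line.Opens} (x : line) (hx : x ∈ V) (r : ℂ) (s : Γ(line, V)) :
    ev x hx (r • s) = toRF (.C r) * ev x hx s := by
  rw [Algebra.smul_def, map_mul, ev_algebraMap]

/-- Restriction of functions on the projective line. -/
def lineRes {V W : line.Opens} (h : W ≤ V) : Γ(line, V) →ₐ[ℂ] Γ(line, W) where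
  toRingHom := (line.presheaf.map (homOfLE h).op).hom
  commutes' r := ev_injective fun x hx => by
    refine (ev_map h x hx _).trans ?_
    rw [ev_algebraMap, ev_algebraMap]

lemma ev_lineRes {V W : line.Opens} (h : W ≤ V) (x : line) (hx : x ∈ W) (s : Γ(line, V)) :
    ev x hx (lineRes h s) = ev x (h hx) s := rfl

/-- The homogeneous coordinate `X_a` as a linear form. -/
def coord (a : Fin 2) : grading 1 := ⟨.X a, MvPolynomial.isHomogeneous_X ℂ a⟩

@[simp] lemma coe_coord (a : Fin 2) : (coord a : MvPolynomial (Fin 2) ℂ) = .X a := rfl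

lemma toRF_ne_zero {x : line} {f : MvPolynomial (Fin 2) ℂ} (hx : x ∈ lineOpen f) :
    toRF f ≠ 0 := by
  simp only [ne_eq, toRF_eq_zero]
  rintro rfl
  exact hx (zero_mem _)

/-- The function `F / f ^ k` on an open subset of the line where the linear form `f` does not
vanish. -/
def lineFrac (f : grading 1) (k : ℕ) {V : line.Opens} (hV : V ≤ lineOpen f) :
    grading k →ₗ[ℂ] Γ(line, V) where
  toFun F := lineRes hV ((awayToLine f).hom (HomogeneousLocalization.Away.mk grading f.2 k F
    (by simp)))
  map_add' F G := ev_injective fun x hx => by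
    rw [map_add, ev_lineRes, ev_lineRes, ev_lineRes, ev_awayToLine, ev_awayToLine, ev_awayToLine,
      Submodule.coe_add, map_add, add_div]
  map_smul' r F := ev_injective fun x hx => by
    rw [RingHom.id_apply, ev_smul, ev_lineRes, ev_lineRes, ev_awayToLine, ev_awayToLine,
      Submodule.coe_smul, MvPolynomial.smul_eq_C_mul, map_mul, mul_div_assoc]

lemma ev_lineFrac (f : grading 1) (k : ℕ) {V : line.Opens} (hV : V ≤ lineOpen f) (F : grading k)
    (x : line) (hx : x ∈ V) :
    ev x hx (lineFrac f k hV F) = toRF F.1 / toRF f.1 ^ k :=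
  ev_awayToLine f.2 k F _ x (hV hx)

/-- The generic point of the projective line. -/
def genericPt : line :=
  show ProjectiveSpectrum grading from
  { asHomogeneousIdeal := ⊥
    isPrime := by
      change (⊥ : Ideal (MvPolynomial (Fin 2) ℂ)).IsPrime
      exact Ideal.isPrime_bot
    not_irrelevant_le := fun h => by
      have h1 : (MvPolynomial.X 0 : MvPolynomial (Fin 2) ℂ) ∈ (⊥ : HomogeneousIdeal grading) :=
        h (HomogeneousIdeal.mem_irrelevant_of_mem grading one_pos
          (MvPolynomial.isHomogeneous_X ℂ 0))
      exact MvPolynomial.X_ne_zero (R := ℂ) (0 : Fin 2) h1 }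

lemma genericPt_mem {f : MvPolynomial (Fin 2) ℂ} (hf : f ≠ 0) : genericPt ∈ lineOpen f :=
  fun h => hf h

lemma ev_genericPt_injective {d : ℕ} (hd : 0 < d) {f : MvPolynomial (Fin 2) ℂ} (h0 : f ≠ 0)
    (hf : f ∈ grading d) : Function.Injective (ev (V := lineOpen f) genericPt (genericPt_mem h0)) := by
  rw [injective_iff_map_eq_zero]
  intro s hs
  obtain ⟨n, F, hF, rfl⟩ := awayToLine_surjective hd hf s
  refine ev_injective fun x hx => ?_
  rw [ev_awayToLine] at hs ⊢
  rw [hs, map_zero]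

/-! ### Monomials on the torus of the projective line -/

/-- The open subset of the line where neither coordinate vanishes. -/
abbrev lineTorus : line.Opens := lineOpen (MvPolynomial.X 0 * MvPolynomial.X 1)

lemma lineOpen_mul_le_left (f g : MvPolynomial (Fin 2) ℂ) : lineOpen (f * g) ≤ lineOpen f :=
  Proj.basicOpen_mono _ _ _ (Dvd.intro _ rfl)

lemma lineOpen_mul_le_right (f g : MvPolynomial (Fin 2) ℂ) : lineOpen (f * g) ≤ lineOpen g :=
  Proj.basicOpen_mono _ _ _ (Dvd.intro_left _ rfl)

lemma lineOpen_mul (f g : MvPolynomial (Fin 2) ℂ) : lineOpen (f * g) = lineOpen f ⊓ lineOpen g :=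
  Proj.basicOpen_mul _ _ _

lemma lineTorus_le (a : Fin 2) : lineTorus ≤ lineOpen (.X a) := by
  fin_cases a
  exacts [lineOpen_mul_le_left _ _, lineOpen_mul_le_right _ _]

lemma lineTorus_le_inter (a b : Fin 2) : lineTorus ≤ lineOpen (MvPolynomial.X a * MvPolynomial.X b) := by
  rw [lineOpen_mul]
  exact le_inf (lineTorus_le a) (lineTorus_le b)

lemma ev_lineRatio (a b : Fin 2) (x : line) (hx : x ∈ lineOpen (MvPolynomial.X a * MvPolynomial.X b)) :
    ev x hx (lineRatio a b : Γ(line, lineOpen (MvPolynomial.X a * MvPolynomial.X b))) =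
      toRF (MvPolynomial.X a) / toRF (MvPolynomial.X b) := by
  have h := ev_awayToLine (X_mul_X_mem a b) 1 (.X a ^ 2)
    (by rw [one_smul]; exact MvPolynomial.isHomogeneous_X_pow a 2) x hx
  have ha : toRF (.X a) ≠ 0 := toRF_ne_zero (lineOpen_mul_le_left (.X a) (.X b) hx)
  have hb : toRF (.X b) ≠ 0 := toRF_ne_zero (lineOpen_mul_le_right (.X a) (.X b) hx)
  refine h.trans ?_
  rw [map_pow, map_mul, pow_one, div_eq_div_iff (mul_ne_zero ha hb) hb]
  ring

lemma isAffineOpen_lineOpen {d : ℕ} (hd : 0 < d) {f : MvPolynomial (Fin 2) ℂ} (hf : f ∈ grading d) :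
    IsAffineOpen (lineOpen f) :=
  Proj.isAffineOpen_basicOpen grading f hf hd

/-- The condition that `(X₁ / X₀) ^ k` extends to the locus where `X_a` and `X_b` do not vanish. -/
def IsRegularExp (a b : Fin 2) (k : ℤ) : Prop :=
  (a = 0 ∧ b = 0 → 0 ≤ k) ∧ (a = 1 ∧ b = 1 → k ≤ 0)

/-- The invertible function `X₁ / X₀` on the torus of the line. -/
def lineMonUnit : Γ(line, lineTorus)ˣ :=
  Units.map (lineRes (lineTorus_le_inter 1 0)).toRingHom.toMonoidHom (lineRatio 1 0)

/-- The function `(X₁ / X₀) ^ k` on the torus of the line. -/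
def lineMon (k : ℤ) : Γ(line, lineTorus) := (lineMonUnit ^ k : Γ(line, lineTorus)ˣ)

lemma ev_lineMon (k : ℤ) (x : line) (hx : x ∈ lineTorus) :
    ev x hx (lineMon k) = (toRF (MvPolynomial.X 1) / toRF (MvPolynomial.X 0)) ^ k := by
  have h := ev_lineRatio 1 0 x (lineTorus_le_inter 1 0 hx)
  rw [← h]
  have := map_zpow (Units.map (ev x hx).toMonoidHom) lineMonUnit k
  have h2 := congrArg Units.val this
  rw [Units.val_zpow_eq_zpow_val] at h2
  exact h2

lemma X_mul_X_ne_zero (a b : Fin 2) : (.X a * .X b : MvPolynomial (Fin 2) ℂ) ≠ 0 :=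
  mul_ne_zero (MvPolynomial.X_ne_zero _) (MvPolynomial.X_ne_zero _)

lemma linearIndependent_lineMon : LinearIndependent ℂ lineMon := by
  rw [linearIndependent_iff']
  intro s c hc i hi
  obtain ⟨N, hN⟩ : ∃ N : ℕ, ∀ k ∈ s, |k| ≤ N := by
    refine ⟨∑ k ∈ s, k.natAbs, fun k hk => ?_⟩
    rw [Int.abs_eq_natAbs]
    exact_mod_cast Finset.single_le_sum (f := Int.natAbs) (fun _ _ => Nat.zero_le _) hk
  have hg : genericPt ∈ lineTorus := genericPt_mem (X_mul_X_ne_zero 0 1)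
  have h := congrArg (ev genericPt hg) hc
  have h0 := toRF_ne_zero (lineTorus_le 0 hg)
  have h1 := toRF_ne_zero (lineTorus_le 1 hg)
  simp only [map_sum, ev_smul, ev_lineMon, map_zero] at h
  have h2 : toRF (∑ k ∈ s, MvPolynomial.C (c k) * (
      MvPolynomial.X 0 ^ (N - k).toNat * MvPolynomial.X 1 ^ (N + k).toNat) :
        MvPolynomial (Fin 2) ℂ) = 0 := by
    rw [map_sum, ← zero_mul (toRF (.X 0) ^ N * toRF (.X 1) ^ N), ← h, Finset.sum_mul]
    refine Finset.sum_congr rfl fun k hk => ?_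
    have := hN k hk
    rw [abs_le] at this
    rw [map_mul, map_mul, map_pow, map_pow, ← zpow_natCast, ← zpow_natCast,
      Int.toNat_of_nonneg (by omega), Int.toNat_of_nonneg (by omega), zpow_sub₀ h0, zpow_add₀ h1,
      div_zpow, zpow_natCast, zpow_natCast]
    field_simp
  rw [toRF_eq_zero] at h2
  have h3 := congrArg (MvPolynomial.coeff
    (Finsupp.single 0 (N - i).toNat + Finsupp.single 1 (N + i).toNat)) h2
  rw [MvPolynomial.coeff_sum, Finset.sum_eq_single i] at h3
  · rw [MvPolynomial.X_pow_eq_monomial, MvPolynomial.X_pow_eq_monomial,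
      MvPolynomial.monomial_mul, MvPolynomial.coeff_C_mul, MvPolynomial.coeff_monomial] at h3
    simpa using h3
  · intro k hk hki
    rw [MvPolynomial.X_pow_eq_monomial, MvPolynomial.X_pow_eq_monomial,
      MvPolynomial.monomial_mul, MvPolynomial.coeff_C_mul, MvPolynomial.coeff_monomial, if_neg, mul_zero]
    intro h
    have := congrArg (fun e => e 0) h
    have a1 := hN k hk
    have a2 := hN i hi
    rw [abs_le] at a1 a2
    simp at this
    omega
  · exact fun h => absurd hi h

lemma toRF_X_div (a : Fin 2) {x : line} (hx : x ∈ lineTorus) :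
    toRF (MvPolynomial.X a) =
      toRF (MvPolynomial.X 0) * (toRF (MvPolynomial.X 1) / toRF (MvPolynomial.X 0)) ^ (a : ℤ) := by
  have h0 := toRF_ne_zero (lineTorus_le 0 hx)
  fin_cases a <;> simp
  field_simp

lemma toRF_monomial_div (a b : Fin 2) (n i j : ℕ) (hij : i + j = 2 * n) {x : line}
    (hx : x ∈ lineTorus) :
    toRF (MvPolynomial.X 0 ^ i * MvPolynomial.X 1 ^ j) /
      toRF (MvPolynomial.X a * MvPolynomial.X b) ^ n =
    (toRF (MvPolynomial.X 1) / toRF (MvPolynomial.X 0)) ^ ((j : ℤ) - n * a - n * b) := by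
  have h0 := toRF_ne_zero (lineTorus_le 0 hx)
  have h1 := toRF_ne_zero (lineTorus_le 1 hx)
  rw [map_mul, map_mul, toRF_X_div a hx, toRF_X_div b hx, map_pow, map_pow]
  set u := toRF (MvPolynomial.X 1) / toRF (MvPolynomial.X 0) with hu
  have hu0 : u ≠ 0 := div_ne_zero h1 h0
  have e1 : toRF (MvPolynomial.X 1) = toRF (MvPolynomial.X 0) * u := by rw [hu]; field_simp
  rw [e1, div_eq_iff (by positivity), sub_sub, zpow_sub₀ hu0, zpow_add₀ hu0, zpow_natCast,
    mul_comm (n : ℤ), mul_comm (n : ℤ), zpow_mul, zpow_mul, zpow_natCast, zpow_natCast]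
  have hi : i = 2 * n - j := by omega
  have hp : toRF (MvPolynomial.X 0) ^ (2 * n) =
      toRF (MvPolynomial.X 0) ^ i * toRF (MvPolynomial.X 0) ^ j := by
    rw [← pow_add, hij]
  have hua : u ^ (a : ℤ) ≠ 0 := zpow_ne_zero _ hu0
  have hub : u ^ (b : ℤ) ≠ 0 := zpow_ne_zero _ hu0
  simp only [mul_pow]
  field_simp
  rw [← pow_mul, mul_comm n 2, hp, zpow_natCast]

lemma lineRes_mem_span (a b : Fin 2) (s : Γ(line, lineOpen (MvPolynomial.X a * MvPolynomial.X b))) :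
    lineRes (lineTorus_le_inter a b) s ∈ Submodule.span ℂ (lineMon '' {k | IsRegularExp a b k}) := by
  obtain ⟨n, F, hF, rfl⟩ := awayToLine_surjective two_pos (X_mul_X_mem a b) s
  have hdeg : ∀ e ∈ F.support, e 0 + e 1 = 2 * n := by
    intro e he
    have := hF (MvPolynomial.mem_support_iff.1 he)
    rw [Finsupp.weight_apply, Finsupp.sum_fintype _ _ (by simp), Fin.sum_univ_two] at this
    simpa [mul_comm] using this
  have : lineRes (lineTorus_le_inter a b) ((awayToLine (MvPolynomial.X a * MvPolynomial.X b)).hom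
      (HomogeneousLocalization.Away.mk grading (X_mul_X_mem a b) n F hF)) =
    ∑ e ∈ F.support, F.coeff e • lineMon ((e 1 : ℤ) - n * a - n * b) := by
    refine ev_injective fun x hx => ?_
    rw [ev_lineRes, ev_awayToLine, map_sum]
    conv_lhs => rw [F.as_sum, map_sum, Finset.sum_div]
    refine Finset.sum_congr rfl fun e he => ?_
    rw [ev_smul, ev_lineMon, ← toRF_monomial_div a b n (e 0) (e 1) (hdeg e he) hx,
      MvPolynomial.monomial_eq, Finsupp.prod_fintype _ _ (by simp), Fin.prod_univ_two, map_mul,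
      mul_div_assoc]
  rw [this]
  refine Submodule.sum_mem _ fun e he => Submodule.smul_mem _ _ (Submodule.subset_span ⟨_, ?_, rfl⟩)
  have := hdeg e he
  constructor <;> rintro ⟨rfl, rfl⟩ <;> simp <;> omega

lemma lineMon_mem_range (a b : Fin 2) (k : ℤ) (hk : IsRegularExp a b k) :
    ∃ s : Γ(line, lineOpen (MvPolynomial.X a * MvPolynomial.X b)),
      lineRes (lineTorus_le_inter a b) s = lineMon k := by
  obtain ⟨N, hN1, hN2⟩ : ∃ N : ℕ, -(N : ℤ) ≤ k ∧ k ≤ N := ⟨k.natAbs, by omega, by omega⟩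
  obtain ⟨i, j, hij, hk'⟩ : ∃ i j : ℕ, i + j = 2 * N ∧ (j : ℤ) - N * a - N * b = k := by
    obtain ⟨hk1, hk2⟩ := hk
    fin_cases a <;> fin_cases b <;> simp at *
    · exact ⟨(2 * N - k).toNat, k.toNat, by omega, by omega⟩
    · exact ⟨(N - k).toNat, (N + k).toNat, by omega, by omega⟩
    · exact ⟨(N - k).toNat, (N + k).toNat, by omega, by omega⟩
    · exact ⟨(-k).toNat, (2 * N + k).toNat, by omega, by omega⟩
  refine ⟨(awayToLine _).hom (HomogeneousLocalization.Away.mk grading (X_mul_X_mem a b) N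
    (MvPolynomial.X 0 ^ i * MvPolynomial.X 1 ^ j) ?_), ?_⟩
  · have := (MvPolynomial.isHomogeneous_X_pow (R := ℂ) (0 : Fin 2) i).mul
      (MvPolynomial.isHomogeneous_X_pow (R := ℂ) (1 : Fin 2) j)
    rw [hij] at this
    rw [smul_eq_mul, mul_comm]
    exact this
  · refine ev_injective fun x hx => ?_
    rw [ev_lineRes, ev_awayToLine, ev_lineMon, toRF_monomial_div a b _ i j hij hx, hk']

lemma lineRes_injective (a b : Fin 2) : Function.Injective (lineRes (lineTorus_le_inter a b)) := by
  intro s t h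
  have hg : genericPt ∈ lineTorus := genericPt_mem (X_mul_X_ne_zero 0 1)
  have h2 := congrArg (ev genericPt hg) h
  rw [ev_lineRes, ev_lineRes] at h2
  exact ev_genericPt_injective (d := 2) two_pos (X_mul_X_ne_zero a b) (X_mul_X_mem a b) h2

lemma lineRes_self {V : line.Opens} (h : V ≤ V) (s : Γ(line, V)) : lineRes h s = s :=
  ev_injective fun x hx => ev_lineRes h x hx s

lemma top_le_span_lineMon : ⊤ ≤ Submodule.span ℂ (Set.range lineMon) := by
  intro s _
  have h := lineRes_mem_span 0 1 s
  rw [lineRes_self] at h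
  exact Submodule.span_mono (Set.image_subset_range _ _) h

/-- The basis of the functions on the torus of the line that consists of the powers of `X₁ / X₀`. -/
def lineBasis : Module.Basis ℤ ℂ Γ(line, lineTorus) :=
  .mk linearIndependent_lineMon top_le_span_lineMon

/-! ### Functions on products of open subsets -/

lemma scalars_eq_appLE {X : Scheme.{0}} (f : X ⟶ Spec (CommRingCat.of ℂ)) (V : X.Opens) :
    CommRingCat.ofHom (scalars f V) =
      (Scheme.ΓSpecIso (CommRingCat.of ℂ)).inv ≫ f.appLE ⊤ V le_top := by
  ext r
  rfl

lemma appLE_scalars {X Y : Scheme.{0}} (g : X ⟶ Y) (f : Y ⟶ Spec (CommRingCat.of ℂ))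
    {U : Y.Opens} {V : X.Opens} (h : V ≤ g ⁻¹ᵁ U) (r : ℂ) :
    (g.appLE U V h).hom (scalars f U r) = scalars (g ≫ f) V r := by
  have : CommRingCat.ofHom (scalars f U) ≫ g.appLE U V h = CommRingCat.ofHom (scalars (g ≫ f) V) := by
    rw [scalars_eq_appLE, scalars_eq_appLE, Category.assoc]
    exact congrArg _ (Scheme.Hom.appLE_comp_appLE _ _ _ _ _ _ _)
  exact congrArg (fun φ => φ.hom r) this

lemma pr₁_lineToSpec : pr₁ ≫ lineToSpec = toSpec := rfl

lemma pr₂_lineToSpec : pr₂ ≫ lineToSpec = toSpec := pullback.condition.symm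

/-- The pull-back of functions under a morphism `q` from the quadric to the line over `ℂ`. -/
def pull (q : surface ⟶ line) (hq : q ≫ lineToSpec = toSpec) {V : surface.Opens} {U : line.Opens}
    (h : V ≤ q ⁻¹ᵁ U) : Γ(line, U) →ₐ[ℂ] Γ(surface, V) where
  toRingHom := (q.appLE U V h).hom
  commutes' r := by
    have := appLE_scalars q lineToSpec h r
    rw [hq] at this
    exact this

lemma res_pull (q : surface ⟶ line) (hq : q ≫ lineToSpec = toSpec) {V W : surface.Opens}
    {U : line.Opens} (h : V ≤ q ⁻¹ᵁ U) (h' : W ≤ V) (s : Γ(line, U)) :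
    res h' (pull q hq h s) = pull q hq (h'.trans h) s := by
  have := Scheme.Hom.appLE_map q h (homOfLE h').op
  exact congrArg (fun φ => φ.hom s) this

lemma pull_lineRes (q : surface ⟶ line) (hq : q ≫ lineToSpec = toSpec) {V : surface.Opens}
    {U U' : line.Opens} (h : V ≤ q ⁻¹ᵁ U') (h' : U' ≤ U) (s : Γ(line, U)) :
    pull q hq h (lineRes h' s) = pull q hq (h.trans ((Opens.map q.base).monotone h')) s := by
  have := Scheme.Hom.map_appLE q h (homOfLE h').op
  exact congrArg (fun φ => φ.hom s) this

lemma isPushout_sections {U₁ U₂ : line.Opens} (h₁ : IsAffineOpen U₁) (h₂ : IsAffineOpen U₂) :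
    IsPushout (CommRingCat.ofHom (scalars lineToSpec U₁)) (CommRingCat.ofHom (scalars lineToSpec U₂))
      (pr₁.appLE U₁ (pr₁ ⁻¹ᵁ U₁ ⊓ pr₂ ⁻¹ᵁ U₂) inf_le_left)
      (pr₂.appLE U₂ (pr₁ ⁻¹ᵁ U₁ ⊓ pr₂ ⁻¹ᵁ U₂) inf_le_right) := by
  have H : IsPullback pr₁ pr₂ lineToSpec lineToSpec := IsPullback.of_hasPullback _ _
  have h := (isIso_pushoutSection_iff H (US := ⊤) (UT := U₂) (UX := U₁) le_top le_top rfl).1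
    (isIso_pushoutSection_of_isAffineOpen H le_top le_top rfl (isAffineOpen_top _) h₂ h₁)
  rw [scalars_eq_appLE, scalars_eq_appLE]
  exact h.of_iso (Scheme.ΓSpecIso (CommRingCat.of ℂ)) (Iso.refl _) (Iso.refl _) (Iso.refl _)
    (by simp) (by simp) (by simp) (by simp)

open TensorProduct in
/-- The product of functions pulled back from the two factors. -/
def tensorMap (U₁ U₂ : line.Opens) :
    Γ(line, U₁) ⊗[ℂ] Γ(line, U₂) →ₐ[ℂ] Γ(surface, pr₁ ⁻¹ᵁ U₁ ⊓ pr₂ ⁻¹ᵁ U₂) :=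
  Algebra.TensorProduct.productMap (pull pr₁ pr₁_lineToSpec inf_le_left)
    (pull pr₂ pr₂_lineToSpec inf_le_right)

lemma tensorMap_bijective {U₁ U₂ : line.Opens} (h₁ : IsAffineOpen U₁) (h₂ : IsAffineOpen U₂) :
    Function.Bijective (tensorMap U₁ U₂) := by
  have h := isPushout_sections h₁ h₂
  have h' := CommRingCat.isPushout_tensorProduct ℂ Γ(line, U₁) Γ(line, U₂)
  let e := h'.isoPushout ≪≫ h.isoPushout.symm
  have he : CommRingCat.ofHom (tensorMap U₁ U₂).toRingHom = e.hom := by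
    refine h'.hom_ext ?_ ?_
    · rw [Iso.trans_hom, h'.inl_isoPushout_hom_assoc]
      refine Eq.trans ?_ (h.inl_isoPushout_inv).symm
      ext s
      exact Algebra.TensorProduct.productMap_left_apply _ _ s
    · rw [Iso.trans_hom, h'.inr_isoPushout_hom_assoc]
      refine Eq.trans ?_ (h.inr_isoPushout_inv).symm
      ext s
      exact Algebra.TensorProduct.productMap_right_apply _ _ s
  have := ConcreteCategory.bijective_of_isIso e.hom
  rw [← he] at this
  exact this

lemma isAffineOpen_inter {U₁ U₂ : line.Opens} (h₁ : IsAffineOpen U₁) (h₂ : IsAffineOpen U₂) :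
    IsAffineOpen (pr₁ ⁻¹ᵁ U₁ ⊓ pr₂ ⁻¹ᵁ U₂) := by
  have H : IsPullback pr₁ pr₂ lineToSpec lineToSpec := IsPullback.of_hasPullback _ _
  have : IsAffine _ := h₁
  have : IsAffine _ := h₂
  have : IsAffine _ := isAffineOpen_top (Spec (CommRingCat.of ℂ))
  exact .of_isIso (Scheme.Hom.isPullback_resLE H (US := ⊤) (UT := U₂) (UX := U₁) le_top le_top
    rfl).isoPullback.hom

/-! ### Monomials on the torus of the quadric -/

/-- The open torus in the quadric. -/
abbrev torus : surface.Opens := pr₁ ⁻¹ᵁ lineTorus ⊓ pr₂ ⁻¹ᵁ lineTorus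

lemma isAffineOpen_lineInter (a b : Fin 2) :
    IsAffineOpen (lineOpen (MvPolynomial.X a * MvPolynomial.X b)) :=
  isAffineOpen_lineOpen two_pos (X_mul_X_mem a b)

lemma chart_inf_chart (c d : Fin 2 × Fin 2) : chart c ⊓ chart d =
    pr₁ ⁻¹ᵁ lineOpen (MvPolynomial.X c.1 * MvPolynomial.X d.1) ⊓
      pr₂ ⁻¹ᵁ lineOpen (MvPolynomial.X c.2 * MvPolynomial.X d.2) := by
  refine le_antisymm (le_inf (chart_le₁ c d) (chart_le₂ c d)) ?_
  rw [lineOpen_mul, lineOpen_mul]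
  exact fun p hp => ⟨⟨hp.1.1, hp.2.1⟩, ⟨hp.1.2, hp.2.2⟩⟩

lemma torus_le_chart (c : Fin 2 × Fin 2) : torus ≤ chart c :=
  fun _ hp => ⟨lineTorus_le c.1 hp.1, lineTorus_le c.2 hp.2⟩

/-- The monomial `(x₁ / x₀) ^ a (z₁ / z₀) ^ b` on the torus. -/
def mon (e : ℤ × ℤ) : Γ(surface, torus) :=
  pull pr₁ pr₁_lineToSpec (U := lineTorus) inf_le_left (lineMon e.1) *
    pull pr₂ pr₂_lineToSpec (U := lineTorus) inf_le_right (lineMon e.2)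

/-- The basis of the functions on the torus that consists of the monomials. -/
def torusBasis : Module.Basis (ℤ × ℤ) ℂ Γ(surface, torus) :=
  (lineBasis.tensorProduct lineBasis).map (AlgEquiv.ofBijective
    (tensorMap lineTorus lineTorus)
    (tensorMap_bijective (isAffineOpen_lineInter 0 1) (isAffineOpen_lineInter 0 1))).toLinearEquiv

lemma torusBasis_apply (e : ℤ × ℤ) : torusBasis e = mon e := by
  rw [torusBasis, Module.Basis.map_apply, Module.Basis.tensorProduct_apply, lineBasis,
    Module.Basis.mk_apply, Module.Basis.mk_apply]
  exact Algebra.TensorProduct.productMap_apply_tmul _ _ _ _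

/-- The exponents of the monomials that extend to the intersection of two charts. -/
def regularExps (c d : Fin 2 × Fin 2) : Set (ℤ × ℤ) :=
  {e | IsRegularExp c.1 d.1 e.1 ∧ IsRegularExp c.2 d.2 e.2}

lemma res_pull_mul_pull {V : surface.Opens} {U₁ U₂ : line.Opens} (hV₁ : V ≤ pr₁ ⁻¹ᵁ U₁)
    (hV₂ : V ≤ pr₂ ⁻¹ᵁ U₂) (h₁ : lineTorus ≤ U₁) (h₂ : lineTorus ≤ U₂) (h : torus ≤ V)
    (s : Γ(line, U₁)) (t : Γ(line, U₂)) :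
    res h (pull pr₁ pr₁_lineToSpec hV₁ s * pull pr₂ pr₂_lineToSpec hV₂ t) =
      pull pr₁ pr₁_lineToSpec (U := lineTorus) inf_le_left (lineRes h₁ s) *
    pull pr₂ pr₂_lineToSpec (U := lineTorus) inf_le_right (lineRes h₂ t) := by
  rw [map_mul, res_pull, res_pull, pull_lineRes, pull_lineRes]

lemma pull_mul_pull_mem_span {A B : Set ℤ} {s t : Γ(line, lineTorus)}
    (hs : s ∈ Submodule.span ℂ (lineMon '' A)) (ht : t ∈ Submodule.span ℂ (lineMon '' B)) :
    pull pr₁ pr₁_lineToSpec (U := lineTorus) inf_le_left s *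
    pull pr₂ pr₂_lineToSpec (U := lineTorus) inf_le_right t ∈
      Submodule.span ℂ (mon '' {e | e.1 ∈ A ∧ e.2 ∈ B}) := by
  induction hs using Submodule.span_induction with
  | mem s hs =>
    obtain ⟨a, ha, rfl⟩ := hs
    induction ht using Submodule.span_induction with
    | mem t ht =>
      obtain ⟨b, hb, rfl⟩ := ht
      exact Submodule.subset_span ⟨(a, b), ⟨ha, hb⟩, rfl⟩
    | zero => rw [map_zero, mul_zero]; exact zero_mem _
    | add s t _ _ hs ht => rw [map_add, mul_add]; exact add_mem hs ht
    | smul r s _ hs => rw [map_smul, mul_smul_comm]; exact Submodule.smul_mem _ _ hs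
  | zero => rw [map_zero, zero_mul]; exact zero_mem _
  | add s t _ _ hs ht => rw [map_add, add_mul]; exact add_mem hs ht
  | smul r s _ hs => rw [map_smul, smul_mul_assoc]; exact Submodule.smul_mem _ _ hs

lemma sections_induction {U₁ U₂ : line.Opens} (h₁ : IsAffineOpen U₁) (h₂ : IsAffineOpen U₂)
    {p : Γ(surface, pr₁ ⁻¹ᵁ U₁ ⊓ pr₂ ⁻¹ᵁ U₂) → Prop} (zero : p 0)
    (add : ∀ s t, p s → p t → p (s + t))
    (mul : ∀ s t, p (pull pr₁ pr₁_lineToSpec inf_le_left s * pull pr₂ pr₂_lineToSpec inf_le_right t))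
    (s) : p s := by
  obtain ⟨z, rfl⟩ := (tensorMap_bijective h₁ h₂).2 s
  induction z using TensorProduct.induction_on with
  | zero => rw [map_zero]; exact zero
  | add x y hx hy => rw [map_add]; exact add _ _ hx hy
  | tmul x y => exact mul x y

lemma res_torus_mem_span {V : surface.Opens} (c d : Fin 2 × Fin 2) (hV : V = chart c ⊓ chart d)
    (h : torus ≤ V) (s : Γ(surface, V)) :
    res h s ∈ Submodule.span ℂ (mon '' regularExps c d) := by
  rw [chart_inf_chart] at hV
  subst hV
  induction s using sections_induction (isAffineOpen_lineInter c.1 d.1)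
    (isAffineOpen_lineInter c.2 d.2) with
  | zero => rw [map_zero]; exact zero_mem _
  | add s t hs ht => rw [map_add]; exact add_mem hs ht
  | mul s t =>
    rw [res_pull_mul_pull inf_le_left inf_le_right (lineTorus_le_inter c.1 d.1)
      (lineTorus_le_inter c.2 d.2)]
    have := pull_mul_pull_mem_span (lineRes_mem_span c.1 d.1 s) (lineRes_mem_span c.2 d.2 t)
    exact this

lemma mon_mem_range_res {V : surface.Opens} (c d : Fin 2 × Fin 2) (hV : V = chart c ⊓ chart d)
    (h : torus ≤ V) {e : ℤ × ℤ} (he : e ∈ regularExps c d) : ∃ s : Γ(surface, V), res h s = mon e := by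
  rw [chart_inf_chart] at hV
  subst hV
  obtain ⟨s, hs⟩ := lineMon_mem_range c.1 d.1 e.1 he.1
  obtain ⟨t, ht⟩ := lineMon_mem_range c.2 d.2 e.2 he.2
  refine ⟨pull pr₁ pr₁_lineToSpec inf_le_left s * pull pr₂ pr₂_lineToSpec inf_le_right t, ?_⟩
  rw [res_pull_mul_pull inf_le_left inf_le_right (lineTorus_le_inter c.1 d.1)
      (lineTorus_le_inter c.2 d.2), hs, ht, mon]

lemma res_torus_injective {V : surface.Opens} (c d : Fin 2 × Fin 2) (hV : V = chart c ⊓ chart d)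
    (h : torus ≤ V) : Function.Injective (res h) := by
  rw [chart_inf_chart] at hV
  subst hV
  have h1 := (tensorMap_bijective (isAffineOpen_lineInter c.1 d.1) (isAffineOpen_lineInter c.2 d.2))
  have h2 := (tensorMap_bijective (isAffineOpen_lineInter 0 1) (isAffineOpen_lineInter 0 1))
  rw [injective_iff_map_eq_zero]
  intro s hs
  obtain ⟨z, rfl⟩ := h1.2 s
  have h3 : res h (tensorMap _ _ z) = tensorMap lineTorus lineTorus (TensorProduct.map
      (lineRes (lineTorus_le_inter c.1 d.1)).toLinearMap
      (lineRes (lineTorus_le_inter c.2 d.2)).toLinearMap z) := by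
    clear hs
    induction z using TensorProduct.induction_on with
    | zero => simp only [map_zero]
    | add x y hx hy => simp only [map_add, hx, hy]
    | tmul x y =>
      exact (res_pull_mul_pull inf_le_left inf_le_right (lineTorus_le_inter _ _)
        (lineTorus_le_inter _ _) h x y)
  rw [h3] at hs
  have h4 := (injective_iff_map_eq_zero _).1 h2.1 _ hs
  have h5 := TensorProduct.map_injective_of_flat_flat
    (lineRes (lineTorus_le_inter c.1 d.1)).toLinearMap
    (lineRes (lineTorus_le_inter c.2 d.2)).toLinearMap
    (lineRes_injective _ _) (lineRes_injective _ _)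
  rw [(injective_iff_map_eq_zero _).1 h5 _ h4, map_zero]

/-! ### Transition functions -/

lemma res_self {V : surface.Opens} (h : V ≤ V) (s : Γ(surface, V)) : res h s = s := by
  have : (homOfLE h).op = 𝟙 _ := rfl
  change (surface.presheaf.map (homOfLE h).op).hom s = s
  rw [this, CategoryTheory.Functor.map_id]
  rfl

lemma ratio₁_val (c d : Fin 2 × Fin 2) : (ratio₁ c d : Γ(surface, chart c ⊓ chart d)) =
    pull pr₁ pr₁_lineToSpec (chart_le₁ c d) (lineRatio c.1 d.1).1 := rfl

lemma ratio₂_val (c d : Fin 2 × Fin 2) : (ratio₂ c d : Γ(surface, chart c ⊓ chart d)) =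
    pull pr₂ pr₂_lineToSpec (chart_le₂ c d) (lineRatio c.2 d.2).1 := rfl

lemma lineRatio_mul (a b e : Fin 2) {U : line.Opens}
    (h₁ : U ≤ lineOpen (MvPolynomial.X a * MvPolynomial.X b))
    (h₂ : U ≤ lineOpen (MvPolynomial.X b * MvPolynomial.X e))
    (h₃ : U ≤ lineOpen (MvPolynomial.X a * MvPolynomial.X e)) :
    lineRes h₁ (lineRatio a b).1 * lineRes h₂ (lineRatio b e).1 = lineRes h₃ (lineRatio a e).1 := by
  refine ev_injective fun x hx => ?_
  have hb : toRF (MvPolynomial.X b) ≠ 0 := toRF_ne_zero (lineOpen_mul_le_right _ _ (h₁ hx))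
  rw [map_mul, ev_lineRes, ev_lineRes, ev_lineRes, ev_lineRatio, ev_lineRatio, ev_lineRatio]
  field_simp

lemma pull_lineRatio_mul (q : surface ⟶ line) (hq : q ≫ lineToSpec = toSpec) {T : surface.Opens}
    (a b e : Fin 2)
    (h₁ : T ≤ q ⁻¹ᵁ lineOpen (MvPolynomial.X a * MvPolynomial.X b))
    (h₂ : T ≤ q ⁻¹ᵁ lineOpen (MvPolynomial.X b * MvPolynomial.X e))
    (h₃ : T ≤ q ⁻¹ᵁ lineOpen (MvPolynomial.X a * MvPolynomial.X e)) :
    pull q hq h₁ (lineRatio a b).1 * pull q hq h₂ (lineRatio b e).1 =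
      pull q hq h₃ (lineRatio a e).1 := by
  let U := lineOpen (MvPolynomial.X a * MvPolynomial.X b) ⊓
    (lineOpen (MvPolynomial.X b * MvPolynomial.X e) ⊓ lineOpen (MvPolynomial.X a * MvPolynomial.X e))
  have hU : T ≤ q ⁻¹ᵁ U := le_inf h₁ (le_inf h₂ h₃)
  have k₁ : U ≤ lineOpen (MvPolynomial.X a * MvPolynomial.X b) := inf_le_left
  have k₂ : U ≤ lineOpen (MvPolynomial.X b * MvPolynomial.X e) := inf_le_right.trans inf_le_left
  have k₃ : U ≤ lineOpen (MvPolynomial.X a * MvPolynomial.X e) := inf_le_right.trans inf_le_right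
  rw [← pull_lineRes q hq hU k₁, ← pull_lineRes q hq hU k₂, ← pull_lineRes q hq hU k₃, ← map_mul,
    lineRatio_mul]

/-- The transition function of `𝒪(m, n)` from the chart `c` to the chart `d`, as an invertible
function on an open subset of both charts. -/
def trans (m n : ℤ) (c d : Fin 2 × Fin 2) {T : surface.Opens} (h : T ≤ chart c ⊓ chart d) :
    Γ(surface, T)ˣ :=
  Units.map (res h).toRingHom.toMonoidHom (transition m n c d)

lemma trans_val (m n : ℤ) (c d : Fin 2 × Fin 2) {T : surface.Opens} (h : T ≤ chart c ⊓ chart d) :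
    (trans m n c d h : Γ(surface, T)) = res h (transition m n c d : Γ(surface, _)) := rfl

lemma res_trans (m n : ℤ) (c d : Fin 2 × Fin 2) {T T' : surface.Opens} (h : T ≤ chart c ⊓ chart d)
    (h' : T' ≤ T) : res h' (trans m n c d h).1 = (trans m n c d (h'.trans h)).1 := by
  rw [trans_val, trans_val, res_res]

lemma trans_eq (m n : ℤ) (c d : Fin 2 × Fin 2) {T : surface.Opens} (h : T ≤ chart c ⊓ chart d) :
    trans m n c d h = Units.map (res h).toRingHom.toMonoidHom (ratio₁ c d) ^ m *
      Units.map (res h).toRingHom.toMonoidHom (ratio₂ c d) ^ n := by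
  rw [trans, transition, map_mul, map_zpow, map_zpow]

lemma trans_mul (m n : ℤ) (c d e : Fin 2 × Fin 2) {T : surface.Opens} (h₁ : T ≤ chart c ⊓ chart d)
    (h₂ : T ≤ chart d ⊓ chart e) (h₃ : T ≤ chart c ⊓ chart e) :
    trans m n c d h₁ * trans m n d e h₂ = trans m n c e h₃ := by
  have e₁ : Units.map (res h₁).toRingHom.toMonoidHom (ratio₁ c d) *
      Units.map (res h₂).toRingHom.toMonoidHom (ratio₁ d e) =
      Units.map (res h₃).toRingHom.toMonoidHom (ratio₁ c e) := by
    ext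
    change res h₁ (ratio₁ c d).1 * res h₂ (ratio₁ d e).1 = res h₃ (ratio₁ c e).1
    rw [ratio₁_val, ratio₁_val, ratio₁_val, res_pull, res_pull, res_pull, pull_lineRatio_mul]
  have e₂ : Units.map (res h₁).toRingHom.toMonoidHom (ratio₂ c d) *
      Units.map (res h₂).toRingHom.toMonoidHom (ratio₂ d e) =
      Units.map (res h₃).toRingHom.toMonoidHom (ratio₂ c e) := by
    ext
    change res h₁ (ratio₂ c d).1 * res h₂ (ratio₂ d e).1 = res h₃ (ratio₂ c e).1
    rw [ratio₂_val, ratio₂_val, ratio₂_val, res_pull, res_pull, res_pull, pull_lineRatio_mul]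
  rw [trans_eq, trans_eq, trans_eq, ← e₁, ← e₂, mul_zpow, mul_zpow]
  exact mul_mul_mul_comm _ _ _ _

lemma trans_self (m n : ℤ) (c : Fin 2 × Fin 2) {T : surface.Opens} (h : T ≤ chart c ⊓ chart c) :
    trans m n c c h = 1 := by
  have := trans_mul m n c c c h h h
  simpa using this

/-! ### Transition functions as monomials -/

lemma lineMon_add (a b : ℤ) : lineMon (a + b) = lineMon a * lineMon b := by
  rw [lineMon, zpow_add]; rfl

lemma lineMon_zero : lineMon 0 = 1 := rfl

lemma mon_add (e e' : ℤ × ℤ) : mon (e + e') = mon e * mon e' := by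
  simp only [mon, Prod.fst_add, Prod.snd_add, lineMon_add, map_mul]
  exact mul_mul_mul_comm _ _ _ _

lemma mon_zero : mon 0 = 1 := by
  simp only [mon, Prod.fst_zero, Prod.snd_zero, lineMon_zero, map_one, mul_one]

/-- The exponent of the monomial by which `𝒪(m, n)` is trivialised over the chart `c`: a section
given by `t` over this chart is `mon (chartExp m n c) * t` in the trivialisation over the chart
`(0, 0)`. -/
def chartExp (m n : ℤ) (c : Fin 2 × Fin 2) : ℤ × ℤ := (m * (c.1 : ℤ), n * (c.2 : ℤ))

lemma lineRes_lineRatio (a b : Fin 2) :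
    lineRes (lineTorus_le_inter a b) (lineRatio a b).1 = lineMon (a - b) := by
  refine ev_injective fun x hx => ?_
  have h0 := toRF_ne_zero (lineTorus_le 0 hx)
  have h1 := toRF_ne_zero (lineTorus_le 1 hx)
  rw [ev_lineRes, ev_lineRatio, ev_lineMon, zpow_sub₀ (div_ne_zero h1 h0), toRF_X_div a hx,
    toRF_X_div b hx]
  field_simp

lemma trans_torus (m n : ℤ) (c d : Fin 2 × Fin 2) (h : torus ≤ chart c ⊓ chart d) :
    (trans m n c d h).1 = mon (chartExp m n c - chartExp m n d) := by
  have e₁ : Units.map (res h).toRingHom.toMonoidHom (ratio₁ c d) =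
      Units.map (pull pr₁ pr₁_lineToSpec (V := torus) (U := lineTorus) inf_le_left).toRingHom.toMonoidHom
        (lineMonUnit ^ ((c.1 : ℤ) - d.1)) := by
    ext
    change res h (ratio₁ c d).1 = pull pr₁ _ _ (lineMon _)
    rw [ratio₁_val, res_pull, ← lineRes_lineRatio, pull_lineRes]
  have e₂ : Units.map (res h).toRingHom.toMonoidHom (ratio₂ c d) =
      Units.map (pull pr₂ pr₂_lineToSpec (V := torus) (U := lineTorus) inf_le_right).toRingHom.toMonoidHom
        (lineMonUnit ^ ((c.2 : ℤ) - d.2)) := by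
    ext
    change res h (ratio₂ c d).1 = pull pr₂ _ _ (lineMon _)
    rw [ratio₂_val, res_pull, ← lineRes_lineRatio, pull_lineRes]
  rw [trans_eq, e₁, e₂, ← map_zpow, ← map_zpow, ← zpow_mul, ← zpow_mul, mul_comm _ m, mul_comm _ n,
    mul_sub, mul_sub]
  rfl

lemma repr_mon_mul (e : ℤ × ℤ) (s : Γ(surface, torus)) (x : ℤ × ℤ) :
    torusBasis.repr (mon e * s) x = torusBasis.repr s (x - e) := by
  have : (Finsupp.lapply x) ∘ₗ torusBasis.repr.toLinearMap ∘ₗ LinearMap.mulLeft ℂ (mon e) =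
      (Finsupp.lapply (x - e)) ∘ₗ torusBasis.repr.toLinearMap := by
    refine torusBasis.ext fun e' => ?_
    simp only [LinearMap.comp_apply, LinearMap.mulLeft_apply, LinearEquiv.coe_coe, torusBasis_apply,
      ← mon_add, Finsupp.lapply_apply]
    rw [← torusBasis_apply, ← torusBasis_apply, Module.Basis.repr_self, Module.Basis.repr_self,
      Finsupp.single_apply, Finsupp.single_apply]
    congr 1
    rw [eq_sub_iff_add_eq, add_comm]
  exact LinearMap.congr_fun this s

lemma mem_regularExps_of_repr_ne_zero {V : surface.Opens} (c d : Fin 2 × Fin 2)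
    (hV : V = chart c ⊓ chart d) (h : torus ≤ V) (s : Γ(surface, V)) {e : ℤ × ℤ}
    (he : torusBasis.repr (res h s) e ≠ 0) : e ∈ regularExps c d := by
  have h1 := res_torus_mem_span c d hV h s
  have h2 : mon = torusBasis := funext fun e => (torusBasis_apply e).symm
  rw [h2, Module.Basis.mem_span_image] at h1
  exact h1 (Finsupp.mem_support_iff.2 he)

lemma exists_res_eq {V : surface.Opens} (c d : Fin 2 × Fin 2)
    (hV : V = chart c ⊓ chart d) (h : torus ≤ V) (s : Γ(surface, torus))
    (hs : ∀ e, torusBasis.repr s e ≠ 0 → e ∈ regularExps c d) :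
    ∃ t : Γ(surface, V), res h t = s := by
  have h1 : s ∈ Submodule.span ℂ (mon '' regularExps c d) := by
    have h2 : mon = torusBasis := funext fun e => (torusBasis_apply e).symm
    rw [h2, Module.Basis.mem_span_image]
    exact fun e he => hs e (Finsupp.mem_support_iff.1 he)
  have h2 : Submodule.span ℂ (mon '' regularExps c d) ≤ LinearMap.range (res h).toLinearMap := by
    rw [Submodule.span_le]
    rintro _ ⟨e, he, rfl⟩
    exact mon_mem_range_res c d hV h he
  exact h2 h1

/-! ### Vanishing of the first Čech cohomology of `𝒪(m, n)` -/

lemma isRegularExp_self_iff (a : Fin 2) (k : ℤ) :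
    IsRegularExp a a k ↔ (a = 0 → 0 ≤ k) ∧ (a = 1 → k ≤ 0) := by
  simp [IsRegularExp]

/-- The chart at which the Čech complex is contracted in degree `x`. It is chosen such that, for
`m, n ≥ -1`, a monomial of degree `x` that is a section of `𝒪(m, n)` over the intersection of this
chart with another one is already a section over the other chart. -/
def corner (x : ℤ × ℤ) : Fin 2 × Fin 2 := (if x.1 < 0 then 0 else 1, if x.2 < 0 then 0 else 1)

/-- If `m ≥ -1`, then a negative degree satisfies `x ≤ m`, so it occurs on the second chart of the
line, and a non-negative degree occurs on the first one. -/
lemma isRegularExp_of_corner {m : ℤ} (hm : -1 ≤ m) (j : Fin 2) {x : ℤ}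
    (h : IsRegularExp (if x < 0 then 0 else 1) j (x - m * ((if x < 0 then 0 else 1 : Fin 2) : ℤ))) :
    IsRegularExp j j (x - m * (j : ℤ)) := by
  rw [isRegularExp_self_iff]
  obtain ⟨h1, h2⟩ := h
  constructor
  · rintro rfl
    by_contra h3
    have hx : x < 0 := by simpa using h3
    have := h1 ⟨by simp [hx], rfl⟩
    simp [hx] at this
    omega
  · rintro rfl
    by_contra h3
    have hx : ¬ x < 0 := by simp at h3; omega
    have := h2 ⟨by simp [hx], rfl⟩
    simp [hx] at this h3
    omega

/-- Čech cocycles of `𝒪(m, n)` are coboundaries, for `m, n ≥ -1`. In degree `x` the cochain `τ` is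
the cocycle at the chart `corner x`. All functions are restricted to the torus and written in the
trivialisation over the chart `(0, 0)`. -/
lemma exists_cochain {m n : ℤ} (hm : -1 ≤ m) (hn : -1 ≤ n)
    (σ : Fin 2 × Fin 2 → Fin 2 × Fin 2 → Γ(surface, torus))
    (hσ : ∀ c d e, σ d e - σ c e + σ c d = 0)
    (hs : ∀ c d x, torusBasis.repr (σ c d) x ≠ 0 → x - chartExp m n c ∈ regularExps c d) :
    ∃ τ : Fin 2 × Fin 2 → Γ(surface, torus),
      (∀ c x, torusBasis.repr (τ c) x ≠ 0 → x - chartExp m n c ∈ regularExps c c) ∧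
      ∀ c d, σ c d = τ d - τ c := by
  classical
  let τ : Fin 2 × Fin 2 → Γ(surface, torus) := fun c => torusBasis.repr.symm
    (∑ p, (torusBasis.repr (σ p c)).filter (fun x => corner x = p))
  have hτ (c x) : torusBasis.repr (τ c) x = torusBasis.repr (σ (corner x) c) x := by
    simp only [τ, LinearEquiv.apply_symm_apply, Finsupp.finsetSum_apply, Finsupp.filter_apply]
    rw [Finset.sum_ite_eq Finset.univ (corner x) (fun p => torusBasis.repr (σ p c) x)]
    simp
  refine ⟨τ, fun c x hx => ?_, fun c d => ?_⟩
  · rw [hτ] at hx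
    obtain ⟨h1, h2⟩ := hs _ _ _ hx
    exact ⟨isRegularExp_of_corner hm _ h1, isRegularExp_of_corner hn _ h2⟩
  · apply torusBasis.repr.injective
    ext x
    rw [map_sub, Finsupp.sub_apply, hτ, hτ, ← Finsupp.sub_apply, ← map_sub]
    congr 2
    have := hσ (corner x) c d
    rw [← sub_eq_zero, ← this]
    abel

/-! ### Fractions on the surface -/

/-- The pull-back under a projection `q` of the function `F / f ^ k` on the line. -/
def frc (q : surface ⟶ line) (hq : q ≫ lineToSpec = toSpec) (f : grading 1) (k : ℕ)
    {V : surface.Opens} (hV : V ≤ q ⁻¹ᵁ lineOpen f) : grading k →ₗ[ℂ] Γ(surface, V) :=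
  (pull q hq hV).toLinearMap ∘ₗ lineFrac f k le_rfl

section frc

variable (q : surface ⟶ line) (hq : q ≫ lineToSpec = toSpec) {V : surface.Opens}

lemma lineRes_lineFrac (f : grading 1) (k : ℕ) {U U' : line.Opens} (hU : U ≤ lineOpen f)
    (h : U' ≤ U) (F : grading k) : lineRes h (lineFrac f k hU F) = lineFrac f k (h.trans hU) F :=
  ev_injective fun x hx => by rw [ev_lineRes, ev_lineFrac, ev_lineFrac]

lemma frc_eq_pull (f : grading 1) (k : ℕ) {U : line.Opens} (hU : U ≤ lineOpen f)
    (hV : V ≤ q ⁻¹ᵁ U) (F : grading k) (hV' : V ≤ q ⁻¹ᵁ lineOpen f) :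
    frc q hq f k hV' F = pull q hq hV (lineFrac f k hU F) := by
  rw [← lineRes_lineFrac f k le_rfl hU, pull_lineRes]
  rfl

lemma res_frc (f : grading 1) (k : ℕ) {W : surface.Opens} (hV : V ≤ q ⁻¹ᵁ lineOpen f) (h : W ≤ V)
    (F : grading k) : res h (frc q hq f k hV F) = frc q hq f k (h.trans hV) F :=
  res_pull q hq _ _ _

lemma frc_mul_frc (f : grading 1) (k j : ℕ) (hV : V ≤ q ⁻¹ᵁ lineOpen f) (F : grading k)
    (G : grading j) : frc q hq f k hV F * frc q hq f j hV G =
      frc q hq f (k + j) hV ⟨F.1 * G.1, SetLike.mul_mem_graded F.2 G.2⟩ := by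
  refine (map_mul (pull q hq hV) _ _).symm.trans (congrArg (pull q hq hV) ?_)
  refine ev_injective fun x hx => ?_
  rw [map_mul, ev_lineFrac, ev_lineFrac, ev_lineFrac, map_mul, pow_add, div_mul_div_comm]

lemma frc_change (f g : grading 1) (k : ℕ) (hf : V ≤ q ⁻¹ᵁ lineOpen f) (hg : V ≤ q ⁻¹ᵁ lineOpen g)
    (F : grading k) : frc q hq f k hf F = frc q hq g k hg F * frc q hq f 1 hf g ^ k := by
  have hU : V ≤ q ⁻¹ᵁ (lineOpen f ⊓ lineOpen g) := le_inf hf hg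
  rw [frc_eq_pull q hq f k inf_le_left hU, frc_eq_pull q hq g k inf_le_right hU,
    frc_eq_pull q hq f 1 inf_le_left hU, ← map_pow, ← map_mul]
  congr 1
  refine ev_injective fun x hx => ?_
  have h1 := toRF_ne_zero hx.1
  have h2 := toRF_ne_zero hx.2
  rw [map_mul, map_pow, ev_lineFrac, ev_lineFrac, ev_lineFrac, pow_one, div_pow]
  field_simp

lemma frc_self (f : grading 1) (hf : V ≤ q ⁻¹ᵁ lineOpen f) : frc q hq f 1 hf f = 1 := by
  rw [← map_one (pull q hq hf)]
  refine congrArg (pull q hq hf) (ev_injective fun x hx => ?_)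
  have h1 := toRF_ne_zero hx
  rw [ev_lineFrac, map_one, pow_one, div_self h1]

lemma frc_mul_frc_change (f g h : grading 1) (hf : V ≤ q ⁻¹ᵁ lineOpen f) (hg : V ≤ q ⁻¹ᵁ lineOpen g) :
    frc q hq g 1 hg f * frc q hq f 1 hf h = frc q hq g 1 hg h := by
  have := frc_change q hq g f 1 hg hf h
  rw [this, pow_one, mul_comm]

/-- The invertible function `f / g`, for linear forms `f`, `g` that do not vanish on `V`. -/
def quot (f g : grading 1) (hf : V ≤ q ⁻¹ᵁ lineOpen f) (hg : V ≤ q ⁻¹ᵁ lineOpen g) :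
    Γ(surface, V)ˣ where
  val := frc q hq g 1 hg f
  inv := frc q hq f 1 hf g
  val_inv := by rw [frc_mul_frc_change, frc_self]
  inv_val := by rw [frc_mul_frc_change, frc_self]

lemma quot_mul (f g h : grading 1) (hf : V ≤ q ⁻¹ᵁ lineOpen f) (hg : V ≤ q ⁻¹ᵁ lineOpen g)
    (hh : V ≤ q ⁻¹ᵁ lineOpen h) :
    quot q hq f g hf hg * quot q hq g h hg hh = quot q hq f h hf hh := by
  ext
  change frc q hq g 1 hg f * frc q hq h 1 hh g = frc q hq h 1 hh f
  rw [mul_comm, frc_mul_frc_change]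

lemma pull_lineRatio (a b : Fin 2)
    (h : V ≤ q ⁻¹ᵁ lineOpen (MvPolynomial.X a * MvPolynomial.X b))
    (hb : V ≤ q ⁻¹ᵁ lineOpen (coord b).1) :
    pull q hq h (lineRatio a b).1 = frc q hq (coord b) 1 hb (coord a) := by
  have hle : lineOpen (MvPolynomial.X a * MvPolynomial.X b) ≤ lineOpen (coord b).1 :=
    lineOpen_mul_le_right _ _
  rw [frc_eq_pull q hq (coord b) 1 hle h]
  congr 1
  refine ev_injective fun x hx => ?_
  rw [ev_lineRatio, ev_lineFrac, pow_one, coe_coord, coe_coord]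

end frc

lemma le_preimage₁ {V : surface.Opens} {c : Fin 2 × Fin 2} (h : V ≤ chart c) :
    V ≤ pr₁ ⁻¹ᵁ lineOpen (coord c.1).1 := h.trans inf_le_left

lemma le_preimage₂ {V : surface.Opens} {c : Fin 2 × Fin 2} (h : V ≤ chart c) :
    V ≤ pr₂ ⁻¹ᵁ lineOpen (coord c.2).1 := h.trans inf_le_right

lemma trans_eq_quot (m n : ℤ) (c d : Fin 2 × Fin 2) {V : surface.Opens} (h : V ≤ chart c ⊓ chart d)
    (hc : V ≤ chart c) (hd : V ≤ chart d) :
    trans m n c d h =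
      quot pr₁ pr₁_lineToSpec (coord c.1) (coord d.1) (le_preimage₁ hc) (le_preimage₁ hd) ^ m *
      quot pr₂ pr₂_lineToSpec (coord c.2) (coord d.2) (le_preimage₂ hc) (le_preimage₂ hd) ^ n := by
  rw [trans_eq]
  congr 2
  · ext
    change res h (ratio₁ c d).1 = frc _ _ _ _ _ _
    rw [ratio₁_val, res_pull, pull_lineRatio]
  · ext
    change res h (ratio₂ c d).1 = frc _ _ _ _ _ _
    rw [ratio₂_val, res_pull, pull_lineRatio]

/-! ### Global sections -/

/-- The monomial `X₀ ^ (m - a) X₁ ^ a`. -/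
def monForm (m : ℕ) (a : Fin (m + 1)) : grading m :=
  ⟨MvPolynomial.X 0 ^ (m - a : ℕ) * MvPolynomial.X 1 ^ (a : ℕ), by
    have := (MvPolynomial.isHomogeneous_X_pow (R := ℂ) (0 : Fin 2) (m - a)).mul
      (MvPolynomial.isHomogeneous_X_pow (R := ℂ) (1 : Fin 2) a)
    rwa [Nat.sub_add_cancel (Nat.lt_succ_iff.1 a.2)] at this⟩

lemma lineTorus_le_coord (c : Fin 2) : lineTorus ≤ lineOpen (coord c).1 := lineTorus_le c

lemma lineFrac_monForm (m : ℕ) (a : Fin (m + 1)) (c : Fin 2) :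
    lineFrac (coord c) m (lineTorus_le_coord c) (monForm m a) = lineMon ((a : ℤ) - m * (c : ℤ)) := by
  refine ev_injective fun x hx => ?_
  have h0 := toRF_ne_zero (lineTorus_le 0 hx)
  have h1 := toRF_ne_zero (lineTorus_le 1 hx)
  have ha : m = (m - a) + (a : ℕ) := (Nat.sub_add_cancel (Nat.lt_succ_iff.1 a.2)).symm
  rw [ev_lineFrac, ev_lineMon, coe_coord, toRF_X_div c hx, monForm, map_mul, map_pow, map_pow,
    zpow_sub₀ (div_ne_zero h1 h0), mul_pow, mul_comm (m : ℤ), zpow_mul, zpow_natCast, zpow_natCast]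
  have hp : toRF (MvPolynomial.X 0) ^ m =
      toRF (MvPolynomial.X 0) ^ (m - a : ℕ) * toRF (MvPolynomial.X 0) ^ (a : ℕ) := by
    rw [← pow_add, ← ha]
  rw [hp]
  simp only [zpow_natCast]
  rw [div_pow _ _ (a : ℕ)]
  field_simp

/-- A family of functions on the charts is a global section of `𝒪(m, n)`. -/
def IsGlobalSection (m n : ℤ) (t : ∀ c, Γ(surface, chart c)) : Prop :=
  ∀ c d, res inf_le_right (t d) = (trans m n c d le_rfl).1 * res inf_le_left (t c)

lemma IsGlobalSection.mon_mul_res {m n : ℤ} {t : ∀ c, Γ(surface, chart c)}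
    (ht : IsGlobalSection m n t) (c d : Fin 2 × Fin 2) :
    mon (chartExp m n d) * res (torus_le_chart d) (t d) =
      mon (chartExp m n c) * res (torus_le_chart c) (t c) := by
  have h := congrArg (res (le_inf (torus_le_chart c) (torus_le_chart d))) (ht c d)
  rw [map_mul, res_res, res_res, res_trans, trans_torus] at h
  rw [h, ← mul_assoc, ← mon_add, add_sub_cancel]

lemma IsGlobalSection.mem_of_repr_ne_zero {m n : ℤ} {t : ∀ c, Γ(surface, chart c)}
    (ht : IsGlobalSection m n t) {x : ℤ × ℤ}
    (hx : torusBasis.repr (res (torus_le_chart (0, 0)) (t (0, 0))) x ≠ 0) :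
    (0 ≤ x.1 ∧ x.1 ≤ m) ∧ (0 ≤ x.2 ∧ x.2 ≤ n) := by
  have h0 := mem_regularExps_of_repr_ne_zero (0, 0) (0, 0) (inf_idem _).symm _ _ hx
  have h := ht.mon_mul_res (1, 1) (0, 0)
  have e0 : chartExp m n (0, 0) = 0 := by simp [chartExp]
  rw [e0, mon_zero, one_mul] at h
  rw [h, repr_mon_mul] at hx
  have h1 := mem_regularExps_of_repr_ne_zero (1, 1) (1, 1) (inf_idem _).symm _ _ hx
  simp only [regularExps, IsRegularExp, chartExp, Set.mem_ofPred_eq] at h0 h1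
  simp at h0 h1
  omega

lemma IsGlobalSection.ext {m n : ℤ} {t t' : ∀ c, Γ(surface, chart c)}
    (ht : IsGlobalSection m n t) (ht' : IsGlobalSection m n t')
    (h : res (torus_le_chart (0, 0)) (t (0, 0)) = res (torus_le_chart (0, 0)) (t' (0, 0))) : t = t' := by
  funext c
  apply res_torus_injective c c (inf_idem _).symm (torus_le_chart c)
  have h1 := ht.mon_mul_res c (0, 0)
  have h2 := ht'.mon_mul_res c (0, 0)
  rw [h, h2] at h1
  have h3 := congrArg (fun s => mon (- chartExp m n c) * s) h1
  simpa only [← mul_assoc, ← mon_add, neg_add_cancel, mon_zero, one_mul, eq_comm] using h3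

lemma IsGlobalSection.eq_zero {m n : ℤ} {t : ∀ c, Γ(surface, chart c)}
    (ht : IsGlobalSection m n t) (hmn : m < 0 ∨ n < 0) : t = 0 := by
  refine ht.ext (t' := 0) (fun c d => by simp) ?_
  rw [Pi.zero_apply, map_zero]
  apply torusBasis.repr.injective
  ext x
  by_contra hx
  rw [map_zero, Finsupp.zero_apply] at hx
  have := ht.mem_of_repr_ne_zero hx
  omega

/-- The section of `𝒪(m, n)` given by forms `F` and `G` on the two factors. -/
def formSection {m n : ℕ} (F : grading m) (G : grading n) (c : Fin 2 × Fin 2) :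
    Γ(surface, chart c) :=
  frc pr₁ pr₁_lineToSpec (coord c.1) m (le_preimage₁ le_rfl) F *
    frc pr₂ pr₂_lineToSpec (coord c.2) n (le_preimage₂ le_rfl) G

lemma res_formSection_monForm (m n : ℕ) (a : Fin (m + 1)) (b : Fin (n + 1)) (c : Fin 2 × Fin 2) :
    res (torus_le_chart c) (formSection (monForm m a) (monForm n b) c) =
      mon ((((a : ℕ) : ℤ), ((b : ℕ) : ℤ)) - chartExp m n c) := by
  rw [formSection, map_mul, res_frc, res_frc, frc_eq_pull _ _ _ _ (lineTorus_le_coord c.1) inf_le_left,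
    frc_eq_pull _ _ _ _ (lineTorus_le_coord c.2) inf_le_right, lineFrac_monForm, lineFrac_monForm]
  rfl

lemma isGlobalSection_formSection {m n : ℕ} (F : grading m) (G : grading n) :
    IsGlobalSection m n (formSection F G) := by
  intro c d
  rw [trans_eq_quot (m : ℤ) (n : ℤ) c d le_rfl inf_le_left inf_le_right, formSection, formSection,
    map_mul, map_mul, res_frc, res_frc, res_frc, res_frc,
    frc_change _ _ (coord d.1) (coord c.1) m _ (le_preimage₁ inf_le_left),
    frc_change _ _ (coord d.2) (coord c.2) n _ (le_preimage₂ inf_le_left), zpow_natCast,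
    zpow_natCast]
  change _ * _ * (_ * _) = (frc _ _ _ _ _ _ ^ m * frc _ _ _ _ _ _ ^ n) * (_ * _)
  ring

lemma IsGlobalSection.sum {ι : Type*} (s : Finset ι) {m n : ℤ} {t : ι → ∀ c, Γ(surface, chart c)}
    (r : ι → ℂ) (ht : ∀ i, IsGlobalSection m n (t i)) :
    IsGlobalSection m n (fun c => ∑ i ∈ s, r i • t i c) := by
  intro c d
  simp only [map_sum, map_smul, Finset.mul_sum, mul_smul_comm]
  exact Finset.sum_congr rfl fun i _ => by rw [ht i c d]

lemma IsGlobalSection.exists_eq_sum {m n : ℕ} {t : ∀ c, Γ(surface, chart c)}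
    (ht : IsGlobalSection m n t) : ∃ φ : Fin (m + 1) × Fin (n + 1) → ℂ, ∀ c,
      t c = ∑ e, φ e • formSection (monForm m e.1) (monForm n e.2) c := by
  classical
  let ψ := torusBasis.repr (res (torus_le_chart (0, 0)) (t (0, 0)))
  refine ⟨fun e => ψ ((e.1 : ℕ), (e.2 : ℕ)), fun c => ?_⟩
  refine congrFun (ht.ext (IsGlobalSection.sum _ _ fun e => isGlobalSection_formSection _ _) ?_) c
  simp only [map_sum, map_smul, res_formSection_monForm]
  have e0 : chartExp m n (0, 0) = 0 := by simp [chartExp]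
  simp only [e0, sub_zero, ← torusBasis_apply]
  apply torusBasis.repr.injective
  ext x
  simp only [map_sum, map_smul, Module.Basis.repr_self, Finsupp.finsetSum_apply, Finsupp.smul_apply,
    Finsupp.single_apply, smul_eq_mul, mul_ite, mul_one, mul_zero]
  change ψ x = _
  by_cases hx : ψ x = 0
  · rw [hx, eq_comm]
    refine Finset.sum_eq_zero fun e _ => ?_
    split_ifs with h
    · rw [h, hx]
    · rfl
  · obtain ⟨⟨h1, h2⟩, h3, h4⟩ := ht.mem_of_repr_ne_zero hx
    obtain ⟨a, ha⟩ := Int.eq_ofNat_of_zero_le h1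
    obtain ⟨b, hb⟩ := Int.eq_ofNat_of_zero_le h3
    rw [Finset.sum_eq_single (⟨a, by omega⟩, ⟨b, by omega⟩)]
    · rw [if_pos]
      · congr 1
        ext <;> simp [ha, hb]
      · ext <;> simp [ha, hb]
    · rintro ⟨a', b'⟩ _ hne
      rw [if_neg]
      rintro rfl
      simp at ha hb
      exact hne (by ext <;> simp [ha, hb])
    · exact fun h => absurd (Finset.mem_univ _) h

/-! ### Quotients of an algebra by the span of the first powers of a generator -/

section Strip

open Polynomial

variable {K R : Type*} [Field K] [CommRing R] [Algebra K R]

lemma finrank_quotient_eq_add {M : Type*} [AddCommGroup M] [Module K M] (A : Submodule K M)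
    [Module.Finite K (M ⧸ A)] (f : M →ₗ[K] M) :
    Module.finrank K (M ⧸ A) =
      Module.finrank K (M ⧸ (A ⊔ LinearMap.range f)) + Module.finrank K (M ⧸ A.comap f) := by
  set g : (M ⧸ A.comap f) →ₗ[K] M ⧸ A := Submodule.mapQ _ _ f le_rfl with hg
  have hinj : Function.Injective g := by
    rw [← LinearMap.ker_eq_bot, hg, Submodule.ker_mapQ]
    exact Submodule.mkQ_map_self _
  have hr : LinearMap.range g = (LinearMap.range f).map A.mkQ := by
    rw [hg, Submodule.range_mapQ]
  have h1 := Submodule.finrank_quotient_add_finrank (LinearMap.range g)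
  rw [LinearMap.finrank_range_of_inj hinj, hr,
    (Submodule.quotientQuotientEquivQuotientSup A (LinearMap.range f)).finrank_eq] at h1
  exact h1.symm

/-- The span of the products `uⁱ vʲ` with `j < N`, as the image of the families of polynomials `p_j`
under `∑ p_j(u) vʲ`. -/
def strip (K : Type*) [Field K] [Algebra K R] (u v : R) (N : ℕ) : Submodule K R :=
  LinearMap.range (∑ j : Fin N, LinearMap.mulRight K (v ^ (j : ℕ)) ∘ₗ
    (aeval (R := K) u).toLinearMap ∘ₗ LinearMap.proj (R := K) (φ := fun _ : Fin N => K[X]) j)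

lemma mem_strip {u v : R} {N : ℕ} {x : R} :
    x ∈ strip K u v N ↔ ∃ p : Fin N → K[X], ∑ j, aeval u (p j) * v ^ (j : ℕ) = x := by
  simp [strip]

lemma aeval_mul_mem_strip {u v : R} {N : ℕ} (p : K[X]) {x : R} (hx : x ∈ strip K u v N) :
    aeval u p * x ∈ strip K u v N := by
  obtain ⟨q, rfl⟩ := mem_strip.1 hx
  refine mem_strip.2 ⟨fun j => p * q j, ?_⟩
  simp [Finset.mul_sum, mul_assoc]

lemma aeval_mul_pow_mem_strip (u v : R) {N : ℕ} (p : K[X]) {j : ℕ} (hj : j < N) :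
    aeval u p * v ^ j ∈ strip K u v N := by
  refine mem_strip.2 ⟨Pi.single ⟨j, hj⟩ p, ?_⟩
  rw [Finset.sum_eq_single ⟨j, hj⟩] <;> simp +contextual

/-- If a finite algebra is generated by `v`, the first `N` powers of `v` are linearly independent
for `N` at most the dimension of the algebra, and they span it for larger `N`. -/
lemma finrank_span_pow {B : Type*} [CommRing B] [Algebra K B] [Module.Finite K B] {v : B}
    (hv : Algebra.adjoin K {v} = ⊤) (N : ℕ) :
    Module.finrank K (Submodule.span K (Set.range fun j : Fin N => v ^ (j : ℕ))) =
      min N (Module.finrank K B) := by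
  have hint : IsIntegral K v := Algebra.IsIntegral.isIntegral v
  let pb := PowerBasis.ofAdjoinEqTop hint hv
  have hgen : pb.gen = v := PowerBasis.ofAdjoinEqTop_gen hint hv
  have hdim : Module.finrank K B = pb.dim := pb.finrank
  rcases le_total N (Module.finrank K B) with h | h
  · have hli : LinearIndependent K fun j : Fin N => v ^ (j : ℕ) := by
      have := pb.basis.linearIndependent.comp (Fin.castLE (hdim ▸ h)) (Fin.castLE_injective _)
      have he : (pb.basis ∘ Fin.castLE (hdim ▸ h)) = fun j : Fin N => v ^ (j : ℕ) := by
        ext j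
        simp [pb.coe_basis, hgen]
      rwa [he] at this
    rw [finrank_span_eq_card hli, Fintype.card_fin, min_eq_left h]
  · have htop : Submodule.span K (Set.range fun j : Fin N => v ^ (j : ℕ)) = ⊤ := by
      rw [eq_top_iff, ← pb.basis.span_eq]
      apply Submodule.span_mono
      rintro _ ⟨j, rfl⟩
      exact ⟨⟨j, j.2.trans_le (hdim ▸ h)⟩, by simp [pb.coe_basis, hgen]⟩
    rw [htop, finrank_top, min_eq_right h]

lemma finite_quotient_of_le {M : Type*} [AddCommGroup M] [Module K M] {A B : Submodule K M}
    (h : A ≤ B) [Module.Finite K (M ⧸ A)] : Module.Finite K (M ⧸ B) :=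
  Module.Finite.of_surjective (Submodule.mapQ A B LinearMap.id h) fun x => by
    obtain ⟨y, rfl⟩ := Submodule.mkQ_surjective _ x
    exact ⟨A.mkQ y, by simp⟩

lemma finite_quotient_ideal {I J : Ideal R} (h : I ≤ J) [Module.Finite K (R ⧸ I)] :
    Module.Finite K (R ⧸ J) :=
  Module.Finite.of_surjective (Ideal.Quotient.factorₐ K h).toLinearMap
    (Ideal.Quotient.factor_surjective h)

lemma finrank_quotient_congr {M : Type*} [AddCommGroup M] [Module K M] {A B : Submodule K M}
    (h : A = B) : Module.finrank K (M ⧸ A) = Module.finrank K (M ⧸ B) := by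
  rw [h]

lemma finrank_quotient_ker_sup {M N : Type*} [AddCommGroup M] [Module K M] [AddCommGroup N]
    [Module K N] [Module.Finite K N] (g : M →ₗ[K] N) (hg : Function.Surjective g)
    (W : Submodule K M) : Module.finrank K (M ⧸ (LinearMap.ker g ⊔ W)) =
      Module.finrank K N - Module.finrank K (W.map g) := by
  have hs : Function.Surjective ((W.map g).mkQ ∘ₗ g) := (Submodule.mkQ_surjective _).comp hg
  have h1 := (LinearMap.quotKerEquivOfSurjective _ hs).finrank_eq
  rw [LinearMap.ker_comp, Submodule.ker_mkQ, Submodule.comap_map_eq, sup_comm] at h1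
  have h2 := Submodule.finrank_quotient_add_finrank (W.map g)
  omega

lemma finrank_quotient_eq_zero_iff {M : Type*} [AddCommGroup M] [Module K M] {A : Submodule K M}
    [Module.Finite K (M ⧸ A)] : Module.finrank K (M ⧸ A) = 0 ↔ A = ⊤ := by
  rw [Module.finrank_zero_iff, Submodule.Quotient.subsingleton_iff]

lemma mk_eq_algebraMap {u : R} {a : K} {E : Ideal R} (hE : u - algebraMap K R a ∈ E) :
    Ideal.Quotient.mkₐ K E u = algebraMap K (R ⧸ E) a := by
  rw [← sub_eq_zero, ← AlgHom.commutes (Ideal.Quotient.mkₐ K E), ← map_sub]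
  exact Ideal.Quotient.eq_zero_iff_mem.2 hE

lemma adjoin_mk_eq_top {u v : R} (hgen : Algebra.adjoin K {u, v} = ⊤) (a : K) {E : Ideal R}
    (hE : u - algebraMap K R a ∈ E) : Algebra.adjoin K {Ideal.Quotient.mkₐ K E v} = ⊤ := by
  have h1 : (⊤ : Subalgebra K (R ⧸ E)) = (⊤ : Subalgebra K R).map (Ideal.Quotient.mkₐ K E) := by
    rw [Algebra.map_top, eq_comm, AlgHom.range_eq_top]
    exact Ideal.Quotient.mkₐ_surjective K E
  rw [h1, ← hgen, AlgHom.map_adjoin, Set.image_pair, mk_eq_algebraMap hE]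
  refine le_antisymm (Algebra.adjoin_mono (by simp)) (Algebra.adjoin_le ?_)
  rintro x (rfl | rfl)
  · exact Subalgebra.algebraMap_mem _ _
  · exact Algebra.subset_adjoin rfl

/-- Modulo an ideal that contains `u - a`, a strip is the span of the first powers of `v`. -/
lemma finrank_quotient_sup_strip_of_mem {u v : R} (hgen : Algebra.adjoin K {u, v} = ⊤) (a : K)
    {E : Ideal R} [Module.Finite K (R ⧸ E)] (hE : u - algebraMap K R a ∈ E) (N : ℕ) :
    Module.finrank K (R ⧸ (E.restrictScalars K ⊔ strip K u v N)) =
      Module.finrank K (R ⧸ E) - N := by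
  have hu := mk_eq_algebraMap hE
  have hadj := adjoin_mk_eq_top hgen a hE
  have hker : LinearMap.ker (Ideal.Quotient.mkₐ K E).toLinearMap = E.restrictScalars K := by
    ext x
    exact Ideal.Quotient.eq_zero_iff_mem
  have hmap : (strip K u v N).map (Ideal.Quotient.mkₐ K E).toLinearMap =
      Submodule.span K (Set.range fun j : Fin N => (Ideal.Quotient.mkₐ K E v) ^ (j : ℕ)) := by
    apply le_antisymm
    · rintro _ ⟨x, hx, rfl⟩
      obtain ⟨p, rfl⟩ := mem_strip.1 hx
      rw [map_sum]
      refine Submodule.sum_mem _ fun j _ => ?_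
      rw [AlgHom.toLinearMap_apply, map_mul, map_pow, ← Polynomial.aeval_algHom_apply, hu,
        Polynomial.aeval_algebraMap_apply, ← Algebra.smul_def]
      exact Submodule.smul_mem _ _ (Submodule.subset_span ⟨j, rfl⟩)
    · rw [Submodule.span_le]
      rintro _ ⟨j, rfl⟩
      refine ⟨v ^ (j : ℕ), ?_, ?_⟩
      · simpa using aeval_mul_pow_mem_strip (K := K) u v 1 j.2
      · exact map_pow (Ideal.Quotient.mkₐ K E) v j
  have h := finrank_quotient_ker_sup (Ideal.Quotient.mkₐ K E).toLinearMap
    (Ideal.Quotient.mkₐ_surjective K E) (strip K u v N)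
  rw [hmap, finrank_span_pow hadj N] at h
  rw [finrank_quotient_congr (congrArg (· ⊔ strip K u v N) hker.symm), h]
  omega

/-- The dimensions of the quotients by `w` of the residual ideals `I`, `(I : w)`, `(I : w²)`, … -/
def residualLength (K : Type*) [Field K] [Algebra K R] (w : R) : ℕ → Ideal R → ℕ
  | 0, I => Module.finrank K (R ⧸ (I ⊔ Ideal.span {w}))
  | j + 1, I => residualLength K w j (I.colon {w})

lemma le_colon_singleton (I : Ideal R) (w : R) : I ≤ I.colon {w} := fun x hx => by
  rw [Submodule.mem_colon_singleton]
  exact I.mul_mem_right w hx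

lemma residualLength_le (w : R) (j : ℕ) (I : Ideal R) [Module.Finite K (R ⧸ I)] :
    residualLength K w j I ≤ Module.finrank K (R ⧸ (I ⊔ Ideal.span {w})) := by
  induction j generalizing I with
  | zero => exact le_rfl
  | succ j ih =>
    have := finite_quotient_ideal (K := K) (le_colon_singleton I w)
    refine (ih (I.colon {w})).trans ?_
    have := finite_quotient_ideal (K := K) (le_sup_left : I ≤ I ⊔ Ideal.span {w})
    exact LinearMap.finrank_le_finrank_of_surjective (f := (Ideal.Quotient.factorₐ K
      (sup_le_sup_right (le_colon_singleton I w) (Ideal.span {w}))).toLinearMap)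
      (Ideal.Quotient.factor_surjective
        (sup_le_sup_right (le_colon_singleton I w) (Ideal.span {w})))

lemma finite_quotient_sup_strip (I : Ideal R) [h : Module.Finite K (R ⧸ I)] (S : Submodule K R) :
    Module.Finite K (R ⧸ (I.restrictScalars K ⊔ S)) :=
  have : Module.Finite K (R ⧸ I.restrictScalars K) := h
  finite_quotient_of_le (le_sup_left : I.restrictScalars K ≤ _)

/-- One step of the filtration by powers of `u - a`. If the first `N` powers of `v` are independent
modulo `(I, u - a)`, then multiplication by `u - a` identifies the quotient that belongs to
`(I : u - a)` with a subspace; otherwise both quotients by strips are zero. -/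
lemma finrank_quotient_sup_strip_step {u v : R} (hgen : Algebra.adjoin K {u, v} = ⊤) (a : K)
    {I : Ideal R} [Module.Finite K (R ⧸ I)] {k : ℕ} (hk : (u - algebraMap K R a) ^ (k + 1) ∈ I)
    (N : ℕ) :
    Module.finrank K (R ⧸ (I.restrictScalars K ⊔ strip K u v N)) =
      (Module.finrank K (R ⧸ (I ⊔ Ideal.span {u - algebraMap K R a})) - N) +
        Module.finrank K (R ⧸ ((I.colon {u - algebraMap K R a}).restrictScalars K ⊔
          strip K u v N)) := by
  set w := u - algebraMap K R a with hw
  have := finite_quotient_sup_strip (K := K) I (strip K u v N)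
  have := finite_quotient_ideal (K := K) (le_sup_left : I ≤ I ⊔ Ideal.span {w})
  have := finite_quotient_ideal (K := K) (le_colon_singleton I w)
  have := finite_quotient_sup_strip (K := K) (I.colon {w}) (strip K u v N)
  have hwE : w ∈ I ⊔ Ideal.span {w} := Ideal.mem_sup_right (Ideal.mem_span_singleton_self w)
  have hwp : ∀ p : K[X], aeval u ((X - C a) * p) = w * aeval u p := fun p => by simp [hw]
  have hE := finrank_quotient_sup_strip_of_mem hgen a hwE N
  have hsup : (I.restrictScalars K ⊔ strip K u v N) ⊔ LinearMap.range (LinearMap.mulLeft K w) =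
      (I ⊔ Ideal.span {w}).restrictScalars K ⊔ strip K u v N := by
    have : (I ⊔ Ideal.span {w}).restrictScalars K =
        I.restrictScalars K ⊔ LinearMap.range (LinearMap.mulLeft K w) := by
      ext x
      simp [Submodule.mem_sup, Ideal.mem_span_singleton', mul_comm w]
    rw [this, sup_right_comm]
  have hcomap_le : (I.colon {w}).restrictScalars K ⊔ strip K u v N ≤
      (I.restrictScalars K ⊔ strip K u v N).comap (LinearMap.mulLeft K w) := by
    refine sup_le (fun x hx => ?_) (fun x hx => ?_)
    · rw [Submodule.restrictScalars_mem, Submodule.mem_colon_singleton, smul_eq_mul, mul_comm] at hx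
      exact Submodule.mem_sup_left hx
    · refine Submodule.mem_sup_right ?_
      have := aeval_mul_mem_strip (X - C a) hx
      rwa [show aeval u (X - C a) = w by simp [hw]] at this
  rcases le_total N (Module.finrank K (R ⧸ (I ⊔ Ideal.span {w}))) with h | h
  · rw [finrank_quotient_eq_add _ (LinearMap.mulLeft K w), hsup, hE]
    have heq : (I.restrictScalars K ⊔ strip K u v N).comap (LinearMap.mulLeft K w) =
        (I.colon {w}).restrictScalars K ⊔ strip K u v N := by
      refine le_antisymm (fun x hx => ?_) hcomap_le
      obtain ⟨i, hi, s, hs, hx⟩ := Submodule.mem_sup.1 hx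
      obtain ⟨p, rfl⟩ := mem_strip.1 hs
      -- `∑ p_j(u) vʲ ≡ ∑ p_j(a) vʲ` vanishes modulo `(I, w)`, where the powers of `v` are
      -- independent
      have hli : ∀ j, (p j).eval a = 0 := by
        set E := I ⊔ Ideal.span {w}
        have hsum : ∑ j, (p j).eval a • v ^ (j : ℕ) ∈ E := by
          have h1 : ∀ q : K[X], aeval u q - algebraMap K R (q.eval a) ∈ E := fun q => by
            obtain ⟨r, hr⟩ := X_sub_C_dvd_sub_C_eval (a := a) (p := q)
            have : aeval u q - algebraMap K R (q.eval a) = w * aeval u r := by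
              rw [← hwp, ← hr]; simp
            rw [this]
            exact E.mul_mem_right _ hwE
          have h2 : ∑ j, aeval u (p j) * v ^ (j : ℕ) ∈ E := by
            have : ∑ j, aeval u (p j) * v ^ (j : ℕ) = w * x - i := by
              rw [eq_sub_iff_add_eq, add_comm]; exact hx
            rw [this]
            exact E.sub_mem (E.mul_mem_right _ hwE) (Ideal.mem_sup_left hi)
          have h3 : ∑ j, (aeval u (p j) - algebraMap K R ((p j).eval a)) * v ^ (j : ℕ) ∈ E :=
            E.sum_mem fun j _ => E.mul_mem_right _ (h1 _)
          have := E.sub_mem h2 h3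
          rw [← Finset.sum_sub_distrib] at this
          convert this using 2 with j
          rw [Algebra.smul_def]; ring
        have hadj := adjoin_mk_eq_top hgen a hwE
        have hlin : LinearIndependent K fun j : Fin N => (Ideal.Quotient.mkₐ K E v) ^ (j : ℕ) := by
          rw [linearIndependent_iff_card_eq_finrank_span, Set.finrank, finrank_span_pow hadj,
            Fintype.card_fin, min_eq_left h]
        refine Fintype.linearIndependent_iff.1 hlin _ ?_
        have h0 : (Ideal.Quotient.mkₐ K E) (∑ j, (p j).eval a • v ^ (j : ℕ)) = 0 :=
          Ideal.Quotient.eq_zero_iff_mem.2 hsum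
        simpa only [map_sum, map_smul, map_pow] using h0
      choose q hq using fun j => dvd_iff_isRoot.2 (hli j)
      have hs : ∑ j, aeval u (p j) * v ^ (j : ℕ) = w * ∑ j, aeval u (q j) * v ^ (j : ℕ) := by
        rw [Finset.mul_sum]
        exact Finset.sum_congr rfl fun j _ => by rw [hq j, hwp, mul_assoc]
      have hx' : x = (x - ∑ j, aeval u (q j) * v ^ (j : ℕ)) + ∑ j, aeval u (q j) * v ^ (j : ℕ) := by
        ring
      rw [hx']
      refine Submodule.add_mem_sup ?_ (mem_strip.2 ⟨q, rfl⟩)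
      rw [Submodule.restrictScalars_mem, Submodule.mem_colon_singleton, smul_eq_mul]
      have : (x - ∑ j, aeval u (q j) * v ^ (j : ℕ)) * w = i := by
        have hx2 : i + ∑ j, aeval u (p j) * v ^ (j : ℕ) = w * x := hx
        rw [hs] at hx2
        linear_combination -hx2
      rw [this]; exact hi
    rw [finrank_quotient_congr heq]
  · have htop1 : (I ⊔ Ideal.span {w}).restrictScalars K ⊔ strip K u v N = ⊤ := by
      have := finite_quotient_sup_strip (K := K) (I ⊔ Ideal.span {w}) (strip K u v N)
      rw [← finrank_quotient_eq_zero_iff, hE]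
      omega
    -- The strip and `(I, w)` span everything. As `w` preserves the strip, this can be iterated.
    have key : ∀ j : ℕ, ∀ x : R, ∃ y, x - w ^ j * y ∈ I.restrictScalars K ⊔ strip K u v N := by
      intro j
      induction j with
      | zero => exact fun x => ⟨x, by simp⟩
      | succ j ih =>
        intro x
        obtain ⟨y, hy⟩ := ih x
        obtain ⟨e, he, s, hs, hes⟩ := Submodule.mem_sup.1
          (htop1.symm ▸ Submodule.mem_top : y ∈ (I ⊔ Ideal.span {w}).restrictScalars K ⊔
            strip K u v N)
        obtain ⟨i, hi, z, hz, rfl⟩ := Submodule.mem_sup.1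
          ((Submodule.restrictScalars_mem K _ _).1 he)
        obtain ⟨z, rfl⟩ := Ideal.mem_span_singleton'.1 hz
        refine ⟨z, ?_⟩
        have hx : x - w ^ (j + 1) * z = (x - w ^ j * y) + (w ^ j * i + w ^ j * s) := by
          rw [← hes]; ring
        rw [hx]
        refine add_mem hy (Submodule.add_mem_sup (I.mul_mem_left _ hi) ?_)
        have := aeval_mul_mem_strip ((X - C a) ^ j) hs
        rwa [show aeval u ((X - C a) ^ j) = w ^ j by simp [hw]] at this
    have htop : I.restrictScalars K ⊔ strip K u v N = ⊤ := by
      rw [eq_top_iff]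
      intro x _
      obtain ⟨y, hy⟩ := key (k + 1) x
      rw [← sub_add_cancel x (w ^ (k + 1) * y)]
      exact add_mem hy (Submodule.mem_sup_left (I.mul_mem_right _ hk))
    have htop' : (I.colon {w}).restrictScalars K ⊔ strip K u v N = ⊤ := by
      rw [eq_top_iff, ← htop]
      exact sup_le_sup_right (show I.restrictScalars K ≤ (I.colon {w}).restrictScalars K from
        le_colon_singleton I w) _
    have z1 : Module.finrank K (R ⧸ (I.restrictScalars K ⊔ strip K u v N)) = 0 := by
      rw [finrank_quotient_eq_zero_iff, htop]
    have z2 : Module.finrank K (R ⧸ ((I.colon {w}).restrictScalars K ⊔ strip K u v N)) = 0 := by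
      rw [finrank_quotient_eq_zero_iff, htop']
    omega

/-- The codimension of a strip modulo an ideal that contains a power of `u - a`. -/
lemma finrank_quotient_sup_strip_of_pow_mem {u v : R} (hgen : Algebra.adjoin K {u, v} = ⊤) (a : K)
    {I : Ideal R} [Module.Finite K (R ⧸ I)] {k : ℕ} (hk : (u - algebraMap K R a) ^ k ∈ I)
    (N : ℕ) :
    Module.finrank K (R ⧸ (I.restrictScalars K ⊔ strip K u v N)) =
      ∑ j ∈ Finset.range k, (residualLength K (u - algebraMap K R a) j I - N) := by
  induction k generalizing I with
  | zero =>
    have : I.restrictScalars K ⊔ strip K u v N = ⊤ := by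
      rw [(Ideal.eq_top_iff_one I).2 (by simpa using hk), Submodule.restrictScalars_top, top_sup_eq]
    have := finite_quotient_sup_strip (K := K) I (strip K u v N)
    rwa [Finset.sum_range_zero, finrank_quotient_eq_zero_iff]
  | succ k ih =>
    have := finite_quotient_ideal (K := K) (le_colon_singleton I (u - algebraMap K R a))
    rw [finrank_quotient_sup_strip_step hgen a hk N, Finset.sum_range_succ', ih, add_comm]
    · rfl
    · rw [Submodule.mem_colon_singleton, smul_eq_mul, ← pow_succ]
      exact hk

/-- A finite-dimensional space with an endomorphism annihilated by `∏ (X - a)^(e a)` has the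
dimension of the sum of its quotients by the images of the factors. -/
lemma finrank_eq_sum_finrank_range {M : Type*} [AddCommGroup M] [Module K M] [Module.Finite K M]
    (f : M →ₗ[K] M) (S : Finset K) (e : K → ℕ)
    (h : aeval f (∏ a ∈ S, (X - C a) ^ e a) = 0) :
    Module.finrank K M =
      ∑ a ∈ S, Module.finrank K (M ⧸ LinearMap.range ((f - algebraMap K (Module.End K M) a) ^ e a)) := by
  classical
  have key : ∀ T : Finset K, Module.finrank K (LinearMap.ker (aeval f (∏ a ∈ T, (X - C a) ^ e a))) =
      ∑ a ∈ T, Module.finrank K (LinearMap.ker ((f - algebraMap K (Module.End K M) a) ^ e a)) := by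
    intro T
    induction T using Finset.induction_on with
    | empty =>
      rw [Finset.prod_empty, Finset.sum_empty, map_one]
      exact (congrArg (fun S : Submodule K M => Module.finrank K S) LinearMap.ker_id).trans
        (finrank_bot K M)
    | insert a T ha ih =>
      rw [Finset.prod_insert ha, Finset.sum_insert ha, ← ih]
      have hc : IsCoprime ((X - C a) ^ e a) (∏ b ∈ T, (X - C b) ^ e b) := by
        refine IsCoprime.prod_right fun b hb => IsCoprime.pow (isCoprime_X_sub_C_of_isUnit_sub ?_)
        rw [isUnit_iff_ne_zero, sub_ne_zero]
        rintro rfl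
        exact ha hb
      rw [← sup_ker_aeval_eq_ker_aeval_mul_of_coprime f hc]
      have hd := disjoint_ker_aeval_of_isCoprime f hc
      have := Submodule.finrank_sup_add_finrank_inf_eq (LinearMap.ker (aeval f ((X - C a) ^ e a)))
        (LinearMap.ker (aeval f (∏ b ∈ T, (X - C b) ^ e b)))
      rw [hd.eq_bot, finrank_bot, add_zero] at this
      rw [this, map_pow, map_sub, aeval_X, aeval_C]
  have h1 := key S
  rw [h, LinearMap.ker_zero, finrank_top] at h1
  rw [h1]
  refine Finset.sum_congr rfl fun a _ => ?_
  have h2 := Submodule.finrank_quotient_add_finrank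
    (LinearMap.range ((f - algebraMap K (Module.End K M) a) ^ e a))
  have h3 := LinearMap.finrank_range_add_finrank_ker ((f - algebraMap K (Module.End K M) a) ^ e a)
  omega

/-- The codimension of a strip modulo an ideal that contains a polynomial in `u`. The strip is
stable under multiplication by `u`, so that the quotient splits according to the roots of the
polynomial. -/
theorem finrank_quotient_sup_strip {u v : R} (hgen : Algebra.adjoin K {u, v} = ⊤)
    {I : Ideal R} [Module.Finite K (R ⧸ I)] (S : Finset K) (e : K → ℕ)
    (h : aeval u (∏ a ∈ S, (X - C a) ^ e a) ∈ I) (N : ℕ) :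
    Module.finrank K (R ⧸ (I.restrictScalars K ⊔ strip K u v N)) =
      ∑ a ∈ S, ∑ j ∈ Finset.range (e a), (residualLength K (u - algebraMap K R a) j
        (I ⊔ Ideal.span {(u - algebraMap K R a) ^ e a}) - N) := by
  set A := I.restrictScalars K ⊔ strip K u v N with hA
  have : Module.Finite K (R ⧸ A) := finite_quotient_sup_strip (K := K) I (strip K u v N)
  have hAu : ∀ p : K[X], A ≤ A.comap (LinearMap.mulLeft K (aeval u p)) := fun p =>
    sup_le (fun x hx => Submodule.mem_sup_left (I.mul_mem_left _ hx))
      (fun x hx => Submodule.mem_sup_right (aeval_mul_mem_strip p hx))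
  let f : (R ⧸ A) →ₗ[K] (R ⧸ A) := Submodule.mapQ A A (LinearMap.mulLeft K u)
    (by simpa using hAu X)
  have hf : ∀ (p : K[X]) (x : R), aeval f p (A.mkQ x) = A.mkQ (aeval u p * x) := by
    intro p x
    induction p using Polynomial.induction_on' with
    | add p q hp hq => simp only [map_add, LinearMap.add_apply, hp, hq, add_mul]
    | monomial n c =>
      have hpow : ∀ n : ℕ, (f ^ n) (A.mkQ x) = A.mkQ (u ^ n * x) := fun n => by
        induction n with
        | zero => simp
        | succ n ih =>
          rw [pow_succ', Module.End.mul_apply, ih, pow_succ', mul_assoc]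
          rfl
      rw [aeval_monomial, aeval_monomial, Module.End.mul_apply, hpow, Module.algebraMap_end_apply,
        mul_assoc, ← Algebra.smul_def, map_smul]
  rw [finrank_eq_sum_finrank_range f S e]
  · refine Finset.sum_congr rfl fun a _ => ?_
    set J := I ⊔ Ideal.span {(u - algebraMap K R a) ^ e a} with hJ
    have : Module.Finite K (R ⧸ J) := finite_quotient_ideal (K := K) (le_sup_left : I ≤ J)
    rw [← finrank_quotient_sup_strip_of_pow_mem hgen a (k := e a)
      (Ideal.mem_sup_right (Ideal.mem_span_singleton_self _)) N]
    have hr : LinearMap.range ((f - algebraMap K (Module.End K (R ⧸ A)) a) ^ e a) =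
        (LinearMap.range (LinearMap.mulLeft K ((u - algebraMap K R a) ^ e a))).map A.mkQ := by
      have h1 : (f - algebraMap K (Module.End K (R ⧸ A)) a) ^ e a = aeval f ((X - C a) ^ e a) := by
        simp
      ext y
      constructor
      · rintro ⟨x, rfl⟩
        obtain ⟨x, rfl⟩ := A.mkQ_surjective x
        exact ⟨_, ⟨x, rfl⟩, by rw [h1, hf]; simp⟩
      · rintro ⟨_, ⟨x, rfl⟩, rfl⟩
        exact ⟨A.mkQ x, by rw [h1, hf]; simp⟩
    rw [finrank_quotient_congr hr, (Submodule.quotientQuotientEquivQuotientSup A _).finrank_eq]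
    apply finrank_quotient_congr
    have : J.restrictScalars K = I.restrictScalars K ⊔
        LinearMap.range (LinearMap.mulLeft K ((u - algebraMap K R a) ^ e a)) := by
      ext x
      simp [hJ, Submodule.mem_sup, Ideal.mem_span_singleton', mul_comm]
    rw [this, hA, sup_right_comm]
  · refine LinearMap.ext fun x => ?_
    obtain ⟨x, rfl⟩ := A.mkQ_surjective x
    rw [hf, LinearMap.zero_apply]
    exact (Submodule.Quotient.mk_eq_zero A).2 (Submodule.mem_sup_left (I.mul_mem_right x h))

end Strip

/-! ### Functions vanishing on a scheme over the quadric -/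

instance isSeparated_lineToSpec : IsSeparated lineToSpec := by
  have h₁ : IsSeparated (Proj.toSpecZero grading) := inferInstance
  have h₂ : IsSeparated (Spec.map (CommRingCat.ofHom (algebraMap ℂ (grading 0)))) := inferInstance
  exact MorphismProperty.comp_mem @IsSeparated _ _ h₁ h₂

instance isSeparated_pr₁ : IsSeparated pr₁ :=
  inferInstanceAs (IsSeparated (pullback.fst lineToSpec lineToSpec))

instance isSeparated_toSpec : IsSeparated toSpec :=
  inferInstanceAs (IsSeparated (pr₁ ≫ lineToSpec))

instance isSeparated_surface : surface.IsSeparated :=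
  ⟨by rw [← terminal.comp_from toSpec]; infer_instance⟩

/-- The functions on `V` that are killed by pullback along `g`. -/
def kerApp {Y : Scheme.{0}} (g : Y ⟶ surface) (V : surface.Opens) : Ideal Γ(surface, V) :=
  RingHom.ker (g.app V).hom

lemma mem_kerApp {Y : Scheme.{0}} {g : Y ⟶ surface} {V : surface.Opens} {f : Γ(surface, V)} :
    f ∈ kerApp g V ↔ (g.app V).hom f = 0 := Iff.rfl

lemma app_res {Y : Scheme.{0}} (g : Y ⟶ surface) {V W : surface.Opens} (h : W ≤ V)
    (f : Γ(surface, V)) : (g.app W).hom (res h f) =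
      (Y.presheaf.map (homOfLE (g.preimage_mono h)).op).hom ((g.app V).hom f) :=
  congrArg (fun φ => φ.hom f) (g.naturality (homOfLE h).op)

lemma res_mem_kerApp {Y : Scheme.{0}} {g : Y ⟶ surface} {V W : surface.Opens} (h : W ≤ V)
    {f : Γ(surface, V)} (hf : f ∈ kerApp g V) : res h f ∈ kerApp g W := by
  rw [mem_kerApp] at hf ⊢
  rw [app_res, hf, map_zero]

lemma mem_kerApp_iff_of_cover {Y : Scheme.{0}} {g : Y ⟶ surface} {V : surface.Opens} {ι : Type*}
    (W : ι → surface.Opens) (hW : ∀ i, W i ≤ V) (hc : ∀ y, g y ∈ V → ∃ i, g y ∈ W i)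
    {f : Γ(surface, V)} : f ∈ kerApp g V ↔ ∀ i, res (hW i) f ∈ kerApp g (W i) := by
  refine ⟨fun hf i => res_mem_kerApp (hW i) hf, fun hf => ?_⟩
  rw [mem_kerApp]
  refine Y.sheaf.eq_of_locally_eq' (fun i => g ⁻¹ᵁ W i) (g ⁻¹ᵁ V)
    (fun i => homOfLE (g.preimage_mono (hW i))) (fun y hy => ?_) _ _ fun i => ?_
  · obtain ⟨i, hi⟩ := hc y hy
    exact Opens.mem_iSup.2 ⟨i, hi⟩
  · have := hf i
    rw [mem_kerApp, app_res] at this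
    exact this.trans (map_zero _).symm

lemma mem_kerApp_iff {Y : Scheme.{0}} {g : Y ⟶ surface} {V W : surface.Opens} (h : W ≤ V)
    (hc : ∀ y, g y ∈ V → g y ∈ W) {f : Γ(surface, V)} :
    f ∈ kerApp g V ↔ res h f ∈ kerApp g W := by
  rw [mem_kerApp_iff_of_cover (fun _ : Unit => W) (fun _ => h) (fun y hy => ⟨(), hc y hy⟩)]
  simp

lemma ker_appLE_top {Y : Scheme.{0}} (g : Y ⟶ surface) (V : surface.Opens)
    (h : ⊤ ≤ g ⁻¹ᵁ V) : RingHom.ker (g.appLE V ⊤ h).hom = kerApp g V := by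
  ext f
  have : IsIso (homOfLE h) := isIso_homOfLE (top_unique h).symm
  have hinj := (ConcreteCategory.bijective_of_isIso (Y.presheaf.map (homOfLE h).op)).1
  exact map_eq_zero_iff (Y.presheaf.map (homOfLE h).op).hom hinj

lemma appLE_top_surjective {Y : Scheme.{0}} (g : Y ⟶ surface) (V : surface.Opens)
    (h : ⊤ ≤ g ⁻¹ᵁ V) (hg : Function.Surjective (g.app V)) :
    Function.Surjective (g.appLE V ⊤ h).hom := by
  have : IsIso (homOfLE h) := isIso_homOfLE (top_unique h).symm
  exact (ConcreteCategory.bijective_of_isIso (Y.presheaf.map (homOfLE h).op)).2.comp hg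

lemma ker_ideal {Y : Scheme.{0}} (g : Y ⟶ surface) [QuasiCompact g] (V : surface.affineOpens) :
    Scheme.IdealSheafData.ideal g.ker V = kerApp g V.1 := g.ker_apply V

lemma map_res_ideal (Z : surface.IdealSheafData) {V W : surface.affineOpens} (h : W.1 ≤ V.1) :
    (Z.ideal V).map (res h).toRingHom = Z.ideal W := Z.map_ideal h

/-- The functions on `V` that vanish on the closed subscheme `Z`. -/
def van (Z : surface.IdealSheafData) (V : surface.Opens) : Ideal Γ(surface, V) :=
  kerApp Z.subschemeι V

lemma van_eq (Z : surface.IdealSheafData) (V : surface.affineOpens) : van Z V.1 = Z.ideal V :=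
  Z.ker_subschemeι_app V

lemma subschemeι_mem_support (Z : surface.IdealSheafData) (y : Z.subscheme) :
    Z.subschemeι y ∈ Z.support := by
  have : Z.subschemeι y ∈ Set.range Z.subschemeι := ⟨y, rfl⟩
  rwa [Z.range_subschemeι] at this

lemma res_mem_van {Z : surface.IdealSheafData} {V W : surface.Opens} (h : W ≤ V)
    {f : Γ(surface, V)} (hf : f ∈ van Z V) : res h f ∈ van Z W := res_mem_kerApp h hf

lemma mem_van_iff_of_cover {Z : surface.IdealSheafData} {V : surface.Opens} {ι : Type*}
    (W : ι → surface.Opens) (hW : ∀ i, W i ≤ V) (hc : ∀ y ∈ Z.support, y ∈ V → ∃ i, y ∈ W i)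
    {f : Γ(surface, V)} : f ∈ van Z V ↔ ∀ i, res (hW i) f ∈ van Z (W i) :=
  mem_kerApp_iff_of_cover W hW fun y hy => hc _ (subschemeι_mem_support Z y) hy

lemma mem_van_iff {Z : surface.IdealSheafData} {V W : surface.Opens} (h : W ≤ V)
    (hc : ∀ y ∈ Z.support, y ∈ V → y ∈ W) {f : Γ(surface, V)} :
    f ∈ van Z V ↔ res h f ∈ van Z W :=
  mem_kerApp_iff h fun y hy => hc _ (subschemeι_mem_support Z y) hy

/-- A function on the part of `V` that contains `Z ∩ V` agrees on `Z` with a function on `V`, if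
`V` is affine. -/
lemma exists_res_sub_mem_van {Z : surface.IdealSheafData} {V W : surface.Opens}
    (hV : IsAffineOpen V) (h : W ≤ V) (hc : ∀ y ∈ Z.support, y ∈ V → y ∈ W) (f : Γ(surface, W)) :
    ∃ s : Γ(surface, V), res h s - f ∈ van Z W := by
  have hle : Z.subschemeι ⁻¹ᵁ V ≤ Z.subschemeι ⁻¹ᵁ W := fun y hy =>
    hc _ (subschemeι_mem_support Z y) hy
  obtain ⟨s, hs⟩ := Z.subschemeι_app_surjective ⟨V, hV⟩
    ((Z.subscheme.presheaf.map (homOfLE hle).op).hom ((Z.subschemeι.app W).hom f))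
  refine ⟨s, ?_⟩
  rw [van, mem_kerApp, map_sub, sub_eq_zero, app_res]
  refine (congrArg _ hs).trans ?_
  rw [← CommRingCat.comp_apply, ← Functor.map_comp, ← op_comp,
    Subsingleton.elim (homOfLE _ ≫ homOfLE hle) (𝟙 _), op_id, CategoryTheory.Functor.map_id]
  rfl

/-- Functions on the parts of a covering of an affine open set that agree on `Z` can be glued to a
function on that set, up to functions that vanish on `Z`. -/
lemma exists_glue {Z : surface.IdealSheafData} {U : surface.Opens} (hU : IsAffineOpen U)
    {ι : Type} (W : ι → surface.Opens) (hW : ∀ i, W i ≤ U) (hc : ∀ y ∈ U, ∃ i, y ∈ W i)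
    (f : ∀ i, Γ(surface, W i))
    (hf : ∀ i j, res (inf_le_left : W i ⊓ W j ≤ W i) (f i) - res inf_le_right (f j) ∈
      van Z (W i ⊓ W j)) :
    ∃ s : Γ(surface, U), ∀ i, res (hW i) s - f i ∈ van Z (W i) := by
  obtain ⟨t, ht, -⟩ := Z.subscheme.sheaf.existsUnique_gluing' (fun i => Z.subschemeι ⁻¹ᵁ W i)
    (Z.subschemeι ⁻¹ᵁ U) (fun i => homOfLE (Z.subschemeι.preimage_mono (hW i)))
    (fun y hy => by
      obtain ⟨i, hi⟩ := hc _ hy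
      exact Opens.mem_iSup.2 ⟨i, hi⟩)
    (fun i => (Z.subschemeι.app (W i)).hom (f i)) (fun i j => by
      have := hf i j
      rw [van, mem_kerApp, map_sub, sub_eq_zero, app_res, app_res] at this
      exact this)
  obtain ⟨s, hs⟩ := Z.subschemeι_app_surjective ⟨U, hU⟩ t
  refine ⟨s, fun i => ?_⟩
  rw [van, mem_kerApp, map_sub, sub_eq_zero, app_res]
  exact (congrArg _ hs).trans (ht i)

/-! ### Closed subschemes supported in an affine open set -/

lemma le_iff_ideal_le {A Z : surface.IdealSheafData} {U : surface.affineOpens}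
    (hZ : (Z.support : Set surface) ⊆ U.1) : A ≤ Z ↔ A.ideal U ≤ Z.ideal U := by
  refine ⟨fun h => h U, fun h W => ?_⟩
  have hWU : IsAffineOpen (W.1 ⊓ U.1) := W.2.inf U.2
  intro f hf
  rw [← van_eq, mem_van_iff (inf_le_left : W.1 ⊓ U.1 ≤ W.1) (fun y hy hyW => ⟨hyW, hZ hy⟩),
    van_eq Z ⟨_, hWU⟩, ← map_res_ideal Z (inf_le_right : W.1 ⊓ U.1 ≤ U.1)]
  refine Ideal.map_mono h ?_
  rw [map_res_ideal A (V := U) (W := ⟨_, hWU⟩) inf_le_right,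
    ← map_res_ideal A (V := W) (W := ⟨_, hWU⟩) inf_le_left]
  exact Ideal.mem_map_of_mem _ hf

lemma support_subset_of_le {A Z : surface.IdealSheafData} (h : Z ≤ A) {U : Set surface}
    (hZ : (Z.support : Set surface) ⊆ U) : (A.support : Set surface) ⊆ U :=
  fun _ hy => hZ (Scheme.IdealSheafData.support_antitone h hy)

/-- The closure of the closed subscheme of the affine open set `U` defined by the ideal `I`. -/
def closureOf (U : surface.affineOpens) (I : Ideal Γ(surface, U.1)) : surface.IdealSheafData :=
  Scheme.Hom.ker (Spec.map (CommRingCat.ofHom (Ideal.Quotient.mk I)) ≫ U.2.fromSpec)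

lemma closureOf_ideal (U W : surface.affineOpens) (I : Ideal Γ(surface, U.1)) :
    (closureOf U I).ideal W =
      kerApp (Spec.map (CommRingCat.ofHom (Ideal.Quotient.mk I)) ≫ U.2.fromSpec) W.1 :=
  ker_ideal _ W

lemma closureOf_ideal_self (U : surface.affineOpens) (I : Ideal Γ(surface, U.1)) :
    (closureOf U I).ideal U = I := by
  have h₁ : ⊤ ≤ U.2.fromSpec ⁻¹ᵁ U.1 := U.2.fromSpec_preimage_self.ge
  have h₂ : U.2.fromSpec.appLE U.1 ⊤ h₁ = (Scheme.ΓSpecIso Γ(surface, U.1)).inv := by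
    rw [Scheme.Hom.appLE, U.2.fromSpec_app_self, Category.assoc, ← Functor.map_comp, ← op_comp,
      Subsingleton.elim (homOfLE _ ≫ eqToHom _) (𝟙 _), op_id,
      CategoryTheory.Functor.map_id, Category.comp_id]
  set φ := CommRingCat.ofHom (Ideal.Quotient.mk I) with hφ
  have h₀ : ⊤ ≤ (Spec.map φ ≫ U.2.fromSpec) ⁻¹ᵁ U.1 := fun y _ => h₁ (Set.mem_univ (Spec.map φ y))
  have h₃ : (Spec.map φ ≫ U.2.fromSpec).appLE U.1 ⊤ h₀ =
      φ ≫ (Scheme.ΓSpecIso (CommRingCat.of (Γ(surface, U.1) ⧸ I))).inv := by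
    refine Eq.trans ?_ ((congrArg (· ≫ (Spec.map φ).appTop) h₂).trans
      (Scheme.ΓSpecIso_inv_naturality φ).symm)
    refine (Scheme.Hom.appLE_comp_appLE (Spec.map φ) U.2.fromSpec U.1 ⊤ ⊤ h₁ le_top).symm.trans ?_
    congr 1
  rw [closureOf_ideal, ← ker_appLE_top _ _ h₀, h₃]
  ext f
  have hinj := (ConcreteCategory.bijective_of_isIso
    (Scheme.ΓSpecIso (CommRingCat.of (Γ(surface, U.1) ⧸ I))).inv).1
  exact (map_eq_zero_iff _ hinj).trans Ideal.Quotient.eq_zero_iff_mem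

lemma mem_closureOf_ideal_iff {U W : surface.affineOpens} {I : Ideal Γ(surface, U.1)}
    {f : Γ(surface, W.1)} (W' : surface.affineOpens) (hW' : W'.1 = W.1 ⊓ U.1) :
    f ∈ (closureOf U I).ideal W ↔
      res (hW'.le.trans inf_le_left : W'.1 ≤ W.1) f ∈
        I.map (res (hW'.le.trans inf_le_right : W'.1 ≤ U.1)).toRingHom := by
  rw [closureOf_ideal, mem_kerApp_iff (hW'.le.trans inf_le_left), ← closureOf_ideal,
    ← closureOf_ideal_self U I, map_res_ideal, closureOf_ideal_self]
  intro y hy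
  rw [hW']
  refine ⟨hy, ?_⟩
  have : (Spec.map (CommRingCat.ofHom (Ideal.Quotient.mk I)) ≫ U.2.fromSpec) y ∈
      Set.range U.2.fromSpec := ⟨_, rfl⟩
  rw [U.2.range_fromSpec] at this
  exact this

lemma residual_ideal {Z : surface.IdealSheafData} (D : surface.IdealSheafData)
    {U : surface.affineOpens} (hZ : (Z.support : Set surface) ⊆ U.1) :
    (residual Z D).ideal U = (Z.ideal U).colon (D.ideal U : Set Γ(surface, U.1)) := by
  apply le_antisymm
  · rw [residual, Scheme.IdealSheafData.ideal_sSup, sSup_apply, iSup_le_iff]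
    rintro ⟨_, J, hJ, rfl⟩ f hf
    rw [Submodule.mem_colon]
    exact fun s hs => hJ U (Ideal.mul_mem_mul hf hs)
  · have h : closureOf U ((Z.ideal U).colon (D.ideal U : Set Γ(surface, U.1))) ≤ residual Z D := by
      refine le_sSup ?_
      rw [Set.mem_ofPred_eq, le_iff_ideal_le hZ]
      change (closureOf U _).ideal U * D.ideal U ≤ _
      rw [closureOf_ideal_self, Ideal.mul_le]
      exact fun r hr s hs => Submodule.mem_colon.1 hr s hs
    have := h U
    rwa [closureOf_ideal_self] at this

lemma le_residual (Z D : surface.IdealSheafData) : Z ≤ residual Z D :=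
  le_sSup (show Z * D ≤ Z from fun U => show Z.ideal U * D.ideal U ≤ Z.ideal U from
    Ideal.mul_le_left)

/-- Functions on `U` restricted to the scheme `Z`, which is contained in `U`. -/
def toSections (Z : surface.IdealSheafData) {U : surface.affineOpens}
    (hZ : (Z.support : Set surface) ⊆ U.1) : Γ(surface, U.1) →+* Γ(Z.subscheme, ⊤) :=
  (Z.subschemeι.appLE U.1 ⊤ fun y _ => hZ (subschemeι_mem_support Z y)).hom

lemma ker_toSections (Z : surface.IdealSheafData) {U : surface.affineOpens}
    (hZ : (Z.support : Set surface) ⊆ U.1) : RingHom.ker (toSections Z hZ) = Z.ideal U :=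
  (ker_appLE_top _ _ _).trans (van_eq Z U)

lemma toSections_surjective (Z : surface.IdealSheafData) {U : surface.affineOpens}
    (hZ : (Z.support : Set surface) ⊆ U.1) : Function.Surjective (toSections Z hZ) :=
  appLE_top_surjective _ _ _ (Z.subschemeι_app_surjective U)

lemma toSections_algebraMap (Z : surface.IdealSheafData) {U : surface.affineOpens}
    (hZ : (Z.support : Set surface) ⊆ U.1) (r : ℂ) :
    toSections Z hZ (algebraMap ℂ _ r) = scalars (Z.subschemeι ≫ toSpec) ⊤ r :=
  appLE_scalars Z.subschemeι toSpec _ r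

/-- The ring of functions of `Z ⊆ U` is the quotient by the ideal of `Z`. -/
lemma length_eq (Z : surface.IdealSheafData) {U : surface.affineOpens}
    (hZ : (Z.support : Set surface) ⊆ U.1) :
    length Z = Module.finrank ℂ (Γ(surface, U.1) ⧸ Z.ideal U) := by
  let : Algebra ℂ Γ(Z.subscheme, ⊤) := (scalars (Z.subschemeι ≫ toSpec) ⊤).toAlgebra
  let φ : Γ(surface, U.1) →ₐ[ℂ] Γ(Z.subscheme, ⊤) :=
    { toSections Z hZ with commutes' := toSections_algebraMap Z hZ }
  have hφ : Function.Surjective φ := toSections_surjective Z hZ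
  have e := Ideal.quotientKerAlgEquivOfSurjective hφ
  have hk : RingHom.ker φ = Z.ideal U := ker_toSections Z hZ
  rw [← hk]
  exact e.toLinearEquiv.finrank_eq.symm

lemma finite_quotient {Z : surface.IdealSheafData} (hfin : IsFiniteSubscheme Z)
    {U : surface.affineOpens} (hZ : (Z.support : Set surface) ⊆ U.1) :
    Module.Finite ℂ (Γ(surface, U.1) ⧸ Z.ideal U) := by
  let : Algebra ℂ Γ(Z.subscheme, ⊤) := (scalars (Z.subschemeι ≫ toSpec) ⊤).toAlgebra
  let φ : Γ(surface, U.1) →ₐ[ℂ] Γ(Z.subscheme, ⊤) :=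
    { toSections Z hZ with commutes' := toSections_algebraMap Z hZ }
  have hφ : Function.Surjective φ := toSections_surjective Z hZ
  have e := Ideal.quotientKerAlgEquivOfSurjective hφ
  have hk : RingHom.ker φ = Z.ideal U := ker_toSections Z hZ
  have hf : Module.Finite ℂ Γ(Z.subscheme, ⊤) := by
    have : IsFinite (Z.subschemeι ≫ toSpec) := hfin
    have h1 := (Z.subschemeι ≫ toSpec).finite_appTop
    have h2 : (Scheme.ΓSpecIso (CommRingCat.of ℂ)).inv.hom.Finite :=
      RingHom.Finite.of_surjective _
        (ConcreteCategory.bijective_of_isIso (Scheme.ΓSpecIso (CommRingCat.of ℂ)).inv).2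
    have h3 : scalars (Z.subschemeι ≫ toSpec) ⊤ = (Z.subschemeι ≫ toSpec).appTop.hom.comp
        (Scheme.ΓSpecIso (CommRingCat.of ℂ)).inv.hom := by
      ext r
      exact congrArg (fun φ => φ.hom ((Z.subschemeι ≫ toSpec).appTop.hom
        ((Scheme.ΓSpecIso (CommRingCat.of ℂ)).inv.hom r))) (Z.subscheme.presheaf.map_id _)
    have h4 : (scalars (Z.subschemeι ≫ toSpec) ⊤).Finite := h3 ▸ h1.comp h2
    exact h4
  rw [← hk]
  exact Module.Finite.equiv e.toLinearEquiv.symm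

lemma finite_support {Z : surface.IdealSheafData} (hfin : IsFiniteSubscheme Z) :
    (Z.support : Set surface).Finite := by
  have : IsFinite (Z.subschemeι ≫ toSpec) := hfin
  rw [← Z.range_subschemeι, ← Set.image_univ]
  refine Set.Finite.image _ ?_
  have : Subsingleton (Spec (CommRingCat.of ℂ)) :=
    inferInstanceAs (Subsingleton (PrimeSpectrum ℂ))
  exact ((Z.subschemeι ≫ toSpec).finite_preimage (Set.toFinite Set.univ)).subset
    fun _ _ => Set.mem_univ _

/-! ### Affine coordinates on the complement of a point of the line -/

/-- The linear form `X₀ + c X₁`. -/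
def linForm (c : ℂ) : grading 1 := coord 0 + c • coord 1

lemma coe_linForm (c : ℂ) : (linForm c).1 =
    (MvPolynomial.X 0 + MvPolynomial.C c * MvPolynomial.X 1 : MvPolynomial (Fin 2) ℂ) := by
  rw [linForm, Submodule.coe_add, Submodule.coe_smul, MvPolynomial.smul_eq_C_mul]
  rfl

/-- The complement of the point `X₀ + c X₁ = 0`. -/
abbrev cell (c : ℂ) : line.Opens := lineOpen (linForm c).1

lemma isAffineOpen_cell (c : ℂ) : IsAffineOpen (cell c) :=
  isAffineOpen_lineOpen one_pos (linForm c).2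

lemma linForm_ne_zero (c : ℂ) : (linForm c).1 ≠ 0 := by
  intro h
  rw [coe_linForm] at h
  have := congrArg (MvPolynomial.eval ![1, 0]) h
  simp at this

lemma eq_of_notMem_cell {x : line} {c c' : ℂ} (h : x ∉ cell c) (h' : x ∉ cell c') : c = c' := by
  by_contra hcc
  let P : Ideal (MvPolynomial (Fin 2) ℂ) :=
    (show ProjectiveSpectrum grading from x).asHomogeneousIdeal.toIdeal
  have m : ∀ f : MvPolynomial (Fin 2) ℂ, x ∉ lineOpen f → f ∈ P := fun f hf => not_not.1 hf
  have h1 := m _ h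
  have h2 := m _ h'
  rw [coe_linForm] at h1 h2
  have hX1 : (MvPolynomial.X 1 : MvPolynomial (Fin 2) ℂ) ∈ P := by
    have h3 := P.mul_mem_left (MvPolynomial.C (c - c')⁻¹) (P.sub_mem h1 h2)
    have h4 : (MvPolynomial.C (c - c')⁻¹ * ((MvPolynomial.X 0 + MvPolynomial.C c * MvPolynomial.X 1) -
        (MvPolynomial.X 0 + MvPolynomial.C c' * MvPolynomial.X 1)) : MvPolynomial (Fin 2) ℂ) =
        MvPolynomial.C ((c - c')⁻¹ * (c - c')) * MvPolynomial.X 1 := by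
      simp only [map_mul, map_sub]; ring
    rw [h4, inv_mul_cancel₀ (sub_ne_zero.2 hcc), map_one, one_mul] at h3
    exact h3
  have hX0 : (MvPolynomial.X 0 : MvPolynomial (Fin 2) ℂ) ∈ P := by
    have := P.sub_mem h1 (P.mul_mem_left (MvPolynomial.C c) hX1)
    rwa [add_sub_cancel_right] at this
  obtain ⟨a, ha⟩ := exists_mem_lineOpen_X x
  fin_cases a
  · exact ha hX0
  · exact ha hX1

/-- A finite set of points of the line is contained in the complement of some point. -/
lemma exists_subset_cell {S : Set line} (hS : S.Finite) : ∃ c, S ⊆ cell c := by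
  have hfin : {c | ∃ x ∈ S, x ∉ cell c}.Finite := by
    have : {c | ∃ x ∈ S, x ∉ cell c} = ⋃ x ∈ S, {c | x ∉ cell c} := by
      ext c; simp
    rw [this]
    refine hS.biUnion fun x _ => Set.Subsingleton.finite fun c hc c' hc' => eq_of_notMem_cell hc hc'
  obtain ⟨c, hc⟩ := hfin.exists_notMem
  refine ⟨c, fun x hx => ?_⟩
  by_contra h
  exact hc ⟨x, hx, h⟩

open Polynomial

/-- The coordinate `X₁ / (X₀ + c X₁)`. -/
def affCoord (c : ℂ) : Γ(line, cell c) := lineFrac (linForm c) 1 le_rfl (coord 1)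

/-- The polynomial in the affine coordinate `X₁ / (X₀ + c X₁)` that corresponds to a form. -/
def dehom (c : ℂ) : MvPolynomial (Fin 2) ℂ →ₐ[ℂ] ℂ[X] := MvPolynomial.aeval ![1 - C c * X, X]

/-- The form of degree `k` with a given dehomogenization. -/
def homog (c : ℂ) (k : ℕ) (p : ℂ[X]) : grading k :=
  ∑ i : Fin (k + 1), p.coeff i • ⟨(linForm c).1 ^ (k - i : ℕ) * MvPolynomial.X 1 ^ (i : ℕ), by
    have h1 : (linForm c).1 ^ (k - i : ℕ) ∈ grading (k - i) := by
      simpa using SetLike.pow_mem_graded (k - i : ℕ) (linForm c).2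
    have := SetLike.mul_mem_graded h1 (MvPolynomial.isHomogeneous_X_pow (R := ℂ) (1 : Fin 2) i)
    rwa [Nat.sub_add_cancel (Nat.lt_succ_iff.1 i.2)] at this⟩

lemma dehom_linForm (c : ℂ) : dehom c (linForm c).1 = 1 := by
  rw [coe_linForm]
  simp [dehom, ← MvPolynomial.algebraMap_eq]

lemma dehom_X_one (c : ℂ) : dehom c (MvPolynomial.X 1) = X := by simp [dehom]

lemma dehom_homog (c : ℂ) {k : ℕ} {p : ℂ[X]} (hp : p.natDegree ≤ k) :
    dehom c (homog c k p).1 = p := by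
  rw [homog, AddSubmonoidClass.coe_finsetSum, map_sum]
  simp only [Submodule.coe_smul, map_smul, map_mul, map_pow, dehom_linForm, dehom_X_one, one_pow,
    one_mul]
  rw [Fin.sum_univ_eq_sum_range (fun i => p.coeff i • (X : ℂ[X]) ^ i), eq_comm]
  simpa only [smul_eq_C_mul] using p.as_sum_range_C_mul_X_pow' (Nat.lt_succ_of_le hp)

lemma natDegree_dehom_le (c : ℂ) {k : ℕ} {F : MvPolynomial (Fin 2) ℂ} (hF : F ∈ grading k) :
    (dehom c F).natDegree ≤ k := by
  rw [dehom, MvPolynomial.aeval_def, MvPolynomial.eval₂_eq']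
  refine natDegree_sum_le_of_forall_le _ _ fun d hd => ?_
  have hdeg : d 0 + d 1 = k := by
    have := hF (MvPolynomial.mem_support_iff.1 hd)
    rw [Finsupp.weight_apply, Finsupp.sum_fintype _ _ (by simp)] at this
    simpa using this
  rw [Fin.prod_univ_two]
  refine natDegree_C_mul_le _ _ |>.trans (natDegree_mul_le.trans ?_)
  have h1 : (1 - C c * X : ℂ[X]).natDegree ≤ 1 := by compute_degree
  have h2 := natDegree_pow_le_of_le (d 0) h1
  have h3 := natDegree_pow_le_of_le (d 1) (natDegree_X_le (R := ℂ))
  simp only [Matrix.cons_val_zero, Matrix.cons_val_one]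
  omega

lemma eval₂_smul_of_homogeneous {S T : Type*} [CommRing S] [CommRing T] (φ : S →+* T)
    {F : MvPolynomial (Fin 2) S} {k : ℕ} (hF : F.IsHomogeneous k) (g : Fin 2 → T) (r : T) :
    F.eval₂ φ (fun i => r * g i) = r ^ k * F.eval₂ φ g := by
  rw [MvPolynomial.eval₂_eq', MvPolynomial.eval₂_eq', Finset.mul_sum]
  refine Finset.sum_congr rfl fun d hd => ?_
  have hdeg : d 0 + d 1 = k := by
    have := hF (MvPolynomial.mem_support_iff.1 hd)
    rw [Finsupp.weight_apply, Finsupp.sum_fintype _ _ (by simp)] at this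
    simpa using this
  rw [Fin.prod_univ_two, Fin.prod_univ_two, ← hdeg]
  ring

lemma lineFrac_eq_aeval (c : ℂ) (k : ℕ) (F : grading k) :
    lineFrac (linForm c) k le_rfl F = aeval (affCoord c) (dehom c F.1) := by
  refine ev_injective fun x hx => ?_
  have h0 := toRF_ne_zero hx
  have hu : ev x hx (affCoord c) = (toRF (linForm c).1)⁻¹ * toRF (MvPolynomial.X 1) := by
    rw [affCoord, ev_lineFrac, pow_one, div_eq_inv_mul]; rfl
  have key : ((ev x hx).comp (aeval (R := ℂ) (affCoord c)).toRingHom).comp (dehom c).toRingHom =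
      MvPolynomial.eval₂Hom (toRF.comp MvPolynomial.C)
        (fun i => (toRF (linForm c).1)⁻¹ * toRF (MvPolynomial.X i)) := by
    apply MvPolynomial.ringHom_ext
    · intro r
      simp [dehom, ev_algebraMap]
    · intro i
      fin_cases i
      · simp only [Fin.zero_eta, AlgHom.toRingHom_eq_coe, RingHom.coe_comp, RingHom.coe_coe,
          Function.comp_apply, MvPolynomial.coe_eval₂Hom, MvPolynomial.eval₂_X]
        simp only [dehom, MvPolynomial.aeval_X, Matrix.cons_val_zero, map_sub, map_one, map_mul,
          aeval_C, aeval_X, ev_algebraMap, hu]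
        rw [eq_comm, eq_sub_iff_add_eq, mul_left_comm, ← mul_add, ← map_mul, ← map_add,
          ← coe_linForm, inv_mul_cancel₀ h0]
      · simp [dehom, hu]
  rw [ev_lineFrac]
  have := DFunLike.congr_fun key F.1
  refine Eq.trans ?_ this.symm
  have hF : F.1.eval₂ (toRF.comp MvPolynomial.C) (fun i => toRF (MvPolynomial.X i)) = toRF F.1 :=
    (MvPolynomial.eval₂_comp_left toRF MvPolynomial.C MvPolynomial.X F.1).symm.trans
      (by rw [MvPolynomial.eval₂_eta])
  rw [MvPolynomial.coe_eval₂Hom, eval₂_smul_of_homogeneous _ F.2, hF, inv_pow, div_eq_inv_mul]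

lemma dehom_injective (c : ℂ) {k : ℕ} {F : grading k} (h : dehom c F.1 = 0) : F = 0 := by
  have h1 := lineFrac_eq_aeval c k F
  rw [h, map_zero] at h1
  have h2 := congrArg (ev genericPt (genericPt_mem (linForm_ne_zero c))) h1
  rw [ev_lineFrac, map_zero, div_eq_zero_iff, or_iff_left, toRF_eq_zero] at h2
  · exact Subtype.ext h2
  · exact pow_ne_zero _ (toRF_ne_zero (genericPt_mem (linForm_ne_zero c)))

lemma aeval_affCoord_bijective (c : ℂ) : Function.Bijective (aeval (R := ℂ) (affCoord c)) := by
  constructor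
  · rw [injective_iff_map_eq_zero]
    intro p hp
    have h1 := lineFrac_eq_aeval c p.natDegree (homog c p.natDegree p)
    rw [dehom_homog c le_rfl, hp] at h1
    have h2 := congrArg (ev genericPt (genericPt_mem (linForm_ne_zero c))) h1
    rw [ev_lineFrac, map_zero, div_eq_zero_iff, or_iff_left, toRF_eq_zero] at h2
    · rw [← dehom_homog c (p := p) le_rfl, h2, map_zero]
    · exact pow_ne_zero _ (toRF_ne_zero (genericPt_mem (linForm_ne_zero c)))
  · intro s
    obtain ⟨n, F, hF, rfl⟩ := awayToLine_surjective one_pos (linForm c).2 s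
    have hF' : F ∈ grading n := by simpa using hF
    refine ⟨dehom c F, ?_⟩
    rw [← lineFrac_eq_aeval c n ⟨F, hF'⟩]
    rfl

/-- Functions on the complement of a point are the polynomials in the affine coordinate. -/
def cellEquiv (c : ℂ) : ℂ[X] ≃ₐ[ℂ] Γ(line, cell c) :=
  AlgEquiv.ofBijective (aeval (affCoord c)) (aeval_affCoord_bijective c)

lemma cellEquiv_apply (c : ℂ) (p : ℂ[X]) : cellEquiv c p = aeval (affCoord c) p := rfl

/-! ### Affine coordinates on the surface -/

/-- The product of two affine lines in the quadric. -/
abbrev plane (c c' : ℂ) : surface.Opens := pr₁ ⁻¹ᵁ cell c ⊓ pr₂ ⁻¹ᵁ cell c'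

lemma isAffineOpen_plane (c c' : ℂ) : IsAffineOpen (plane c c') :=
  isAffineOpen_inter (isAffineOpen_cell c) (isAffineOpen_cell c')

/-- The affine coordinate of the first factor. -/
def coord₁ (c c' : ℂ) : Γ(surface, plane c c') := pull pr₁ pr₁_lineToSpec inf_le_left (affCoord c)

/-- The affine coordinate of the second factor. -/
def coord₂ (c c' : ℂ) : Γ(surface, plane c c') := pull pr₂ pr₂_lineToSpec inf_le_right (affCoord c')

lemma adjoin_coord (c c' : ℂ) : Algebra.adjoin ℂ {coord₁ c c', coord₂ c c'} = ⊤ := by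
  rw [eq_top_iff]
  intro s _
  have h : ∀ (q : surface ⟶ line) (hq : q ≫ lineToSpec = toSpec) (d : ℂ)
      (hV : plane c c' ≤ q ⁻¹ᵁ cell d) (s : Γ(line, cell d)),
      pull q hq hV s ∈ Algebra.adjoin ℂ {pull q hq hV (affCoord d)} := by
    intro q hq d hV s
    obtain ⟨p, rfl⟩ := (aeval_affCoord_bijective d).2 s
    rw [← aeval_algHom_apply]
    exact aeval_mem_adjoin_singleton ℂ _
  induction s using sections_induction (isAffineOpen_cell c) (isAffineOpen_cell c') with
  | zero => exact zero_mem _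
  | add s t hs ht => exact add_mem (hs trivial) (ht trivial)
  | mul s t =>
    refine mul_mem (Algebra.adjoin_mono ?_ (h pr₁ _ c _ s)) (Algebra.adjoin_mono ?_ (h pr₂ _ c' _ t))
    · exact Set.singleton_subset_iff.2 (Set.mem_insert _ _)
    · exact Set.singleton_subset_iff.2 (Set.mem_insert_of_mem _ rfl)

open TensorProduct in
lemma exists_retraction₁ (c c' : ℂ) : ∃ ρ : Γ(surface, plane c c') →ₐ[ℂ] ℂ[X], ρ (coord₁ c c') = X := by
  let e := AlgEquiv.ofBijective _ (tensorMap_bijective (isAffineOpen_cell c) (isAffineOpen_cell c'))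
  let φ : Γ(line, cell c) ⊗[ℂ] Γ(line, cell c') →ₐ[ℂ] ℂ[X] :=
    Algebra.TensorProduct.productMap (cellEquiv c).symm.toAlgHom
      ((aeval (0 : ℂ[X])).comp (cellEquiv c').symm.toAlgHom)
  refine ⟨φ.comp e.symm.toAlgHom, ?_⟩
  have h : e (affCoord c ⊗ₜ 1) = coord₁ c c' :=
    (Algebra.TensorProduct.productMap_apply_tmul _ _ _ _).trans (by rw [map_one, mul_one]; rfl)
  have h2 : (cellEquiv c).symm (affCoord c) = X := by
    rw [AlgEquiv.symm_apply_eq, cellEquiv_apply, aeval_X]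
  rw [← h]
  refine (congrArg φ (e.symm_apply_apply _)).trans ?_
  refine (Algebra.TensorProduct.productMap_apply_tmul _ _ _ _).trans ?_
  rw [map_one, mul_one]
  exact h2

open TensorProduct in
lemma exists_retraction₂ (c c' : ℂ) : ∃ ρ : Γ(surface, plane c c') →ₐ[ℂ] ℂ[X], ρ (coord₂ c c') = X := by
  let e := AlgEquiv.ofBijective _ (tensorMap_bijective (isAffineOpen_cell c) (isAffineOpen_cell c'))
  let φ : Γ(line, cell c) ⊗[ℂ] Γ(line, cell c') →ₐ[ℂ] ℂ[X] :=
    Algebra.TensorProduct.productMap ((aeval (0 : ℂ[X])).comp (cellEquiv c).symm.toAlgHom)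
      (cellEquiv c').symm.toAlgHom
  refine ⟨φ.comp e.symm.toAlgHom, ?_⟩
  have h : e (1 ⊗ₜ affCoord c') = coord₂ c c' :=
    (Algebra.TensorProduct.productMap_apply_tmul _ _ _ _).trans (by rw [map_one, one_mul]; rfl)
  have h2 : (cellEquiv c').symm (affCoord c') = X := by
    rw [AlgEquiv.symm_apply_eq, cellEquiv_apply, aeval_X]
  rw [← h]
  refine (congrArg φ (e.symm_apply_apply _)).trans ?_
  refine (Algebra.TensorProduct.productMap_apply_tmul _ _ _ _).trans ?_
  rw [map_one, one_mul]
  exact h2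

lemma frc_linForm (q : surface ⟶ line) (hq : q ≫ lineToSpec = toSpec) {V : surface.Opens} (c : ℂ)
    (hV : V ≤ q ⁻¹ᵁ cell c) (k : ℕ) (F : grading k) :
    frc q hq (linForm c) k hV F = aeval (pull q hq hV (affCoord c)) (dehom c F.1) := by
  rw [aeval_algHom_apply, ← lineFrac_eq_aeval]
  rfl

/-- A finite subscheme is contained in a product of two affine lines. -/
lemma exists_support_subset_plane {Z : surface.IdealSheafData} (hZ : IsFiniteSubscheme Z) :
    ∃ c c', (Z.support : Set surface) ⊆ plane c c' := by
  obtain ⟨c, hc⟩ := exists_subset_cell ((finite_support hZ).image pr₁)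
  obtain ⟨c', hc'⟩ := exists_subset_cell ((finite_support hZ).image pr₂)
  exact ⟨c, c', fun y hy => ⟨hc ⟨y, hy, rfl⟩, hc' ⟨y, hy, rfl⟩⟩⟩

/-! ### Sections of twisted ideal sheaves in a trivialisation -/

lemma exists_mem_chart (y : surface) : ∃ c, y ∈ chart c := by
  obtain ⟨a, ha⟩ := exists_mem_lineOpen_X (pr₁ y)
  obtain ⟨b, hb⟩ := exists_mem_lineOpen_X (pr₂ y)
  exact ⟨(a, b), ha, hb⟩

lemma res_injective_of_le {V W : surface.Opens} (h : W ≤ V) (h' : V ≤ W) :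
    Function.Injective (res h) := fun s t hst => by
  have := congrArg (res h') hst
  rwa [res_res, res_res, res_self, res_self] at this

section component

variable {Z : surface.IdealSheafData} {m n : ℤ} {T : surface.Opens}

/-- The function that represents a section over `T ⊆ chart i` in the trivialisation over
`chart i`. -/
def component (i : Fin 2 × Fin 2) (h : T ≤ chart i) : Sections Z m n T →ₗ[ℂ] Γ(surface, T) :=
  (res (le_inf le_rfl h : T ≤ T ⊓ chart i)).toLinearMap ∘ₗ LinearMap.proj i ∘ₗ
    (twistedIdeal Z m n T).subtype

lemma component_apply (i : Fin 2 × Fin 2) (h : T ≤ chart i) (s : Sections Z m n T) :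
    component i h s = res (le_inf le_rfl h : T ≤ T ⊓ chart i) (s.1 i) := rfl

lemma component_mem_van (i : Fin 2 × Fin 2) (h : T ≤ chart i) (s : Sections Z m n T) :
    component i h s ∈ van Z T :=
  res_mem_van (le_inf le_rfl h) (show s.1 i ∈ van Z (T ⊓ chart i) from s.2.2 i)

lemma component_eq_trans_mul (i j : Fin 2 × Fin 2) (hi : T ≤ chart i) (hj : T ≤ chart j)
    (s : Sections Z m n T) :
    component j hj s = (trans m n i j (le_inf hi hj)).1 * component i hi s := by
  have := congrArg (res (le_inf le_rfl (le_inf hi hj) : T ≤ T ⊓ (chart i ⊓ chart j))) (s.2.1 i j)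
  rw [map_mul, res_res, res_res, res_res] at this
  exact this

lemma component_restrict (i : Fin 2 × Fin 2) (h : T ≤ chart i) {T' : surface.Opens} (h' : T' ≤ T)
    (s : Sections Z m n T) :
    component i (h'.trans h) (restrict Z m n h' s) = res h' (component i h s) := by
  rw [component_apply, component_apply, res_res]
  exact res_res _ _ _

lemma component_injective (i : Fin 2 × Fin 2) (h : T ≤ chart i) :
    Function.Injective (component (Z := Z) (m := m) (n := n) i h) := by
  rw [← LinearMap.ker_eq_bot, LinearMap.ker_eq_bot']
  intro s hs
  refine Subtype.ext (funext fun d => ?_)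
  have h1 : T ⊓ (chart i ⊓ chart d) ≤ T ⊓ chart d := inter_le_right T i d
  refine res_injective_of_le h1 (le_inf inf_le_left (le_inf (inf_le_left.trans h) inf_le_right)) ?_
  have h2 : res (inter_le_left T i d) (s.1 i) = 0 := by
    have := congrArg (res (inf_le_left : T ⊓ (chart i ⊓ chart d) ≤ T)) hs
    rw [component_apply, res_res, map_zero] at this
    exact this
  rw [s.2.1 i d, h2, mul_zero]
  exact (map_zero _).symm

lemma exists_component_eq (i : Fin 2 × Fin 2) (h : T ≤ chart i) {f : Γ(surface, T)}
    (hf : f ∈ van Z T) : ∃ s : Sections Z m n T, component i h s = f := by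
  have hd : ∀ d, T ⊓ chart d ≤ chart i ⊓ chart d := fun d => inf_le_inf_right _ h
  refine ⟨⟨fun d => (trans m n i d (hd d)).1 * res inf_le_left f, fun c d => ?_, fun d => ?_⟩, ?_⟩
  · have h3 := trans_mul m n i c d (T := T ⊓ (chart c ⊓ chart d)) ((inter_le_left T c d).trans (hd c))
      inf_le_right ((inter_le_right T c d).trans (hd d))
    rw [map_mul, map_mul, res_res, res_res, res_trans, res_trans, ← trans_val, ← h3,
      Units.val_mul]
    ring
  · exact (van Z _).mul_mem_left _ (res_mem_van inf_le_left hf)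
  · change res (le_inf le_rfl h : T ≤ T ⊓ chart i)
      ((trans m n i i (hd i)).1 * res (inf_le_left : T ⊓ chart i ≤ T) f) = f
    rw [map_mul, res_res, res_self, res_trans, trans_self]
    exact one_mul f

variable (Z m n)

/-- Sections over `T ⊆ chart i` are the functions on `T` that vanish on `Z`. -/
def componentEquiv (i : Fin 2 × Fin 2) (h : T ≤ chart i) :
    Sections Z m n T ≃ₗ[ℂ] (van Z T).restrictScalars ℂ :=
  LinearEquiv.ofBijective
    ((component i h).codRestrict ((van Z T).restrictScalars ℂ) (component_mem_van i h))
    ⟨fun s t hst => component_injective i h (congrArg Subtype.val hst), fun f => by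
      obtain ⟨s, hs⟩ := exists_component_eq i h f.2
      exact ⟨s, Subtype.ext hs⟩⟩

lemma component_componentEquiv_symm (i : Fin 2 × Fin 2) (h : T ≤ chart i)
    (f : (van Z T).restrictScalars ℂ) :
    component i h ((componentEquiv Z m n i h).symm f) = f.1 :=
  congrArg Subtype.val ((componentEquiv Z m n i h).apply_symm_apply f)

end component

/-! ### Global sections in affine coordinates -/

/-- The transition function of `𝒪(m, n)` from the trivialisation over `chart d` to the one over
`plane c c'`. -/
def twist (m n : ℤ) (c c' : ℂ) (d : Fin 2 × Fin 2) {V : surface.Opens} (hV : V ≤ plane c c')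
    (hd : V ≤ chart d) : Γ(surface, V)ˣ :=
  quot pr₁ pr₁_lineToSpec (coord d.1) (linForm c) (le_preimage₁ hd) (hV.trans inf_le_left) ^ m *
    quot pr₂ pr₂_lineToSpec (coord d.2) (linForm c') (le_preimage₂ hd) (hV.trans inf_le_right) ^ n

lemma map_res_quot (q : surface ⟶ line) (hq : q ≫ lineToSpec = toSpec) {V W : surface.Opens}
    (f g : grading 1) (hf : V ≤ q ⁻¹ᵁ lineOpen f) (hg : V ≤ q ⁻¹ᵁ lineOpen g) (h : W ≤ V) :
    Units.map (res h).toRingHom.toMonoidHom (quot q hq f g hf hg) =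
      quot q hq f g (h.trans hf) (h.trans hg) :=
  Units.ext (res_frc q hq g 1 hg h f)

lemma res_twist (m n : ℤ) (c c' : ℂ) (d : Fin 2 × Fin 2) {V W : surface.Opens}
    (hV : V ≤ plane c c') (hd : V ≤ chart d) (h : W ≤ V) :
    res h (twist m n c c' d hV hd).1 = (twist m n c c' d (h.trans hV) (h.trans hd)).1 := by
  have : Units.map (res h).toRingHom.toMonoidHom (twist m n c c' d hV hd) =
      twist m n c c' d (h.trans hV) (h.trans hd) := by
    rw [twist, map_mul, map_zpow, map_zpow, map_res_quot, map_res_quot]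
    rfl
  exact congrArg Units.val this

lemma trans_mul_twist (m n : ℤ) (c c' : ℂ) (d e : Fin 2 × Fin 2) {V : surface.Opens}
    (hV : V ≤ plane c c') (hd : V ≤ chart d) (he : V ≤ chart e) :
    trans m n d e (le_inf hd he) * twist m n c c' e hV he = twist m n c c' d hV hd := by
  rw [trans_eq_quot m n d e _ hd he, twist, twist, mul_mul_mul_comm, ← mul_zpow, ← mul_zpow,
    quot_mul, quot_mul]

section globalSpace

open Polynomial

/-- The functions on `plane c c'` that represent global sections of `𝒪(m, n)`. -/
def globalSpace (m n : ℤ) (c c' : ℂ) : Submodule ℂ Γ(surface, plane c c') where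
  carrier := {p | ∃ t, IsGlobalSection m n t ∧ ∀ d,
    (twist m n c c' d (inf_le_left : plane c c' ⊓ chart d ≤ _) inf_le_right).1 *
      res inf_le_right (t d) = res inf_le_left p}
  add_mem' := by
    rintro p p' ⟨t, ht, h⟩ ⟨t', ht', h'⟩
    refine ⟨t + t', fun c d => ?_, fun d => ?_⟩
    · rw [Pi.add_apply, Pi.add_apply, map_add, map_add, mul_add, ht c d, ht' c d]
    · rw [Pi.add_apply, map_add, map_add, mul_add, h d, h' d]
  zero_mem' := ⟨0, fun c d => by simp, fun d => by simp⟩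
  smul_mem' := by
    rintro r p ⟨t, ht, h⟩
    refine ⟨r • t, fun c d => ?_, fun d => ?_⟩
    · rw [Pi.smul_apply, Pi.smul_apply, map_smul, map_smul, mul_smul_comm, ht c d]
    · rw [Pi.smul_apply, map_smul, map_smul, mul_smul_comm, h d]

/-- The function on the plane that corresponds to a product of two forms. -/
lemma twist_mul_res_formSection {m n : ℕ} (F : grading m) (G : grading n) (c c' : ℂ)
    (d : Fin 2 × Fin 2) :
    (twist m n c c' d (inf_le_left : plane c c' ⊓ chart d ≤ _) inf_le_right).1 *
      res inf_le_right (formSection F G d) =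
    res inf_le_left (aeval (coord₁ c c') (dehom c F.1) * aeval (coord₂ c c') (dehom c' G.1)) := by
  rw [coord₁, coord₂, ← frc_linForm, ← frc_linForm, formSection, map_mul, map_mul, res_frc, res_frc,
    res_frc, res_frc, twist, zpow_natCast, zpow_natCast,
    frc_change pr₁ pr₁_lineToSpec (linForm c) (coord d.1) m _ (le_preimage₁ inf_le_right),
    frc_change pr₂ pr₂_lineToSpec (linForm c') (coord d.2) n _ (le_preimage₂ inf_le_right)]
  simp only [Units.val_mul, Units.val_pow_eq_pow_val, quot]
  ring

lemma mem_globalSpace_of_natDegree_le (m n : ℕ) (c c' : ℂ) {p₁ p₂ : ℂ[X]} (h₁ : p₁.natDegree ≤ m)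
    (h₂ : p₂.natDegree ≤ n) :
    aeval (coord₁ c c') p₁ * aeval (coord₂ c c') p₂ ∈ globalSpace m n c c' := by
  refine ⟨formSection (homog c m p₁) (homog c' n p₂), isGlobalSection_formSection _ _, fun d => ?_⟩
  rw [twist_mul_res_formSection, dehom_homog c h₁, dehom_homog c' h₂]

lemma eq_of_res_eq {V : surface.Opens} {f g : Γ(surface, V)}
    (h : ∀ d, res (inf_le_left : V ⊓ chart d ≤ V) f = res inf_le_left g) : f = g := by
  refine surface.sheaf.eq_of_locally_eq' (fun d => V ⊓ chart d) V (fun d => homOfLE inf_le_left)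
    (fun y hy => ?_) _ _ h
  obtain ⟨d, hd⟩ := exists_mem_chart y
  exact Opens.mem_iSup.2 ⟨d, hy, hd⟩

lemma globalSpace_eq_bot {m n : ℤ} (hmn : m < 0 ∨ n < 0) (c c' : ℂ) : globalSpace m n c c' = ⊥ := by
  rw [eq_bot_iff]
  rintro p ⟨t, ht, hp⟩
  rw [Submodule.mem_bot]
  refine eq_of_res_eq fun d => ?_
  rw [← hp d, ht.eq_zero hmn]
  simp

lemma globalSpace_eq_span (m n : ℕ) (c c' : ℂ) : globalSpace m n c c' =
    Submodule.span ℂ {p | ∃ p₁ p₂ : ℂ[X], p₁.natDegree ≤ m ∧ p₂.natDegree ≤ n ∧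
      p = aeval (coord₁ c c') p₁ * aeval (coord₂ c c') p₂} := by
  apply le_antisymm
  · rintro p ⟨t, ht, hp⟩
    obtain ⟨φ, hφ⟩ := ht.exists_eq_sum
    have : p = ∑ e, φ e • (aeval (coord₁ c c') (dehom c (monForm m e.1).1) *
        aeval (coord₂ c c') (dehom c' (monForm n e.2).1)) := by
      refine eq_of_res_eq fun d => ?_
      rw [← hp d, hφ d, map_sum, map_sum, Finset.mul_sum]
      refine Finset.sum_congr rfl fun e _ => ?_
      rw [map_smul, map_smul, mul_smul_comm, twist_mul_res_formSection]
    rw [this]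
    exact Submodule.sum_mem _ fun e _ => Submodule.smul_mem _ _ (Submodule.subset_span
      ⟨_, _, natDegree_dehom_le c (monForm m e.1).2, natDegree_dehom_le c' (monForm n e.2).2, rfl⟩)
  · rw [Submodule.span_le]
    rintro _ ⟨p₁, p₂, h₁, h₂, rfl⟩
    exact mem_globalSpace_of_natDegree_le m n c c' h₁ h₂

end globalSpace

/-! ### The first cohomology group in affine coordinates -/

lemma isAffineOpen_chart (d : Fin 2 × Fin 2) : IsAffineOpen (chart d) :=
  isAffineOpen_inter (isAffineOpen_lineOpen one_pos (coord d.1).2)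
    (isAffineOpen_lineOpen one_pos (coord d.2).2)

section cohomology

variable (Z : surface.IdealSheafData) (m n : ℤ) (c c' : ℂ)

/-- The difference of a family of functions on the charts and a function on the plane, as sections
of `𝒪(m, n)`, in the trivialisation over the plane. -/
def chartDiff (d : Fin 2 × Fin 2) : ((∀ d, Γ(surface, chart d)) × Γ(surface, plane c c')) →ₗ[ℂ]
    Γ(surface, plane c c' ⊓ chart d) :=
  LinearMap.mulLeft ℂ (twist m n c c' d inf_le_left inf_le_right).1 ∘ₗ
      (res inf_le_right).toLinearMap ∘ₗ LinearMap.proj d ∘ₗ LinearMap.fst ℂ _ _ -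
    (res inf_le_left).toLinearMap ∘ₗ LinearMap.snd ℂ _ _

lemma chartDiff_apply (d : Fin 2 × Fin 2) (x) : chartDiff m n c c' d x =
    (twist m n c c' d inf_le_left inf_le_right).1 * res inf_le_right (x.1 d) -
      res inf_le_left x.2 := rfl

/-- Families of functions on the charts that agree on `Z` with a function on the plane, as sections
of `𝒪(m, n)`. -/
def liftSpace : Submodule ℂ ((∀ d, Γ(surface, chart d)) × Γ(surface, plane c c')) :=
  ⨅ d, ((van Z (plane c c' ⊓ chart d)).restrictScalars ℂ).comap (chartDiff m n c c' d)

variable {Z m n c c'} in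
lemma mem_liftSpace {x : (∀ d, Γ(surface, chart d)) × Γ(surface, plane c c')} :
    x ∈ liftSpace Z m n c c' ↔ ∀ d, chartDiff m n c c' d x ∈ van Z (plane c c' ⊓ chart d) := by
  simp [liftSpace, Submodule.mem_iInf]

/-- The differences `t_j - t_i` of a family of sections of `𝒪(m, n)` over the charts, in the
trivialisation over `chart i`. -/
def overlapDiff (i j : Fin 2 × Fin 2) : (∀ d, Γ(surface, chart d)) →ₗ[ℂ]
    Γ(surface, chart i ⊓ chart j) :=
  LinearMap.mulLeft ℂ (trans m n j i (le_inf inf_le_right inf_le_left)).1 ∘ₗ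
      (res inf_le_right).toLinearMap ∘ₗ LinearMap.proj j -
    (res inf_le_left).toLinearMap ∘ₗ LinearMap.proj i

lemma overlapDiff_apply (i j : Fin 2 × Fin 2) (t) : overlapDiff m n i j t =
    (trans m n j i (le_inf inf_le_right inf_le_left)).1 * res inf_le_right (t j) -
      res inf_le_left (t i) := rfl

lemma twist_mul_res_overlapDiff (i j : Fin 2 × Fin 2) (x) {V : surface.Opens}
    (hV : V ≤ plane c c') (hi : V ≤ chart i) (hj : V ≤ chart j) :
    (twist m n c c' i hV hi).1 * res (le_inf hi hj) (overlapDiff m n i j x.1) =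
      res (le_inf hV hj) (chartDiff m n c c' j x) - res (le_inf hV hi) (chartDiff m n c c' i x) := by
  rw [overlapDiff_apply, chartDiff_apply, chartDiff_apply]
  simp only [map_sub, map_mul, res_res, res_trans, res_twist]
  rw [← trans_mul_twist m n c c' j i hV hj hi, Units.val_mul]
  ring

variable {Z m n c c'}

lemma overlapDiff_mem_van (hZ : (Z.support : Set surface) ⊆ plane c c')
    {x : (∀ d, Γ(surface, chart d)) × Γ(surface, plane c c')} (hx : x ∈ liftSpace Z m n c c')
    (i j : Fin 2 × Fin 2) : overlapDiff m n i j x.1 ∈ van Z (chart i ⊓ chart j) := by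
  have hi : plane c c' ⊓ (chart i ⊓ chart j) ≤ chart i := inf_le_right.trans inf_le_left
  have hj : plane c c' ⊓ (chart i ⊓ chart j) ≤ chart j := inf_le_right.trans inf_le_right
  rw [mem_van_iff (le_inf hi hj) (fun y hy hyV => ⟨hZ hy, hyV⟩),
    ← Ideal.unit_mul_mem_iff_mem _ (twist m n c c' i inf_le_left hi).isUnit,
    twist_mul_res_overlapDiff m n c c' i j x inf_le_left hi hj]
  exact sub_mem (res_mem_van _ (mem_liftSpace.1 hx j)) (res_mem_van _ (mem_liftSpace.1 hx i))

/-- The coboundary of a family of sections of `𝒪(m, n)` over the charts, as a cochain of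
`ℐ_Z(m, n)`. -/
def liftBoundary (hZ : (Z.support : Set surface) ⊆ plane c c') :
    liftSpace Z m n c c' →ₗ[ℂ] ∀ i j, Sections Z m n (chart i ⊓ chart j) :=
  LinearMap.pi fun i => LinearMap.pi fun j =>
    (componentEquiv Z m n i inf_le_left).symm.toLinearMap ∘ₗ
      LinearMap.codRestrict ((van Z (chart i ⊓ chart j)).restrictScalars ℂ)
        (overlapDiff m n i j ∘ₗ LinearMap.fst ℂ _ _ ∘ₗ (liftSpace Z m n c c').subtype)
        (fun x => overlapDiff_mem_van hZ x.2 i j)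

lemma component_liftBoundary (hZ : (Z.support : Set surface) ⊆ plane c c')
    (x : liftSpace Z m n c c') (i j : Fin 2 × Fin 2) :
    component i inf_le_left (liftBoundary hZ x i j) = overlapDiff m n i j x.1.1 :=
  component_componentEquiv_symm Z m n i inf_le_left _

lemma cechD1_apply (s : ∀ i j, Sections Z m n (chart i ⊓ chart j)) (i j k : Fin 2 × Fin 2) :
    cechD1 Z m n s i j k =
      restrict Z m n (le_inf (inf_le_left.trans inf_le_right) inf_le_right) (s j k) -
      restrict Z m n (le_inf (inf_le_left.trans inf_le_left) inf_le_right) (s i k) +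
      restrict Z m n inf_le_left (s i j) := rfl

/-- The first component of a coboundary on a triple overlap. -/
lemma component_cechD1 (s : ∀ i j, Sections Z m n (chart i ⊓ chart j)) (i j k : Fin 2 × Fin 2) :
    component i (inf_le_left.trans inf_le_left) (cechD1 Z m n s i j k) =
      (trans m n j i (le_inf (inf_le_left.trans inf_le_right) (inf_le_left.trans inf_le_left))).1 *
        res (le_inf (inf_le_left.trans inf_le_right) inf_le_right) (component j inf_le_left (s j k)) -
      res (le_inf (inf_le_left.trans inf_le_left) inf_le_right) (component i inf_le_left (s i k)) +
      res inf_le_left (component i inf_le_left (s i j)) := by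
  rw [cechD1_apply, map_add, map_sub, component_eq_trans_mul j i (inf_le_left.trans inf_le_right)]
  congr 1
  congr 1
  · congr 1
    exact component_restrict j inf_le_left _ _
  · exact component_restrict i inf_le_left _ _
  · exact component_restrict i inf_le_left _ _

lemma liftBoundary_mem_ker (hZ : (Z.support : Set surface) ⊆ plane c c')
    (x : liftSpace Z m n c c') : liftBoundary hZ x ∈ LinearMap.ker (cechD1 Z m n) := by
  rw [LinearMap.mem_ker]
  funext i j k
  refine component_injective i (inf_le_left.trans inf_le_left) ?_
  rw [component_cechD1, component_liftBoundary, component_liftBoundary, component_liftBoundary,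
    overlapDiff_apply, overlapDiff_apply, overlapDiff_apply]
  simp only [map_sub, map_mul, res_res, res_trans]
  have h := trans_mul m n k j i (T := chart i ⊓ chart j ⊓ chart k)
    (le_inf inf_le_right (inf_le_left.trans inf_le_right))
    (le_inf (inf_le_left.trans inf_le_right) (inf_le_left.trans inf_le_left))
    (le_inf inf_le_right (inf_le_left.trans inf_le_left))
  rw [← h, Units.val_mul]
  refine Eq.trans ?_ (map_zero _).symm
  ring

lemma cechD0_apply (t : ∀ i, Sections Z m n (chart i)) (i j : Fin 2 × Fin 2) :
    cechD0 Z m n t i j = restrict Z m n inf_le_right (t j) - restrict Z m n inf_le_left (t i) := rfl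

lemma component_cechD0 (t : ∀ i, Sections Z m n (chart i)) (i j : Fin 2 × Fin 2) :
    component i inf_le_left (cechD0 Z m n t i j) =
      overlapDiff m n i j (fun d => component d le_rfl (t d)) := by
  rw [cechD0_apply, map_sub, component_eq_trans_mul j i inf_le_right, overlapDiff_apply]
  congr 1
  · congr 1
    exact component_restrict j le_rfl _ _
  · exact component_restrict i le_rfl _ _

lemma overlapDiff_eq_zero_iff {t : ∀ d, Γ(surface, chart d)} :
    (∀ i j, overlapDiff m n i j t = 0) ↔ IsGlobalSection m n t := by
  -- the transition functions from `i` to `j` and from `j` to `i` are inverse to each other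
  have hinv : ∀ i j, trans m n i j (le_rfl : chart i ⊓ chart j ≤ _) *
      trans m n j i (le_inf inf_le_right inf_le_left) = 1 := fun i j => by
    rw [mul_comm, trans_mul m n j i j (T := chart i ⊓ chart j) (le_inf inf_le_right inf_le_left)
      le_rfl (le_inf inf_le_right inf_le_right), trans_self]
  constructor
  · intro h i j
    have h1 := sub_eq_zero.1 ((overlapDiff_apply m n i j t).symm.trans (h i j))
    rw [← h1, ← mul_assoc, ← Units.val_mul, hinv, Units.val_one, one_mul]
  · intro h i j
    rw [overlapDiff_apply, h i j, ← mul_assoc, ← Units.val_mul, mul_comm (trans m n j i _), hinv,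
      Units.val_one, one_mul, sub_self]

/-- A global section of `𝒪(m, n)` is represented by a function on the plane. -/
lemma IsGlobalSection.exists_res_eq {t : ∀ d, Γ(surface, chart d)} (ht : IsGlobalSection m n t)
    (c c' : ℂ) : ∃ p : Γ(surface, plane c c'), ∀ d,
      (twist m n c c' d (inf_le_left : plane c c' ⊓ chart d ≤ _) inf_le_right).1 *
        res inf_le_right (t d) = res inf_le_left p := by
  by_cases hmn : m < 0 ∨ n < 0
  · refine ⟨0, fun d => ?_⟩
    rw [ht.eq_zero hmn]
    simp
  · rw [not_or, not_lt, not_lt] at hmn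
    obtain ⟨hm, hn⟩ := hmn
    lift m to ℕ using hm
    lift n to ℕ using hn
    obtain ⟨φ, hφ⟩ := ht.exists_eq_sum
    refine ⟨∑ e, φ e • (Polynomial.aeval (coord₁ c c') (dehom c (monForm m e.1).1) *
        Polynomial.aeval (coord₂ c c') (dehom c' (monForm n e.2).1)), fun d => ?_⟩
    rw [hφ d, map_sum, map_sum, Finset.mul_sum]
    refine Finset.sum_congr rfl fun e _ => ?_
    rw [map_smul, map_smul, mul_smul_comm, twist_mul_res_formSection]

/-- The class of the coboundary of a family of sections of `𝒪(m, n)` over the charts. -/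
def liftClass (hZ : (Z.support : Set surface) ⊆ plane c c') :
    liftSpace Z m n c c' →ₗ[ℂ] H1 Z m n :=
  Submodule.mkQ _ ∘ₗ (liftBoundary hZ).codRestrict _ (liftBoundary_mem_ker hZ)

/-- If the coboundary is the one of sections of `ℐ_Z(m, n)`, then the difference of the two
families is a global section of `𝒪(m, n)` that agrees on `Z` with the given function on the plane. -/
lemma liftClass_eq_zero_iff (hZ : (Z.support : Set surface) ⊆ plane c c')
    (x : liftSpace Z m n c c') :
    liftClass hZ x = 0 ↔ x.1.2 ∈ (van Z (plane c c')).restrictScalars ℂ ⊔ globalSpace m n c c' := by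
  have h0 : liftClass hZ x = 0 ↔ ∃ t, cechD0 Z m n t = liftBoundary hZ x := by
    rw [liftClass, LinearMap.comp_apply, Submodule.mkQ_apply, Submodule.Quotient.mk_eq_zero]
    rfl
  have hcov : ∀ f : Γ(surface, plane c c'), f ∈ van Z (plane c c') ↔
      ∀ d, res (inf_le_left : plane c c' ⊓ chart d ≤ _) f ∈ van Z (plane c c' ⊓ chart d) := fun f =>
    mem_van_iff_of_cover (fun d => plane c c' ⊓ chart d) (fun _ => inf_le_left)
      fun y _ hy => (exists_mem_chart y).imp fun d hd => ⟨hy, hd⟩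
  have hloc : ∀ d (f : Γ(surface, chart d)), f ∈ van Z (chart d) ↔
      (twist m n c c' d (inf_le_left : plane c c' ⊓ chart d ≤ _) inf_le_right).1 *
        res inf_le_right f ∈ van Z (plane c c' ⊓ chart d) := fun d f => by
    rw [Ideal.unit_mul_mem_iff_mem _ (Units.isUnit _)]
    exact mem_van_iff (inf_le_right : plane c c' ⊓ chart d ≤ _) fun y hy hyd => ⟨hZ hy, hyd⟩
  rw [h0]
  constructor
  · rintro ⟨τ, hτ⟩
    set t' : ∀ d, Γ(surface, chart d) := fun d => x.1.1 d - component d le_rfl (τ d) with ht'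
    have hg : IsGlobalSection m n t' := by
      rw [← overlapDiff_eq_zero_iff]
      intro i j
      have h1 : t' = x.1.1 - fun d => component d le_rfl (τ d) := rfl
      rw [h1, map_sub, ← component_cechD0, hτ, component_liftBoundary, sub_self]
    -- the function on the plane that represents the global section
    obtain ⟨p, hp⟩ : ∃ p : Γ(surface, plane c c'), ∀ d,
        (twist m n c c' d (inf_le_left : plane c c' ⊓ chart d ≤ _) inf_le_right).1 *
          res inf_le_right (t' d) = res inf_le_left p := hg.exists_res_eq c c'
    have hv : x.1.2 - p ∈ van Z (plane c c') := by
      rw [hcov]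
      intro d
      have h1 := mem_liftSpace.1 x.2 d
      rw [chartDiff_apply] at h1
      have h2 := (hloc d _).1 (component_mem_van d le_rfl (τ d))
      have h3 : res (inf_le_left : plane c c' ⊓ chart d ≤ _) (x.1.2 - p) =
          (twist m n c c' d (inf_le_left : plane c c' ⊓ chart d ≤ _) inf_le_right).1 *
            res inf_le_right (component d le_rfl (τ d)) -
          ((twist m n c c' d inf_le_left inf_le_right).1 * res inf_le_right (x.1.1 d) -
            res inf_le_left x.1.2) := by
        rw [map_sub, ← hp d, ht']
        simp only [map_sub]
        ring
      rw [h3]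
      exact sub_mem h2 h1
    rw [← sub_add_cancel x.1.2 p]
    exact Submodule.add_mem_sup hv ⟨t', hg, hp⟩
  · intro hx
    obtain ⟨f, hf, p, ⟨t, ht, hp⟩, hfp⟩ := Submodule.mem_sup.1 hx
    have hmem : ∀ d, x.1.1 d - t d ∈ van Z (chart d) := fun d => by
      rw [hloc]
      have h1 := mem_liftSpace.1 x.2 d
      rw [chartDiff_apply] at h1
      have h2 := (hcov f).1 hf d
      have h3 := add_mem h1 h2
      have h4 : (twist m n c c' d (inf_le_left : plane c c' ⊓ chart d ≤ _) inf_le_right).1 *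
          res inf_le_right (x.1.1 d - t d) =
          (twist m n c c' d inf_le_left inf_le_right).1 * res inf_le_right (x.1.1 d) -
            res inf_le_left x.1.2 + res inf_le_left f := by
        rw [map_sub, mul_sub, hp d, ← hfp, map_add]
        ring
      rwa [h4]
    choose τ hτ using fun d => exists_component_eq (m := m) (n := n) d le_rfl (hmem d)
    refine ⟨τ, ?_⟩
    funext i j
    refine component_injective i inf_le_left ?_
    rw [component_cechD0, component_liftBoundary]
    have h1 : (fun d => component d le_rfl (τ d)) = x.1.1 - t := funext hτ
    rw [h1, map_sub, overlapDiff_eq_zero_iff.2 ht i j, sub_zero]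

lemma exists_mem_liftSpace (hZ : (Z.support : Set surface) ⊆ plane c c')
    (b : Γ(surface, plane c c')) : ∃ x : liftSpace Z m n c c', x.1.2 = b := by
  choose t ht using fun d => exists_res_sub_mem_van (Z := Z) (isAffineOpen_chart d)
    (inf_le_right : plane c c' ⊓ chart d ≤ _) (fun y hy hyd => ⟨hZ hy, hyd⟩)
    ((twist m n c c' d (inf_le_left : plane c c' ⊓ chart d ≤ _) inf_le_right)⁻¹.1 *
      res inf_le_left b)
  refine ⟨⟨(t, b), mem_liftSpace.2 fun d => ?_⟩, rfl⟩
  have := (van Z _).mul_mem_left (twist m n c c' d inf_le_left inf_le_right).1 (ht d)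
  rw [mul_sub, Units.mul_inv_cancel_left] at this
  exact this

/-- A cocycle of `ℐ_Z(m, n)` is a coboundary of sections of `𝒪(m, n)`. These agree on `Z`, so they
glue to a function on `Z`. -/
lemma liftClass_surjective (hm : -1 ≤ m) (hn : -1 ≤ n) (hZ : (Z.support : Set surface) ⊆ plane c c') :
    Function.Surjective (liftClass (m := m) (n := n) hZ) := by
  intro y
  obtain ⟨⟨s, hs⟩, rfl⟩ := Submodule.mkQ_surjective _ y
  have htor : ∀ i j, torus ≤ chart i ⊓ chart j := fun i j =>
    le_inf (torus_le_chart i) (torus_le_chart j)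
  set f : ∀ i j, Γ(surface, chart i ⊓ chart j) := fun i j => component i inf_le_left (s i j) with hf
  obtain ⟨τ, hτ, hστ⟩ := exists_cochain hm hn (fun i j => mon (chartExp m n i) * res (htor i j) (f i j))
    (fun i j k => by
      have h1 := component_cechD1 s i j k
      rw [LinearMap.mem_ker.1 hs] at h1
      have h2 := congrArg (res (le_inf (htor i j) (torus_le_chart k))) h1
      simp only [map_add, map_sub, map_mul, res_res, res_trans, trans_torus] at h2
      have h3 : (mon (chartExp m n j - chartExp m n i)) * mon (chartExp m n i) =
        mon (chartExp m n j) := by rw [← mon_add, sub_add_cancel]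
      have h4 : res (le_inf (htor i j) (torus_le_chart k))
          (component i (inf_le_left.trans inf_le_left)
            ((0 : ∀ i j k, Sections Z m n (chart i ⊓ chart j ⊓ chart k)) i j k)) = 0 := by
        have : ((0 : ∀ i j k, Sections Z m n (chart i ⊓ chart j ⊓ chart k)) i j k) = 0 := rfl
        rw [this, map_zero, map_zero]
      rw [h4] at h2
      have h5 := congrArg (mon (chartExp m n i) * ·) h2
      simp only [mul_zero] at h5
      rw [← h3, h5]
      ring)
    (fun i j x hx => by
      rw [repr_mon_mul] at hx
      exact mem_regularExps_of_repr_ne_zero i j rfl (htor i j) _ hx)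
  choose t ht using fun i => exists_res_eq i i (inf_idem (chart i)).symm (torus_le_chart i)
    (mon (-chartExp m n i) * τ i) (fun x hx => by
      rw [repr_mon_mul, sub_neg_eq_add] at hx
      have := hτ i _ hx
      rwa [add_sub_cancel_right] at this)
  have hdiff : ∀ i j, overlapDiff m n i j t = f i j := fun i j => by
    refine res_torus_injective i j rfl (htor i j) ?_
    rw [overlapDiff_apply, map_sub, map_mul, res_res, res_res, res_trans, trans_torus, ht, ht,
      ← mul_assoc, ← mon_add, sub_add_eq_add_sub, add_neg_cancel, zero_sub, ← mul_sub, ← hστ,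
      ← mul_assoc, ← mon_add, neg_add_cancel, mon_zero, one_mul]
  obtain ⟨b, hb⟩ := exists_glue (Z := Z) (isAffineOpen_plane c c') (fun d => plane c c' ⊓ chart d)
    (fun d => inf_le_left) (fun y hy => by
      obtain ⟨d, hd⟩ := exists_mem_chart y
      exact ⟨d, hy, hd⟩)
    (fun d => (twist m n c c' d inf_le_left inf_le_right).1 * res inf_le_right (t d))
    (fun i j => by
      have h1 := twist_mul_res_overlapDiff m n c c' i j (t, 0)
        (V := (plane c c' ⊓ chart i) ⊓ (plane c c' ⊓ chart j)) (inf_le_left.trans inf_le_left)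
        (inf_le_left.trans inf_le_right) (inf_le_right.trans inf_le_right)
      have h2 : f i j ∈ van Z (chart i ⊓ chart j) := component_mem_van _ _ _
      rw [hdiff, chartDiff_apply, chartDiff_apply, map_zero, map_zero, sub_zero, sub_zero] at h1
      rw [← neg_mem_iff, neg_sub]
      refine (congrArg (· ∈ van Z _) h1).mp ?_
      exact (van Z _).mul_mem_left _ (res_mem_van _ h2))
  refine ⟨⟨(t, b), mem_liftSpace.2 fun d => ?_⟩, ?_⟩
  · have := neg_mem (hb d)
    rwa [neg_sub] at this
  · refine congrArg (Submodule.mkQ _) (Subtype.ext ?_)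
    funext i j
    refine component_injective i inf_le_left ?_
    exact (component_liftBoundary hZ _ i j).trans (hdiff i j)

/-- `H¹(ℐ_Z(m, n))` is the cokernel of the restriction of the global sections of `𝒪(m, n)` to
`Z`. -/
def cohomologyEquiv (hm : -1 ≤ m) (hn : -1 ≤ n) (hZ : (Z.support : Set surface) ⊆ plane c c') :
    H1 Z m n ≃ₗ[ℂ] Γ(surface, plane c c') ⧸
      ((van Z (plane c c')).restrictScalars ℂ ⊔ globalSpace m n c c') :=
  let φ : liftSpace Z m n c c' →ₗ[ℂ] Γ(surface, plane c c') ⧸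
      ((van Z (plane c c')).restrictScalars ℂ ⊔ globalSpace m n c c') :=
    Submodule.mkQ _ ∘ₗ LinearMap.snd ℂ _ _ ∘ₗ (liftSpace Z m n c c').subtype
  have hφ : Function.Surjective φ := fun y => by
    obtain ⟨b, rfl⟩ := Submodule.mkQ_surjective _ y
    obtain ⟨x, rfl⟩ := exists_mem_liftSpace (m := m) (n := n) hZ b
    exact ⟨x, rfl⟩
  have hker : LinearMap.ker (liftClass (m := m) (n := n) hZ) = LinearMap.ker φ := by
    ext x
    rw [LinearMap.mem_ker, liftClass_eq_zero_iff]
    exact (Submodule.Quotient.mk_eq_zero _).symm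
  ((liftClass hZ).quotKerEquivOfSurjective (liftClass_surjective hm hn hZ)).symm ≪≫ₗ
    Submodule.quotEquivOfEq _ _ hker ≪≫ₗ φ.quotKerEquivOfSurjective hφ

end cohomology

/-! ### Polynomials of bounded bidegree modulo an ideal -/

section bidegreeSpace

open Polynomial

variable (K : Type*) {R : Type*} [Field K] [CommRing R] [Algebra K R]

/-- The values at `(u, v)` of the polynomials in two variables of degree `< M` in the first and
degree `< N` in the second variable. -/
def bidegreeSpace (u v : R) (M N : ℕ) : Submodule K R :=
  Submodule.span K {x | ∃ p q : K[X], p.degree < M ∧ q.degree < N ∧ x = aeval u p * aeval v q}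

lemma bidegreeSpace_comm (u v : R) (M N : ℕ) :
    bidegreeSpace K u v M N = bidegreeSpace K v u N M := by
  refine congrArg _ (Set.ext fun x => ⟨?_, ?_⟩)
  · rintro ⟨p, q, hp, hq, rfl⟩
    exact ⟨q, p, hq, hp, mul_comm _ _⟩
  · rintro ⟨p, q, hp, hq, rfl⟩
    exact ⟨q, p, hq, hp, mul_comm _ _⟩

variable {K}

/-- Modulo an ideal that contains a monic polynomial in `u` of degree at most `M`, the bound on the
degree in `u` is immaterial. -/
lemma sup_bidegreeSpace_eq_sup_strip {u v : R} {I : Ideal R} {g : K[X]} (hg : g.Monic)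
    (hgI : aeval u g ∈ I) {M : ℕ} (hM : g.natDegree ≤ M) (N : ℕ) :
    I.restrictScalars K ⊔ bidegreeSpace K u v M N = I.restrictScalars K ⊔ strip K u v N := by
  apply le_antisymm
  · refine sup_le_sup_left (Submodule.span_le.2 ?_) _
    rintro _ ⟨p, q, -, hq, rfl⟩
    by_cases hq0 : q = 0
    · simp [hq0]
    rw [SetLike.mem_coe, aeval_eq_sum_range' ((natDegree_lt_iff_degree_lt hq0).2 hq),
      Finset.mul_sum]
    refine Submodule.sum_mem _ fun j hj => ?_
    rw [mul_smul_comm]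
    exact Submodule.smul_mem _ _ (aeval_mul_pow_mem_strip u v p (Finset.mem_range.1 hj))
  · refine sup_le le_sup_left ?_
    intro x hx
    obtain ⟨p, rfl⟩ := mem_strip.1 hx
    refine Submodule.sum_mem _ fun j _ => ?_
    rw [← modByMonic_add_div (p j) g, map_add, add_mul, map_mul, add_comm]
    refine Submodule.add_mem_sup ?_ (Submodule.subset_span ⟨p j %ₘ g, X ^ (j : ℕ), ?_, ?_, ?_⟩)
    · rw [Submodule.restrictScalars_mem, mul_assoc]
      exact I.mul_mem_right _ hgI
    · exact (degree_modByMonic_lt _ hg).trans_le (degree_le_of_natDegree_le hM)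
    · rw [degree_X_pow]
      exact_mod_cast j.2
    · rw [map_pow, aeval_X]

/-- The codimension of the polynomials of bounded bidegree modulo an ideal, if the bound for `u` is
at least the degree of the minimal polynomial of `u`. -/
theorem finrank_quotient_sup_bidegreeSpace [IsAlgClosed K] [DecidableEq K] {u v : R}
    (hgen : Algebra.adjoin K {u, v} = ⊤) (I : Ideal R) [Module.Finite K (R ⧸ I)] {M : ℕ}
    (hM : (minpoly K (Ideal.Quotient.mk I u)).natDegree ≤ M) (N : ℕ) :
    Module.finrank K (R ⧸ (I.restrictScalars K ⊔ bidegreeSpace K u v M N)) =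
      ∑ a ∈ (minpoly K (Ideal.Quotient.mk I u)).roots.toFinset,
        ∑ j ∈ Finset.range ((minpoly K (Ideal.Quotient.mk I u)).rootMultiplicity a),
          (residualLength K (u - algebraMap K R a) j (I ⊔ Ideal.span {(u - algebraMap K R a) ^
            (minpoly K (Ideal.Quotient.mk I u)).rootMultiplicity a}) - N) := by
  set g := minpoly K (Ideal.Quotient.mk I u) with hgdef
  have hint : IsIntegral K (Ideal.Quotient.mk I u) := Algebra.IsIntegral.isIntegral _
  have hg : g.Monic := minpoly.monic hint
  have hgI : aeval u g ∈ I := by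
    rw [← Ideal.Quotient.eq_zero_iff_mem]
    have h1 := minpoly.aeval K (Ideal.Quotient.mk I u)
    rwa [← Ideal.Quotient.mkₐ_eq_mk K I, aeval_algHom_apply] at h1
  have hprod : g = ∏ a ∈ g.roots.toFinset, (X - C a) ^ g.rootMultiplicity a := by
    conv_lhs => rw [(IsAlgClosed.splits g).eq_prod_roots_of_monic hg]
    rw [Finset.prod_multiset_map_count]
    simp only [count_roots]
  rw [finrank_quotient_congr (sup_bidegreeSpace_eq_sup_strip hg hgI hM N)]
  refine finrank_quotient_sup_strip hgen _ _ ?_ N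
  rwa [← hprod]

end bidegreeSpace

open Polynomial in
/-- Global sections of `𝒪(m, n)` are polynomials of bidegree at most `(m, n)`. -/
lemma globalSpace_eq_bidegreeSpace {m n : ℤ} (hm : -1 ≤ m) (hn : -1 ≤ n) (c c' : ℂ) :
    globalSpace m n c c' =
      bidegreeSpace ℂ (coord₁ c c') (coord₂ c c') (m + 1).toNat (n + 1).toNat := by
  have hz : ∀ p : ℂ[X], p.degree < (0 : ℕ) → p = 0 := fun p hp => by
    by_contra h
    exact absurd hp (not_lt.2 (zero_le_degree_iff.2 h))
  by_cases hmn : m < 0 ∨ n < 0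
  · rw [globalSpace_eq_bot hmn, bidegreeSpace, eq_comm, eq_bot_iff, Submodule.span_le]
    rintro _ ⟨p, q, hp, hq, rfl⟩
    rcases hmn with h | h
    · rw [show (m + 1).toNat = 0 by omega] at hp
      simp [hz p hp]
    · rw [show (n + 1).toNat = 0 by omega] at hq
      simp [hz q hq]
  · rw [not_or, not_lt, not_lt] at hmn
    obtain ⟨hm, hn⟩ := hmn
    lift m to ℕ using hm
    lift n to ℕ using hn
    have h : ∀ (k : ℕ) (p : ℂ[X]), p.degree < ((k : ℤ) + 1).toNat ↔ p.natDegree ≤ k := fun k p => by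
      rw [show ((k : ℤ) + 1).toNat = k + 1 by omega]
      by_cases hp : p = 0
      · simp [hp]
      · rw [← natDegree_lt_iff_degree_lt hp, Nat.lt_succ_iff]
    rw [globalSpace_eq_span, bidegreeSpace]
    simp only [h]

/-- The dimension of `H¹(ℐ_Z(m, n))` as a codimension in the ring of functions on a plane. -/
lemma finrank_H1 {Z : surface.IdealSheafData} {c c' : ℂ}
    (hZ : (Z.support : Set surface) ⊆ plane c c') {m n : ℤ} (hm : -1 ≤ m) (hn : -1 ≤ n) :
    Module.finrank ℂ (H1 Z m n) = Module.finrank ℂ (Γ(surface, plane c c') ⧸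
      ((van Z (plane c c')).restrictScalars ℂ ⊔
        bidegreeSpace ℂ (coord₁ c c') (coord₂ c c') (m + 1).toNat (n + 1).toNat)) := by
  rw [(cohomologyEquiv hm hn hZ).finrank_eq]
  exact finrank_quotient_congr (by rw [globalSpace_eq_bidegreeSpace hm hn])

lemma finite_H1 {Z : surface.IdealSheafData} (hfin : IsFiniteSubscheme Z) {c c' : ℂ}
    (hZ : (Z.support : Set surface) ⊆ plane c c') {m n : ℤ} (hm : -1 ≤ m) (hn : -1 ≤ n) :
    Module.Finite ℂ (H1 Z m n) := by
  have h1 := finite_quotient (U := ⟨plane c c', isAffineOpen_plane c c'⟩) hfin hZ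
  rw [← van_eq] at h1
  have h2 := finite_quotient_sup_strip (K := ℂ) (van Z (plane c c')) (globalSpace m n c c')
  exact Module.Finite.equiv (cohomologyEquiv hm hn hZ).symm

open Polynomial

/-! ### Curves of bidegree `(k, 0)` and `(0, k)` as zero schemes of binary forms -/

/-- An ideal sheaf is determined on an affine open set by its values on a cover. -/
lemma ideal_eq_of_cover {C : surface.IdealSheafData} {V : surface.affineOpens} {ι : Type*}
    (W : ι → surface.affineOpens) (hW : ∀ i, (W i).1 ≤ V.1) (hc : ∀ y ∈ V.1, ∃ i, y ∈ (W i).1)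
    {I : Ideal Γ(surface, V.1)}
    (h : ∀ i, C.ideal (W i) = I.map (res (hW i)).toRingHom) : C.ideal V = I := by
  rw [← closureOf_ideal_self V I]
  ext f
  rw [← van_eq, ← van_eq, mem_van_iff_of_cover (fun i => (W i).1) hW fun y _ hy => hc y hy,
    mem_van_iff_of_cover (fun i => (W i).1) hW fun y _ hy => hc y hy]
  refine forall_congr' fun i => ?_
  rw [van_eq, van_eq, h, ← map_res_ideal _ (hW i), closureOf_ideal_self]

lemma isAffineOpen_inter_chart (V : surface.affineOpens) (d : Fin 2 × Fin 2) :
    IsAffineOpen (V.1 ⊓ chart d) := V.2.inf (isAffineOpen_chart d)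

/-- One of the two projections of the quadric, with the description of the curves that are unions
of its fibres. It serves to treat the two rulings simultaneously. -/
structure Ruling where
  /-- The projection. -/
  proj : surface ⟶ line
  proj_comp : proj ≫ lineToSpec = toSpec
  /-- The bidegree of the fibres. -/
  bidegree : ℤ × ℤ
  /-- The homogeneous coordinate of the base that is invertible on a chart. -/
  index : Fin 2 × Fin 2 → Fin 2
  chart_le : ∀ c, chart c ≤ proj ⁻¹ᵁ lineOpen (coord (index c)).1
  isCurve_iff : ∀ (k : ℕ) (C : surface.IdealSheafData),
    IsCurve (k * bidegree.1) (k * bidegree.2) C ↔ ∃ F : grading k, F ≠ 0 ∧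
      ∀ (c : Fin 2 × Fin 2) (W : surface.affineOpens) (hW : W.1 ≤ chart c), C.ideal W =
        Ideal.span {frc proj proj_comp (coord (index c)) k (hW.trans (chart_le c)) F}
  exists_retraction : ∀ c : ℂ, ∃ (V : surface.affineOpens) (hV : V.1 ≤ proj ⁻¹ᵁ cell c)
    (ρ : Γ(surface, V.1) →ₐ[ℂ] ℂ[X]), ρ (pull proj proj_comp hV (affCoord c)) = X

namespace Ruling

variable (r : Ruling)

/-- The affine coordinate of the base, as a function on the surface. -/
def affine {c : ℂ} {V : surface.Opens} (hV : V ≤ r.proj ⁻¹ᵁ cell c) : Γ(surface, V) :=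
  pull r.proj r.proj_comp hV (affCoord c)

/-- `C` is the pull-back of the zero scheme of the form `F`. -/
def IsZeroScheme {k : ℕ} (F : grading k) (C : surface.IdealSheafData) : Prop :=
  ∀ (c : Fin 2 × Fin 2) (W : surface.affineOpens) (hW : W.1 ≤ chart c), C.ideal W =
    Ideal.span {frc r.proj r.proj_comp (coord (r.index c)) k (hW.trans (r.chart_le c)) F}

lemma isCurve_iff_exists (k : ℕ) (C : surface.IdealSheafData) :
    IsCurve (k * r.bidegree.1) (k * r.bidegree.2) C ↔
      ∃ F : grading k, F ≠ 0 ∧ r.IsZeroScheme F C := r.isCurve_iff k C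

variable {r}

/-- The ideal generated by a form does not depend on the trivialisation. -/
lemma span_frc_eq {k : ℕ} (F : grading k) (f g : grading 1) {V : surface.Opens}
    (hf : V ≤ r.proj ⁻¹ᵁ lineOpen f.1) (hg : V ≤ r.proj ⁻¹ᵁ lineOpen g.1) :
    Ideal.span {frc r.proj r.proj_comp f k hf F} = Ideal.span {frc r.proj r.proj_comp g k hg F} := by
  rw [frc_change r.proj r.proj_comp f g k hf hg]
  exact Ideal.span_singleton_mul_right_unit
    ((quot r.proj r.proj_comp g f hg hf).isUnit.pow k) _

lemma map_res_span_frc {k : ℕ} (F : grading k) (f : grading 1) {V W : surface.Opens}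
    (hf : V ≤ r.proj ⁻¹ᵁ lineOpen f.1) (h : W ≤ V) :
    (Ideal.span {frc r.proj r.proj_comp f k hf F}).map (res h).toRingHom =
      Ideal.span {frc r.proj r.proj_comp f k (h.trans hf) F} := by
  rw [Ideal.map_span, Set.image_singleton]
  exact congrArg (fun x => Ideal.span {x}) (res_frc r.proj r.proj_comp f k hf h F)

lemma IsZeroScheme.ideal_eq {k : ℕ} {F : grading k} {C : surface.IdealSheafData}
    (h : r.IsZeroScheme F C) (f : grading 1) (V : surface.affineOpens)
    (hV : V.1 ≤ r.proj ⁻¹ᵁ lineOpen f.1) :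
    C.ideal V = Ideal.span {frc r.proj r.proj_comp f k hV F} := by
  refine ideal_eq_of_cover (fun d => ⟨_, isAffineOpen_inter_chart V d⟩) (fun d => inf_le_left)
    (fun y hy => (exists_mem_chart y).imp fun d hd => ⟨hy, hd⟩) fun d => ?_
  rw [h d ⟨_, isAffineOpen_inter_chart V d⟩ inf_le_right, map_res_span_frc]
  exact span_frc_eq _ _ _ _ _

lemma IsZeroScheme.ideal_eq_span {k : ℕ} {F : grading k} {C : surface.IdealSheafData}
    (h : r.IsZeroScheme F C) {c : ℂ} (V : surface.affineOpens) (hV : V.1 ≤ r.proj ⁻¹ᵁ cell c) :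
    C.ideal V = Ideal.span {aeval (r.affine hV) (dehom c F.1)} := by
  rw [h.ideal_eq (linForm c) V hV, frc_linForm, affine]

lemma exists_isZeroScheme {k : ℕ} (F : grading k) : ∃ C, r.IsZeroScheme F C := by
  let U : Fin 2 × Fin 2 → surface.affineOpens := fun d => ⟨chart d, isAffineOpen_chart d⟩
  let I : ∀ d, Ideal Γ(surface, (U d).1) := fun d =>
    Ideal.span {frc r.proj r.proj_comp (coord (r.index d)) k (r.chart_le d) F}
  refine ⟨⨅ d, closureOf (U d) (I d), fun c W hW => ?_⟩
  rw [Scheme.IdealSheafData.ideal_iInf, iInf_apply]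
  apply le_antisymm
  · refine (iInf_le _ c).trans fun f hf => ?_
    have h1 := (mem_closureOf_ideal_iff W (inf_eq_left.2 hW).symm).1 hf
    rwa [map_res_span_frc, res_self] at h1
  · rw [le_iInf_iff]
    intro d
    rw [Ideal.span_le, Set.singleton_subset_iff, SetLike.mem_coe,
      mem_closureOf_ideal_iff ⟨_, isAffineOpen_inter_chart W d⟩ rfl, map_res_span_frc, res_frc,
      span_frc_eq F _ (coord (r.index c)) _ (inf_le_left.trans (hW.trans (r.chart_le c)))]
    exact Ideal.mem_span_singleton_self _

lemma iSup_chart : ⨆ d, chart d = ⊤ := by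
  rw [eq_top_iff]
  intro y _
  exact Opens.mem_iSup.2 (exists_mem_chart y)

lemma le_of_forall_chart {A B : surface.IdealSheafData}
    (h : ∀ c, A.ideal ⟨chart c, isAffineOpen_chart c⟩ ≤ B.ideal ⟨chart c, isAffineOpen_chart c⟩) :
    A ≤ B :=
  Scheme.IdealSheafData.le_of_iSup_eq_top (fun c => ⟨chart c, isAffineOpen_chart c⟩) iSup_chart h

lemma IsZeroScheme.unique {k : ℕ} {F : grading k} {C C' : surface.IdealSheafData}
    (h : r.IsZeroScheme F C) (h' : r.IsZeroScheme F C') : C = C' :=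
  le_antisymm
    (le_of_forall_chart fun c => (h c _ le_rfl).le.trans (h' c _ le_rfl).ge)
    (le_of_forall_chart fun c => (h' c _ le_rfl).le.trans (h c _ le_rfl).ge)

lemma IsZeroScheme.smul {k : ℕ} {F : grading k} {C : surface.IdealSheafData}
    (h : r.IsZeroScheme F C) {b : ℂ} (hb : b ≠ 0) : r.IsZeroScheme (b • F) C := fun c W hW => by
  rw [h c W hW, map_smul, Algebra.smul_def]
  exact (Ideal.span_singleton_mul_left_unit ((IsUnit.mk0 b hb).map (algebraMap ℂ _)) _).symm

lemma frc_pow_mul {e j k : ℕ} (hk : e + j = k) {F : grading k} {G : grading 1} {H : grading j}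
    (hF : F.1 = G.1 ^ e * H.1) (f : grading 1) {V : surface.Opens}
    (hV : V ≤ r.proj ⁻¹ᵁ lineOpen f.1) :
    frc r.proj r.proj_comp f k hV F = frc r.proj r.proj_comp f 1 hV G ^ e *
      frc r.proj r.proj_comp f j hV H := by
  induction e generalizing k F with
  | zero =>
    obtain rfl : j = k := by omega
    obtain rfl : F = H := Subtype.ext (by simpa using hF)
    simp
  | succ e ih =>
    obtain rfl : k = 1 + (e + j) := by omega
    have hGH : G.1 ^ e * H.1 ∈ grading (e + j) := by
      have h1 := SetLike.pow_mem_graded (A := grading) e G.2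
      rw [smul_eq_mul, mul_one] at h1
      exact SetLike.mul_mem_graded h1 H.2
    rw [pow_succ', mul_assoc, ← ih rfl (F := ⟨_, hGH⟩) rfl, frc_mul_frc]
    congr 1
    exact Subtype.ext (by rw [hF, pow_succ', mul_assoc])

lemma exists_natDegree_dehom_eq_one {G : grading 1} (hG : G ≠ 0) :
    ∃ c, (dehom c G.1).natDegree = 1 := by
  by_contra! h
  have h1 : ∀ c, (dehom c G.1).coeff 1 = 0 := fun c => by
    refine coeff_eq_zero_of_natDegree_lt ?_
    have := natDegree_dehom_le c G.2
    have := h c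
    omega
  have h0 := natDegree_dehom_le 0 G.2
  set p := dehom 0 G.1 with hp
  have hGp : G = homog 0 1 p := sub_eq_zero.1 (dehom_injective 0 (by
    rw [Submodule.coe_sub, map_sub, dehom_homog 0 h0, hp, sub_self]))
  have h2 : ∀ c, p.coeff 1 - p.coeff 0 * c = 0 := fun c => by
    rw [← h1 c, hGp, homog, Fin.sum_univ_two]
    simp [coe_linForm, dehom, sub_eq_neg_add, coeff_one]
  have hp1 : p.coeff 1 = 0 := by simpa using h2 0
  have hp0 : p.coeff 0 = 0 := by simpa [hp1] using h2 1
  refine hG (dehom_injective 0 (hp.symm.trans ?_))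
  rw [eq_X_add_C_of_natDegree_le_one h0, hp1, hp0]
  simp

/-- Multiples of a line in a union of fibres correspond to linear factors of the equation. -/
lemma IsZeroScheme.le_pow_iff {k : ℕ} {F : grading k} (hF : F ≠ 0) {G : grading 1} (hG : G ≠ 0)
    {C D : surface.IdealSheafData} (hC : r.IsZeroScheme F C) (hD : r.IsZeroScheme G D) (e : ℕ) :
    C ≤ D ^ e ↔ ∃ (j : ℕ) (H : grading j), e + j = k ∧ F.1 = G.1 ^ e * H.1 := by
  constructor
  · intro h
    obtain ⟨c, hc⟩ := exists_natDegree_dehom_eq_one hG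
    obtain ⟨V, hV, ρ, hρ⟩ := r.exists_retraction c
    have h1 := h V
    rw [Scheme.IdealSheafData.ideal_pow, Pi.pow_apply, hC.ideal_eq_span V hV,
      hD.ideal_eq_span V hV, Ideal.span_singleton_pow, Ideal.span_singleton_le_span_singleton] at h1
    have h2 := map_dvd ρ h1
    rw [map_pow, ← aeval_algHom_apply, ← aeval_algHom_apply, affine, hρ, aeval_X_left_apply,
      aeval_X_left_apply] at h2
    obtain ⟨p, hp⟩ := h2
    have hF0 : dehom c F.1 ≠ 0 := fun h0 => hF (dehom_injective c h0)
    have hp0 : p ≠ 0 := fun h0 => hF0 (by rw [hp, h0, mul_zero])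
    have hG0 : dehom c G.1 ≠ 0 := fun h0 => hG (dehom_injective c h0)
    have hdeg : (dehom c F.1).natDegree = e + p.natDegree := by
      rw [hp, natDegree_mul (pow_ne_zero _ hG0) hp0, natDegree_pow, hc, mul_one]
    have hk := natDegree_dehom_le c F.2
    have hek : e + (k - e) = k := by omega
    have hmem : G.1 ^ e * (homog c (k - e) p).1 ∈ grading k := by
      have h1 := SetLike.pow_mem_graded (A := grading) e G.2
      rw [smul_eq_mul, mul_one] at h1
      have h2 := SetLike.mul_mem_graded h1 (homog c (k - e) p).2
      rwa [hek] at h2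
    refine ⟨k - e, homog c (k - e) p, hek, ?_⟩
    have h3 : F - ⟨_, hmem⟩ = 0 := dehom_injective c (by
      rw [Submodule.coe_sub, map_sub, map_mul, map_pow, dehom_homog c (by omega), ← hp, sub_self])
    exact congrArg Subtype.val (sub_eq_zero.1 h3)
  · rintro ⟨j, H, hk, hFH⟩
    refine le_of_forall_chart fun c => ?_
    rw [Scheme.IdealSheafData.ideal_pow, Pi.pow_apply, hC c _ le_rfl, hD c _ le_rfl,
      Ideal.span_singleton_pow, Ideal.span_singleton_le_span_singleton, frc_pow_mul hk hFH]
    exact dvd_mul_right _ _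

end Ruling

namespace Ruling

variable {r : Ruling}

/-! ### The minimal curve of a finite subscheme -/

variable (r) in
/-- The fibre over the point with affine coordinate `a` in `cell c`. -/
def fiber (c a : ℂ) : surface.IdealSheafData :=
  (exists_isZeroScheme (r := r) (homog c 1 (X - C a))).choose

lemma dehom_homog_sub (c a : ℂ) : dehom c (homog c 1 (X - C a)).1 = X - C a :=
  dehom_homog c (natDegree_X_sub_C_le a)

lemma homog_ne_zero {c : ℂ} {k : ℕ} {p : ℂ[X]} (hp : p ≠ 0) (hk : p.natDegree ≤ k) :
    homog c k p ≠ 0 := fun h => hp (by rw [← dehom_homog c hk, h, Submodule.coe_zero, map_zero])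

lemma eq_homog_dehom {c : ℂ} {k : ℕ} (F : grading k) : F = homog c k (dehom c F.1) :=
  sub_eq_zero.1 (dehom_injective c (by
    rw [Submodule.coe_sub, map_sub, dehom_homog c (natDegree_dehom_le c F.2), sub_self]))

lemma eq_smul_homog {c : ℂ} {k : ℕ} {F : grading k} {g : ℂ[X]} (hg : g.Monic)
    (h : g ∣ dehom c F.1) (hk : k ≤ g.natDegree) (hk' : g.natDegree ≤ k) :
    F = (dehom c F.1).leadingCoeff • homog c k g := by
  refine sub_eq_zero.1 (dehom_injective c ?_)
  rw [Submodule.coe_sub, map_sub, Submodule.coe_smul, map_smul, dehom_homog c hk', smul_eq_C_mul,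
    ← eq_leadingCoeff_mul_of_monic_of_dvd_of_natDegree_le hg h
      ((natDegree_dehom_le c F.2).trans hk), sub_self]

lemma isZeroScheme_fiber (c a : ℂ) : r.IsZeroScheme (homog c 1 (X - C a)) (r.fiber c a) :=
  (exists_isZeroScheme _).choose_spec

lemma homog_sub_ne_zero (c a : ℂ) : homog c 1 (X - C a) ≠ 0 :=
  homog_ne_zero (X_sub_C_ne_zero a) (natDegree_X_sub_C_le a)

lemma isCurve_bidegree_iff {D : surface.IdealSheafData} :
    IsCurve r.bidegree.1 r.bidegree.2 D ↔ ∃ G : grading 1, G ≠ 0 ∧ r.IsZeroScheme G D := by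
  rw [← r.isCurve_iff_exists 1 D, Nat.cast_one, one_mul, one_mul]

lemma isCurve_fiber (c a : ℂ) : IsCurve r.bidegree.1 r.bidegree.2 (r.fiber c a) :=
  isCurve_bidegree_iff.2 ⟨_, homog_sub_ne_zero c a, isZeroScheme_fiber c a⟩

lemma fiber_ideal {c : ℂ} (a : ℂ) (V : surface.affineOpens) (hV : V.1 ≤ r.proj ⁻¹ᵁ cell c) :
    (r.fiber c a).ideal V = Ideal.span {r.affine hV - algebraMap ℂ _ a} := by
  rw [(isZeroScheme_fiber c a).ideal_eq_span V hV, dehom_homog_sub, map_sub, aeval_X, aeval_C]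

lemma fiber_injective (c : ℂ) : Function.Injective (r.fiber c) := by
  intro a b hab
  obtain ⟨V, hV, ρ, hρ⟩ := r.exists_retraction c
  have h1 := fiber_ideal (r := r) a V hV
  rw [hab, fiber_ideal b V hV] at h1
  have h2 := map_dvd ρ (Ideal.span_singleton_le_span_singleton.1 h1.le)
  rw [map_sub, map_sub, affine, hρ, AlgHom.commutes, AlgHom.commutes] at h2
  have h3 := dvd_iff_isRoot.1 h2
  simpa [sub_eq_zero] using h3

section

variable {Z : surface.IdealSheafData} {U : surface.affineOpens} {c : ℂ}
  {hU : U.1 ≤ r.proj ⁻¹ᵁ cell c} {g : ℂ[X]}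

lemma IsZeroScheme.le_iff (hZ : (Z.support : Set surface) ⊆ U.1)
    (hgZ : ∀ p, aeval (r.affine hU) p ∈ Z.ideal U ↔ g ∣ p) {k : ℕ} {F : grading k}
    {C : surface.IdealSheafData} (hC : r.IsZeroScheme F C) : C ≤ Z ↔ g ∣ dehom c F.1 := by
  rw [le_iff_ideal_le hZ, hC.ideal_eq_span U hU, Ideal.span_le, Set.singleton_subset_iff,
    SetLike.mem_coe, hgZ]

/-- The smallest degree of a union of fibres that contains `Z` is the degree of the generator `g`
of the polynomials in the affine coordinate that vanish on `Z`. -/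
lemma minDegree_eq (hZ : (Z.support : Set surface) ⊆ U.1) (hg : g.Monic)
    (hgZ : ∀ p, aeval (r.affine hU) p ∈ Z.ideal U ↔ g ∣ p) :
    minDegree r.bidegree Z = g.natDegree := by
  rw [minDegree, ← csInf_Ici (a := g.natDegree)]
  congr 1
  ext k
  simp only [Set.mem_ofPred_eq, Set.mem_Ici, isCurve_iff_exists]
  constructor
  · rintro ⟨C, ⟨F, hF, hC⟩, hCZ⟩
    rw [hC.le_iff hZ hgZ] at hCZ
    exact (natDegree_le_of_dvd hCZ fun h => hF (dehom_injective c h)).trans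
      (natDegree_dehom_le c F.2)
  · intro hk
    obtain ⟨C, hC⟩ := exists_isZeroScheme (r := r) (homog c k g)
    refine ⟨C, ⟨_, homog_ne_zero hg.ne_zero hk, hC⟩, ?_⟩
    rw [hC.le_iff hZ hgZ, dehom_homog c hk]

lemma isZeroScheme_minCurve (hZ : (Z.support : Set surface) ⊆ U.1) (hg : g.Monic)
    (hgZ : ∀ p, aeval (r.affine hU) p ∈ Z.ideal U ↔ g ∣ p) :
    r.IsZeroScheme (homog c g.natDegree g) (minCurve r.bidegree Z) := by
  have hex : ∃ C, IsCurve (minDegree r.bidegree Z * r.bidegree.1)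
      (minDegree r.bidegree Z * r.bidegree.2) C ∧ C ≤ Z := by
    obtain ⟨C, hC⟩ := exists_isZeroScheme (r := r) (homog c g.natDegree g)
    rw [minDegree_eq hZ hg hgZ]
    refine ⟨C, (r.isCurve_iff_exists _ _).2 ⟨_, homog_ne_zero hg.ne_zero le_rfl, hC⟩, ?_⟩
    rw [hC.le_iff hZ hgZ, dehom_homog c le_rfl]
  obtain ⟨h1, h2⟩ := Classical.epsilon_spec hex
  change IsCurve _ _ (minCurve r.bidegree Z) at h1
  change minCurve r.bidegree Z ≤ Z at h2
  rw [minDegree_eq hZ hg hgZ, isCurve_iff_exists] at h1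
  obtain ⟨F, hF, hC⟩ := h1
  rw [hC.le_iff hZ hgZ] at h2
  have hF0 : dehom c F.1 ≠ 0 := fun h => hF (dehom_injective c h)
  have hb : (dehom c F.1).leadingCoeff ≠ 0 := leadingCoeff_ne_zero.2 hF0
  rw [← inv_smul_smul₀ hb (homog c g.natDegree g), ← eq_smul_homog hg h2 le_rfl le_rfl]
  exact hC.smul (inv_ne_zero hb)

lemma minCurve_le_pow_iff (hZ : (Z.support : Set surface) ⊆ U.1) (hg : g.Monic)
    (hgZ : ∀ p, aeval (r.affine hU) p ∈ Z.ideal U ↔ g ∣ p) (a : ℂ) (e : ℕ) :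
    minCurve r.bidegree Z ≤ r.fiber c a ^ e ↔ (X - C a) ^ e ∣ g := by
  rw [(isZeroScheme_minCurve hZ hg hgZ).le_pow_iff (homog_ne_zero hg.ne_zero le_rfl)
    (homog_sub_ne_zero c a) (isZeroScheme_fiber c a)]
  constructor
  · rintro ⟨j, H, -, h⟩
    have h1 := congrArg (dehom c) h
    rw [map_mul, map_pow, dehom_homog c le_rfl, dehom_homog_sub] at h1
    exact ⟨_, h1⟩
  · rintro ⟨p, hp⟩
    have hp0 : p ≠ 0 := by
      rintro rfl
      exact hg.ne_zero (by rw [hp, mul_zero])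
    have hdeg : g.natDegree = e + p.natDegree := by
      conv_lhs => rw [hp]
      rw [natDegree_mul (pow_ne_zero _ (X_sub_C_ne_zero a)) hp0, natDegree_pow, natDegree_X_sub_C,
        mul_one]
    refine ⟨p.natDegree, homog c p.natDegree p, hdeg.symm, ?_⟩
    have hmem : (homog c 1 (X - C a)).1 ^ e * (homog c p.natDegree p).1 ∈ grading g.natDegree := by
      have h1 := SetLike.pow_mem_graded (A := grading) e (homog c 1 (X - C a)).2
      rw [smul_eq_mul, mul_one] at h1
      rw [hdeg]
      exact SetLike.mul_mem_graded h1 (homog c _ p).2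
    have h1 : homog c g.natDegree g = ⟨_, hmem⟩ := by
      rw [eq_homog_dehom (c := c) ⟨_, hmem⟩, map_mul, map_pow, dehom_homog_sub, dehom_homog c le_rfl,
        ← hp]
    exact congrArg Subtype.val h1

lemma multiplicity_eq (hZ : (Z.support : Set surface) ⊆ U.1) (hg : g.Monic)
    (hgZ : ∀ p, aeval (r.affine hU) p ∈ Z.ideal U ↔ g ∣ p) (a : ℂ) :
    multiplicity r.bidegree Z (r.fiber c a) = g.rootMultiplicity a := by
  rw [multiplicity, ← csSup_Iic (a := g.rootMultiplicity a)]
  congr 1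
  ext e
  simp only [Set.mem_ofPred_eq, Set.mem_Iic, minCurve_le_pow_iff hZ hg hgZ,
    le_rootMultiplicity_iff hg.ne_zero]

/-- The lines in the minimal curve are the fibres over the roots of `g`. -/
lemma minLines_eq (hZ : (Z.support : Set surface) ⊆ U.1) (hg : g.Monic)
    (hgZ : ∀ p, aeval (r.affine hU) p ∈ Z.ideal U ↔ g ∣ p) :
    minLines r.bidegree Z = r.fiber c '' (g.roots.toFinset : Set ℂ) := by
  ext D
  simp only [minLines, Set.mem_ofPred_eq, Set.mem_image, Finset.mem_coe, Multiset.mem_toFinset,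
    mem_roots hg.ne_zero, ← dvd_iff_isRoot]
  constructor
  · rintro ⟨hD, hle⟩
    obtain ⟨G, hG, hD⟩ := isCurve_bidegree_iff.1 hD
    rw [← pow_one D, (isZeroScheme_minCurve hZ hg hgZ).le_pow_iff (homog_ne_zero hg.ne_zero le_rfl)
      hG hD] at hle
    obtain ⟨j, H, hj, h⟩ := hle
    have h1 := congrArg (dehom c) h
    rw [pow_one, map_mul, dehom_homog c le_rfl] at h1
    have hG1 : (dehom c G.1).natDegree = 1 := by
      have h2 := natDegree_mul_le (p := dehom c G.1) (q := dehom c H.1)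
      rw [← h1] at h2
      have h3 := natDegree_dehom_le c G.2
      have h4 := natDegree_dehom_le c H.2
      omega
    have hG0 : dehom c G.1 ≠ 0 := fun h => hG (dehom_injective c h)
    obtain ⟨a, ha⟩ := exists_root_of_degree_eq_one (by
      rw [degree_eq_natDegree hG0, hG1, Nat.cast_one])
    have hb : (dehom c G.1).leadingCoeff ≠ 0 := leadingCoeff_ne_zero.2 hG0
    refine ⟨a, (dvd_iff_isRoot.2 ha).trans ⟨_, h1⟩, ?_⟩
    refine IsZeroScheme.unique ?_ hD
    rw [eq_smul_homog (monic_X_sub_C a) (dvd_iff_isRoot.2 ha) (natDegree_X_sub_C a).ge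
      (natDegree_X_sub_C_le a)]
    exact (isZeroScheme_fiber c a).smul hb
  · rintro ⟨a, ha, rfl⟩
    refine ⟨isCurve_fiber c a, ?_⟩
    rw [← pow_one (r.fiber c a), minCurve_le_pow_iff hZ hg hgZ, pow_one]
    exact ha

end

end Ruling

/-! ### The part of a finite subscheme that is concentrated on a fibre -/

lemma finite_subscheme {Z : surface.IdealSheafData} (hfin : IsFiniteSubscheme Z) :
    Finite Z.subscheme := by
  have h1 := (finite_support hfin).preimage (f := Z.subschemeι)
    (Z.subschemeι.isClosedEmbedding.injective.injOn)
  have h2 : Z.subschemeι ⁻¹' (Z.support : Set surface) = Set.univ :=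
    Set.eq_univ_of_forall fun y => subschemeι_mem_support Z y
  rw [h2] at h1
  exact Set.finite_univ_iff.1 h1

section

variable {Z D : surface.IdealSheafData} {U : surface.affineOpens} {w s : Γ(surface, U.1)} {e : ℕ}

lemma preimage_support_eq (hZ : (Z.support : Set surface) ⊆ U.1) (hD : D.ideal U = Ideal.span {w})
    (hws : w ^ e * s ∈ Z.ideal U) (hcop : IsCoprime w s) :
    Z.subschemeι ⁻¹' (D.support : Set surface) =
      (Z.subschemeι ⁻¹ᵁ surface.basicOpen s : Set Z.subscheme) := by
  ext y
  have hyU : Z.subschemeι y ∈ U.1 := hZ (subschemeι_mem_support Z y)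
  change Z.subschemeι y ∈ D.support ↔ Z.subschemeι y ∈ surface.basicOpen s
  rw [Scheme.IdealSheafData.mem_support_iff_of_mem hyU, hD, Scheme.mem_zeroLocus_iff]
  constructor
  · intro h
    obtain ⟨a, b, hab⟩ := hcop
    have h1 : Z.subschemeι y ∈ surface.basicOpen (a * w + b * s) := by
      rw [hab, Scheme.basicOpen_one]
      exact hyU
    rcases surface.basicOpen_add_le _ _ h1 with h2 | h2
    · rw [SetLike.mem_coe, Scheme.basicOpen_mul] at h2
      exact absurd h2.2 (h w (Ideal.mem_span_singleton_self w))
    · rw [SetLike.mem_coe, Scheme.basicOpen_mul] at h2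
      exact h2.2
  · intro h f hf hy
    obtain ⟨a, rfl⟩ := Ideal.mem_span_singleton.1 hf
    rw [Scheme.basicOpen_mul] at hy
    have h1 : Z.subschemeι y ∈ surface.basicOpen (w ^ (e + 1) * s) := by
      rw [Scheme.basicOpen_mul, surface.basicOpen_pow w (Nat.succ_pos e)]
      exact ⟨hy.1, h⟩
    have h2 : (Z.subschemeι.app U.1).hom (w ^ (e + 1) * s) = 0 := by
      rw [pow_succ', mul_assoc]
      have h3 : w * (w ^ e * s) ∈ van Z U.1 := by
        rw [van_eq]
        exact (Z.ideal U).mul_mem_left _ hws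
      exact h3
    have h4 : y ∈ Z.subschemeι ⁻¹ᵁ surface.basicOpen (w ^ (e + 1) * s) := h1
    rw [Scheme.Hom.preimage_basicOpen] at h4
    have h5 := (congrArg (fun x => y ∈ Z.subscheme.basicOpen x) h2).mp h4
    rw [Scheme.basicOpen_zero] at h5
    exact h5

/-- If `w ^ e * s` vanishes on `Z` and `w`, `s` are coprime, then the part of `Z` on the
locus `w = 0` is the one where `s` is invertible, and it is given by the additional equation
`w ^ e`. -/
lemma concentratedOn_ideal (hfin : IsFiniteSubscheme Z) (hZ : (Z.support : Set surface) ⊆ U.1)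
    (hD : D.ideal U = Ideal.span {w}) (hws : w ^ e * s ∈ Z.ideal U) (hcop : IsCoprime w s) :
    (concentratedOn Z D).ideal U = Z.ideal U ⊔ Ideal.span {w ^ e} := by
  set O : Z.subscheme.Opens := Opens.interior (Z.subschemeι ⁻¹' (D.support : Set surface)) with hO
  have hOs : O = Z.subschemeι ⁻¹ᵁ surface.basicOpen s := by
    rw [hO, preimage_support_eq hZ hD hws hcop]
    exact Opens.ext (Opens.isOpen _).interior_eq
  rw [Scheme.Hom.preimage_basicOpen] at hOs
  have := finite_subscheme hfin
  have hfinO := Finite.of_injective O.ι O.ι.isOpenEmbedding.injective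
  have hq : QuasiCompact (O.ι ≫ Z.subschemeι) :=
    ⟨fun V _ _ => (Set.toFinite (O.ι ⁻¹' (Z.subschemeι ⁻¹' V))).isCompact⟩
  set g := Z.subschemeι with hg
  set s' := (g.app U.1).hom s with hs'
  have hker : ∀ f, f ∈ kerApp (O.ι ≫ g) U.1 ↔
      (Z.subscheme.presheaf.map (homOfLE (Z.subscheme.basicOpen_le s')).op).hom
        ((g.app U.1).hom f) = 0 := by
    intro f
    have hPB : O.ι ''ᵁ (O.ι ⁻¹ᵁ (g ⁻¹ᵁ U.1)) = Z.subscheme.basicOpen s' := by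
      rw [Scheme.Hom.image_preimage_eq_opensRange_inf, Scheme.Opens.opensRange_ι, hOs]
      exact inf_eq_left.2 (Z.subscheme.basicOpen_le s')
    have hmap : ∀ {P B : Z.subscheme.Opens} (hPB : P = B) (hP : P ≤ g ⁻¹ᵁ U.1) (hB : B ≤ g ⁻¹ᵁ U.1)
        (x : Γ(Z.subscheme, g ⁻¹ᵁ U.1)), (Z.subscheme.presheaf.map (homOfLE hP).op).hom x = 0 ↔
          (Z.subscheme.presheaf.map (homOfLE hB).op).hom x = 0 := by
      rintro P _ rfl _ _ _
      rfl
    rw [← hmap hPB (O.ι.image_preimage_eq_opensRange_inf _ ▸ inf_le_right), mem_kerApp,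
      Scheme.Hom.comp_app]
    rfl
  have hunit : IsUnit ((Z.subscheme.presheaf.map (homOfLE (Z.subscheme.basicOpen_le s')).op).hom s') :=
    RingedSpace.isUnit_res_basicOpen _ s'
  change Scheme.IdealSheafData.ideal (O.ι ≫ g).ker U = _
  rw [ker_ideal]
  apply le_antisymm
  · intro f hf
    obtain ⟨n, hn⟩ := exists_pow_mul_eq_zero_of_res_basicOpen_eq_zero_of_isCompact Z.subscheme
      (Set.toFinite _).isCompact _ s' ((hker f).1 hf)
    have h1 : s ^ n * f ∈ Z.ideal U := by
      rw [← van_eq]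
      change (g.app U.1).hom (s ^ n * f) = 0
      rw [map_mul, map_pow]
      exact hn
    obtain ⟨a, b, hab⟩ := hcop.pow (m := e) (n := n)
    have h2 : f = b * (s ^ n * f) + a * f * w ^ e := by
      linear_combination (-f) * hab
    rw [h2]
    exact Submodule.add_mem_sup ((Z.ideal U).mul_mem_left _ h1)
      (Ideal.mul_mem_left _ _ (Ideal.mem_span_singleton_self _))
  · have h0 : ∀ f ∈ Z.ideal U, (g.app U.1).hom f = 0 := fun f hf => by
      rw [← van_eq] at hf
      exact hf
    refine sup_le (fun f hf => ?_) ?_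
    · rw [hker, h0 f hf, map_zero]
    · rw [Ideal.span_le, Set.singleton_subset_iff, SetLike.mem_coe, hker, ← hunit.mul_left_eq_zero,
        hs', ← map_mul, ← map_mul, h0 _ hws, map_zero]

lemma le_concentratedOn (Z D : surface.IdealSheafData) : Z ≤ concentratedOn Z D := by
  have := (Scheme.Opens.ι (Opens.interior (Z.subschemeι ⁻¹' (D.support : Set surface)))).le_ker_comp
    Z.subschemeι
  rwa [Scheme.IdealSheafData.ker_subschemeι] at this

end

/-! ### Strings of lengths -/

/-- The string of a finite subscheme of a multiple line consists of residual lengths. -/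
lemma getD_rho {D : surface.IdealSheafData} {U : surface.affineOpens} {w : Γ(surface, U.1)}
    (hD : D.ideal U = Ideal.span {w}) {k j : ℕ} (hj : j < k) {Z : surface.IdealSheafData}
    (hZ : (Z.support : Set surface) ⊆ U.1) (hw : w ^ k ∈ Z.ideal U) :
    (rho D k Z).getD j 0 = residualLength ℂ w j (Z.ideal U) := by
  have hlen : length (Z ⊔ D) = residualLength ℂ w 0 (Z.ideal U) := by
    rw [length_eq (U := U) _ (support_subset_of_le le_sup_left hZ), Scheme.IdealSheafData.ideal_sup,
      Pi.sup_apply, hD]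
    rfl
  induction k generalizing Z j with
  | zero => omega
  | succ k ih =>
    cases k with
    | zero =>
      obtain rfl : j = 0 := by omega
      have h1 : Z ⊔ D = Z := by
        rw [sup_eq_left, le_iff_ideal_le hZ, hD, Ideal.span_le, Set.singleton_subset_iff]
        rwa [zero_add, pow_one] at hw
      rw [← hlen, h1]
      rfl
    | succ k =>
      cases j with
      | zero => exact hlen
      | succ j =>
        have h1 : (residual Z D).ideal U = (Z.ideal U).colon {w} := by
          rw [residual_ideal D hZ, hD]
          exact Submodule.colon_span
        have hZ' := support_subset_of_le (le_residual Z D) hZ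
        change (rho D (k + 1) (residual Z D)).getD j 0 = residualLength ℂ w j ((Z.ideal U).colon {w})
        rw [← h1]
        refine ih (by omega) hZ' ?_ ?_
        · rw [h1, Submodule.mem_colon_singleton, smul_eq_mul, ← pow_succ]
          exact hw
        · rw [length_eq (U := U) _ (support_subset_of_le le_sup_left hZ'),
            Scheme.IdealSheafData.ideal_sup, Pi.sup_apply, hD]
          rfl

/-! ### The two rulings -/

lemma isCurve_iff_isGlobalSection {m n : ℤ} {C : surface.IdealSheafData} :
    IsCurve m n C ↔ ∃ t, IsGlobalSection m n t ∧ t ≠ 0 ∧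
      ∀ (c : Fin 2 × Fin 2) (W : surface.affineOpens) (hW : W.1 ≤ chart c),
        C.ideal W = Ideal.span {res hW (t c)} := by
  constructor
  · rintro ⟨s, hs, hs0, hC⟩
    refine ⟨fun c => res (le_inf le_top le_rfl) (s c), fun c d => ?_, fun h => hs0 ?_,
      fun c W hW => ?_⟩
    · have := congrArg (res (le_inf le_top le_rfl : chart c ⊓ chart d ≤ ⊤ ⊓ (chart c ⊓ chart d)))
        (hs c d)
      rw [map_mul, res_res, res_res, res_res] at this
      rw [res_res, res_res]
      exact this
    · funext c
      refine res_injective_of_le (le_inf le_top le_rfl : chart c ≤ ⊤ ⊓ chart c) inf_le_right ?_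
      exact (congrFun h c).trans (map_zero _).symm
    · rw [hC c W hW, res_res]
  · rintro ⟨t, ht, ht0, hC⟩
    refine ⟨fun c => res inf_le_right (t c), fun c d => ?_, fun h => ht0 ?_, fun c W hW => ?_⟩
    · have := congrArg (res (inf_le_right : ⊤ ⊓ (chart c ⊓ chart d) ≤ chart c ⊓ chart d)) (ht c d)
      rw [map_mul, res_res, res_res, res_trans] at this
      rw [res_res, res_res]
      exact this
    · funext c
      refine res_injective_of_le (inf_le_right : ⊤ ⊓ chart c ≤ chart c) (le_inf le_top le_rfl) ?_
      exact (congrFun h c).trans (map_zero _).symm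
    · rw [hC c W hW, res_res]

lemma one_mem_grading_zero : (1 : MvPolynomial (Fin 2) ℂ) ∈ grading 0 := SetLike.GradedOne.one_mem

lemma frc_zero_one (q : surface ⟶ line) (hq : q ≫ lineToSpec = toSpec) (f : grading 1)
    {V : surface.Opens} (hV : V ≤ q ⁻¹ᵁ lineOpen f.1) :
    frc q hq f 0 hV ⟨1, one_mem_grading_zero⟩ = 1 := by
  rw [← map_one (pull q hq hV)]
  refine congrArg (pull q hq hV) (ev_injective fun x hx => ?_)
  rw [ev_lineFrac, map_one, pow_zero, div_one, map_one]

lemma monForm_zero (a : Fin 1) : monForm 0 a = ⟨1, one_mem_grading_zero⟩ :=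
  Subtype.ext (by simp [monForm])

lemma formSection_ne_zero {m n : ℕ} {F : grading m} {G : grading n}
    (h : aeval (coord₁ 0 0) (dehom 0 F.1) * aeval (coord₂ 0 0) (dehom 0 G.1) ≠ 0) :
    formSection F G ≠ 0 := fun h0 => h (eq_of_res_eq fun d => by
  rw [← twist_mul_res_formSection, h0, Pi.zero_apply, map_zero, map_zero, mul_zero])

/-- The fibres of the first projection. -/
def firstRuling : Ruling where
  proj := pr₁
  proj_comp := pr₁_lineToSpec
  bidegree := (1, 0)
  index := Prod.fst
  chart_le c := le_preimage₁ le_rfl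
  isCurve_iff k C := by
    rw [mul_one, mul_zero, isCurve_iff_isGlobalSection]
    constructor
    · rintro ⟨t, ht, ht0, hC⟩
      obtain ⟨φ, hφ⟩ := IsGlobalSection.exists_eq_sum (n := 0) ht
      have hF : ∀ c, t c = frc pr₁ pr₁_lineToSpec (coord c.1) k (le_preimage₁ le_rfl)
          (∑ e, φ e • monForm k e.1) := fun c => by
        rw [hφ c, map_sum]
        refine Finset.sum_congr rfl fun e _ => ?_
        rw [map_smul, formSection, monForm_zero, frc_zero_one, mul_one]
      refine ⟨∑ e, φ e • monForm k e.1, fun h => ht0 (funext fun c => ?_), fun c W hW => ?_⟩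
      · rw [hF c, h, map_zero]
        rfl
      · rw [hC c W hW, hF c, res_frc]
    · rintro ⟨F, hF, hC⟩
      refine ⟨formSection F ⟨1, one_mem_grading_zero⟩, isGlobalSection_formSection _ _,
        formSection_ne_zero fun h => hF (dehom_injective 0 ?_), fun c W hW => ?_⟩
      · obtain ⟨ρ, hρ⟩ := exists_retraction₁ 0 0
        rw [map_one, map_one, mul_one] at h
        have := congrArg ρ h
        rwa [← aeval_algHom_apply, hρ, aeval_X_left_apply, map_zero] at this
      · rw [hC c W hW, formSection, frc_zero_one, mul_one, res_frc]
  exists_retraction c := by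
    obtain ⟨ρ, hρ⟩ := exists_retraction₁ c 0
    exact ⟨⟨plane c 0, isAffineOpen_plane c 0⟩, inf_le_left, ρ, hρ⟩

/-- The fibres of the second projection. -/
def secondRuling : Ruling where
  proj := pr₂
  proj_comp := pr₂_lineToSpec
  bidegree := (0, 1)
  index := Prod.snd
  chart_le c := le_preimage₂ le_rfl
  isCurve_iff k C := by
    rw [mul_one, mul_zero, isCurve_iff_isGlobalSection]
    constructor
    · rintro ⟨t, ht, ht0, hC⟩
      obtain ⟨φ, hφ⟩ := IsGlobalSection.exists_eq_sum (m := 0) ht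
      have hF : ∀ c, t c = frc pr₂ pr₂_lineToSpec (coord c.2) k (le_preimage₂ le_rfl)
          (∑ e, φ e • monForm k e.2) := fun c => by
        rw [hφ c, map_sum]
        refine Finset.sum_congr rfl fun e _ => ?_
        rw [map_smul, formSection, monForm_zero, frc_zero_one, one_mul]
      refine ⟨∑ e, φ e • monForm k e.2, fun h => ht0 (funext fun c => ?_), fun c W hW => ?_⟩
      · rw [hF c, h, map_zero]
        rfl
      · rw [hC c W hW, hF c, res_frc]
    · rintro ⟨F, hF, hC⟩
      refine ⟨formSection ⟨1, one_mem_grading_zero⟩ F, isGlobalSection_formSection _ _,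
        formSection_ne_zero fun h => hF (dehom_injective 0 ?_), fun c W hW => ?_⟩
      · obtain ⟨ρ, hρ⟩ := exists_retraction₂ 0 0
        rw [map_one, map_one, one_mul] at h
        have := congrArg ρ h
        rwa [← aeval_algHom_apply, hρ, aeval_X_left_apply, map_zero] at this
      · rw [hC c W hW, formSection, frc_zero_one, one_mul, res_frc]
  exists_retraction c := by
    obtain ⟨ρ, hρ⟩ := exists_retraction₂ 0 c
    exact ⟨⟨plane 0 c, isAffineOpen_plane 0 c⟩, inf_le_right, ρ, hρ⟩

namespace Ruling

/-! ### The excess of the strings -/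

variable {r : Ruling} {Z : surface.IdealSheafData} {U : surface.affineOpens} {c : ℂ}
  {hU : U.1 ≤ r.proj ⁻¹ᵁ cell c} {g : ℂ[X]}

lemma concentratedOn_fiber_ideal (hfin : IsFiniteSubscheme Z)
    (hZ : (Z.support : Set surface) ⊆ U.1) (hg : g.Monic)
    (hgZ : ∀ p, aeval (r.affine hU) p ∈ Z.ideal U ↔ g ∣ p) (a : ℂ) :
    (concentratedOn Z (r.fiber c a)).ideal U = Z.ideal U ⊔
    Ideal.span {(r.affine hU - algebraMap ℂ _ a) ^ g.rootMultiplicity a} := by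
  obtain ⟨h, hgh, hdvd⟩ := exists_eq_pow_rootMultiplicity_mul_and_not_dvd g hg.ne_zero a
  have hw : aeval (r.affine hU) (X - C a) = r.affine hU - algebraMap ℂ _ a := by
    rw [map_sub, aeval_X, aeval_C]
  refine concentratedOn_ideal hfin hZ (fiber_ideal a U hU) (s := aeval (r.affine hU) h) ?_ ?_
  · rw [← hw, ← map_pow, ← map_mul, ← hgh, hgZ]
  · rw [← hw]
    exact (((irreducible_X_sub_C a).coprime_iff_not_dvd).2 hdvd).map
      (aeval (R := ℂ) (r.affine hU)).toRingHom

lemma aeval_mem_concentratedOn_iff (hfin : IsFiniteSubscheme Z)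
    (hZ : (Z.support : Set surface) ⊆ U.1) (hg : g.Monic)
    (hgZ : ∀ p, aeval (r.affine hU) p ∈ Z.ideal U ↔ g ∣ p) (a : ℂ)
    (p : ℂ[X]) :
    aeval (r.affine hU) p ∈ (concentratedOn Z (r.fiber c a)).ideal U ↔
      (X - C a) ^ g.rootMultiplicity a ∣ p := by
  rw [concentratedOn_fiber_ideal hfin hZ hg hgZ]
  obtain ⟨h, hgh, -⟩ := exists_eq_pow_rootMultiplicity_mul_and_not_dvd g hg.ne_zero a
  set e := g.rootMultiplicity a
  have hw : aeval (r.affine hU) ((X - C a) ^ e) = (r.affine hU - algebraMap ℂ _ a) ^ e := by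
    rw [map_pow, map_sub, aeval_X, aeval_C]
  have hgI : aeval (r.affine hU) g ∈ Z.ideal U := (hgZ g).2 dvd_rfl
  constructor
  · intro hp
    obtain ⟨i, hi, x, hx, hix⟩ := Submodule.mem_sup.1 hp
    obtain ⟨b, rfl⟩ := Ideal.mem_span_singleton.1 hx
    have h1 : aeval (r.affine hU) (h * p) ∈ Z.ideal U := by
      have h2 : aeval (r.affine hU) (h * p) =
          aeval (r.affine hU) h * i + b * aeval (r.affine hU) g := by
        conv_rhs => rw [hgh]
        rw [map_mul, map_mul, ← hix, hw]
        ring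
      rw [h2]
      exact add_mem (Ideal.mul_mem_left _ _ hi) (Ideal.mul_mem_left _ _ hgI)
    rw [hgZ] at h1
    have hh : h ≠ 0 := by
      rintro rfl
      exact hg.ne_zero (by rw [hgh, mul_zero])
    refine (mul_dvd_mul_iff_left hh).1 ?_
    rwa [mul_comm h, ← hgh]
  · rintro ⟨q, rfl⟩
    rw [map_mul, hw]
    exact Ideal.mul_mem_right _ _ (Ideal.mem_sup_right (Ideal.mem_span_singleton_self _))

/-- The strings in terms of the ideal of `Z` in the ring of functions on an affine open set. -/
lemma getD_sigma (hfin : IsFiniteSubscheme Z)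
    (hZ : (Z.support : Set surface) ⊆ U.1) (hg : g.Monic)
    (hgZ : ∀ p, aeval (r.affine hU) p ∈ Z.ideal U ↔ g ∣ p) (a : ℂ)
    {j : ℕ} (hj : j < g.rootMultiplicity a) :
    (sigma r.bidegree (r.fiber c a) (concentratedOn Z (r.fiber c a))).getD j 0 =
      residualLength ℂ (r.affine hU - algebraMap ℂ _ a) j (Z.ideal U ⊔
        Ideal.span {(r.affine hU - algebraMap ℂ _ a) ^ g.rootMultiplicity a}) := by
  have hZ' := support_subset_of_le (le_concentratedOn Z (r.fiber c a)) hZ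
  have hideal := concentratedOn_fiber_ideal hfin hZ hg hgZ a
  rw [sigma, minDegree_eq hZ' ((monic_X_sub_C a).pow _)
    (aeval_mem_concentratedOn_iff hfin hZ hg hgZ a), natDegree_pow, natDegree_X_sub_C, mul_one,
    getD_rho (fiber_ideal a U hU) hj hZ', hideal]
  rw [hideal]
  exact Ideal.mem_sup_right (Ideal.mem_span_singleton_self _)

/-- The excess of the strings in terms of residual ideals; the truncated subtraction of natural
numbers accounts for the condition on the entries. -/
lemma excess_eq (hfin : IsFiniteSubscheme Z)
    (hZ : (Z.support : Set surface) ⊆ U.1) (hg : g.Monic)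
    (hgZ : ∀ p, aeval (r.affine hU) p ∈ Z.ideal U ↔ g ∣ p)
    {n : ℤ} {N : ℕ} (hN : (N : ℤ) = n + 1) : excess r.bidegree Z n =
    ((∑ a ∈ g.roots.toFinset, ∑ j ∈ Finset.range (g.rootMultiplicity a),
      (residualLength ℂ (r.affine hU - algebraMap ℂ _ a) j (Z.ideal U ⊔
        Ideal.span {(r.affine hU - algebraMap ℂ _ a) ^ g.rootMultiplicity a}) - N) : ℕ) : ℤ) := by
  rw [excess, minLines_eq hZ hg hgZ, finsum_mem_image (fiber_injective c).injOn,
    finsum_mem_coe_finset, Nat.cast_sum]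
  refine Finset.sum_congr rfl fun a _ => ?_
  rw [multiplicity_eq hZ hg hgZ, Finset.sum_filter, Nat.cast_sum]
  refine Finset.sum_congr rfl fun j hj => ?_
  rw [getD_sigma hfin hZ hg hgZ a (Finset.mem_range.1 hj)]
  split_ifs with h <;> omega

/-- If every fibre meets `Z` in a scheme of length at most `n + 1`, then there is no excess. -/
lemma excess_eq_zero (hfin : IsFiniteSubscheme Z) (hZ : (Z.support : Set surface) ⊆ U.1)
    (hg : g.Monic) (hgZ : ∀ p, aeval (r.affine hU) p ∈ Z.ideal U ↔ g ∣ p) {n : ℤ} (hn : -1 ≤ n)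
    (hlen : ∀ D, IsCurve r.bidegree.1 r.bidegree.2 D → (length (Z ⊔ D) : ℤ) ≤ n + 1) :
    excess r.bidegree Z n = 0 := by
  rw [excess_eq hfin hZ hg hgZ (Int.toNat_of_nonneg (show 0 ≤ n + 1 by omega)), Nat.cast_eq_zero]
  refine Finset.sum_eq_zero fun a _ => Finset.sum_eq_zero fun j hj => ?_
  set w := r.affine hU - algebraMap ℂ _ a with hw
  set e := g.rootMultiplicity a with he
  have h1 := hlen _ (isCurve_fiber c a)
  rw [length_eq (U := U) _ (support_subset_of_le le_sup_left hZ), Scheme.IdealSheafData.ideal_sup,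
    Pi.sup_apply, fiber_ideal a U hU, ← hw] at h1
  have := finite_quotient hfin hZ
  have := finite_quotient_ideal (K := ℂ) (le_sup_left : Z.ideal U ≤ Z.ideal U ⊔ Ideal.span {w ^ e})
  have h2 := residualLength_le (K := ℂ) w j (Z.ideal U ⊔ Ideal.span {w ^ e})
  have h3 : Z.ideal U ⊔ Ideal.span {w ^ e} ⊔ Ideal.span {w} = Z.ideal U ⊔ Ideal.span {w} := by
    rw [sup_assoc, sup_eq_right.2 (Ideal.span_singleton_le_span_singleton.2
      (dvd_pow_self w (Nat.ne_zero_of_lt (Finset.mem_range.1 hj))))]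
  rw [h3] at h2
  omega

/-- The codimension of the polynomials of bounded bidegree in the ring of functions on `Z` is the
excess of `Z`. -/
theorem finrank_quotient_eq_excess (hfin : IsFiniteSubscheme Z)
    (hZ : (Z.support : Set surface) ⊆ U.1) (hU : U.1 ≤ r.proj ⁻¹ᵁ cell c) {v : Γ(surface, U.1)}
    (hgen : Algebra.adjoin ℂ {r.affine hU, v} = ⊤) {M N : ℕ} (hM : minDegree r.bidegree Z ≤ M)
    {n : ℤ} (hN : (N : ℤ) = n + 1) :
    (minLines r.bidegree Z).Finite ∧
      (Module.finrank ℂ (Γ(surface, U.1) ⧸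
        ((Z.ideal U).restrictScalars ℂ ⊔ bidegreeSpace ℂ (r.affine hU) v M N)) : ℤ) =
          excess r.bidegree Z n ∧
      ((∀ D, IsCurve r.bidegree.1 r.bidegree.2 D → (length (Z ⊔ D) : ℤ) ≤ n + 1) →
        excess r.bidegree Z n = 0) := by
  have := finite_quotient hfin hZ
  set g := minpoly ℂ (Ideal.Quotient.mk (Z.ideal U) (r.affine hU)) with hgdef
  have hg : g.Monic := minpoly.monic (Algebra.IsIntegral.isIntegral _)
  have hgZ : ∀ p, aeval (r.affine hU) p ∈ Z.ideal U ↔ g ∣ p := fun p => by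
    rw [minpoly.dvd_iff, ← Ideal.Quotient.eq_zero_iff_mem, ← Ideal.Quotient.mkₐ_eq_mk ℂ,
      ← aeval_algHom_apply]
  refine ⟨?_, ?_, excess_eq_zero hfin hZ hg hgZ (by omega)⟩
  · rw [minLines_eq hZ hg hgZ]
    exact (Finset.finite_toSet _).image _
  · rw [minDegree_eq hZ hg hgZ] at hM
    rw [finrank_quotient_sup_bidegreeSpace hgen _ hM N, excess_eq hfin hZ hg hgZ hN]

end Ruling

end Quadric

end

theorem corollary2p4 (Z : Quadric.surface.IdealSheafData) (hZ : Quadric.IsFiniteSubscheme Z)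
    (m n : ℤ) :
    ((Quadric.mu Z : ℤ) - 1 ≤ m → -1 ≤ n →
      ((Quadric.minLines (1, 0) Z).Finite ∧
        Module.Finite ℂ (Quadric.H1 Z m n) ∧
        (Module.finrank ℂ (Quadric.H1 Z m n) : ℤ) = Quadric.excess (1, 0) Z n) ∧
      ((∀ D, Quadric.IsCurve 1 0 D → (Quadric.length (Z ⊔ D) : ℤ) ≤ n + 1) →
        Subsingleton (Quadric.H1 Z m n))) ∧
    ((Quadric.nu Z : ℤ) - 1 ≤ n → -1 ≤ m →
      ((Quadric.minLines (0, 1) Z).Finite ∧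
        Module.Finite ℂ (Quadric.H1 Z m n) ∧
        (Module.finrank ℂ (Quadric.H1 Z m n) : ℤ) = Quadric.excess (0, 1) Z m) ∧
      ((∀ E, Quadric.IsCurve 0 1 E → (Quadric.length (Z ⊔ E) : ℤ) ≤ m + 1) →
        Subsingleton (Quadric.H1 Z m n))) := by
  obtain ⟨c, c', hc⟩ := Quadric.exists_support_subset_plane hZ
  constructor
  · intro hm hn
    have hm' : -1 ≤ m := by omega
    have hM : Quadric.minDegree Quadric.firstRuling.bidegree Z ≤ (m + 1).toNat := by
      change Quadric.mu Z ≤ _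
      omega
    obtain ⟨h₁, h₂, h₃⟩ := Quadric.Ruling.finrank_quotient_eq_excess (r := Quadric.firstRuling)
      (U := ⟨Quadric.plane c c', Quadric.isAffineOpen_plane c c'⟩) hZ hc
      (hU := inf_le_left) (Quadric.adjoin_coord c c') hM
      (Int.toNat_of_nonneg (show 0 ≤ n + 1 by omega))
    rw [← Quadric.van_eq] at h₂
    have hfin := Quadric.finite_H1 hZ hc hm' hn
    have hdim := (congrArg Nat.cast (Quadric.finrank_H1 hc hm' hn)).trans h₂
    refine ⟨⟨h₁, hfin, hdim⟩, fun hlen => ?_⟩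
    rw [← Module.finrank_zero_iff (R := ℂ), ← Nat.cast_eq_zero (R := ℤ)]
    exact hdim.trans (h₃ hlen)
  · intro hn hm
    have hn' : -1 ≤ n := by omega
    have hM : Quadric.minDegree Quadric.secondRuling.bidegree Z ≤ (n + 1).toNat := by
      change Quadric.nu Z ≤ _
      omega
    obtain ⟨h₁, h₂, h₃⟩ := Quadric.Ruling.finrank_quotient_eq_excess (r := Quadric.secondRuling)
      (U := ⟨Quadric.plane c c', Quadric.isAffineOpen_plane c c'⟩) hZ hc
      (hU := inf_le_right) (v := Quadric.coord₁ c c')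
      ((congrArg (Algebra.adjoin ℂ) (Set.pair_comm _ _)).trans (Quadric.adjoin_coord c c')) hM
      (Int.toNat_of_nonneg (show 0 ≤ m + 1 by omega))
    rw [← Quadric.van_eq, Quadric.bidegreeSpace_comm] at h₂
    have hfin := Quadric.finite_H1 hZ hc hm hn'
    have hdim := (congrArg Nat.cast (Quadric.finrank_H1 hc hm hn')).trans h₂
    refine ⟨⟨h₁, hfin, hdim⟩, fun hlen => ?_⟩
    rw [← Module.finrank_zero_iff (R := ℂ), ← Nat.cast_eq_zero (R := ℤ)]
    exact hdim.trans (h₃ hlen)
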